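/- Let $M=\mathbb R\times\mathbb R\times S^2$ with points $(t,\ell,(\vartheta,\varphi))$ carry the metric $$g=-N^2\,dt^2+d\ell^2+R^2\big[d\vartheta^2+\sin^2\vartheta\,(d\varphi-\omega\,dt)^2\big],$$ where $N,R,\omega$ are functions of $(\ell,\vartheta)$ that are smooth on $\mathbb R\times S^2$, $N$ and $R$ are strictly positive, and, uniformly in $\vartheta$ as $\ell\to\pm\infty$, $$N=1+O(1/|\ell|),\quad R=|\ell|\,(1+O(1/|\ell|)),\quad \omega=O(1/|\ell|^2),$$ $$\partial_\ell N=O(1/|\ell|^2),\quad \partial_\ell R=\pm1+O(1/|\ell|),\quad \partial_\ell\omega=O(1/|\ell|^3).$$ Put $\Psi_\pm=-\dfrac{N}{R\sin\vartheta}\mp\omega$. Let $M_{\rm out}$ (resp. $M_{\rm in}$) be the set of all points at which $\partial_\ell\Psi_+$ and $\partial_\ell\Psi_-$ are both positive (resp. both negative), where on the axis $\sin\vartheta=0$ the sign of $\partial_\ell\Psi_\pm$ is understood as the sign of $\lim\,\sin\vartheta\,\partial_\ell\Psi_\pm=\partial_\ell(-N/R)$. Let $K=M\setminus(M_{\rm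 in}\cup M_{\rm out})$. Let $p\in M$, let $-\infty<\tau_a\le\infty$, and let $\gamma:\,]-\infty,\tau_a[\,\to M$ be a smooth future-pointing timelike curve with $t(\gamma(\tau))=\tau$ for all $\tau$, such that * the closure of $\gamma(\,]-\infty,\tau_a[\,)$ in $M$ does not meet the caustic of the past light-cone of $p$ (the set of all points conjugate to $p$ along a past-pointing lightlike geodesic from $p$), and * $|\ell(\gamma(\tau))|$ remains bounded as $\tau\to-\infty$. Let $W\subseteq M$ be any open set that contains $K$ and is invariant under the time translations $t\mapsto t+a$, $a\in\mathbb R$. Then all but finitely many past-pointing lightlike geodesic arcs from $p$ to a point of $\gamma$ intersect $W$. -/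

import Mathlib

open scoped ContDiff

noncomputable section

namespace RotatingWormhole

/-! The spacetime manifold `ℝ × ℝ × S²`, with points `(t, ℓ, n)`, is covered by one global chart:
`(t, ℓ, n)` has the coordinates `(t, e^ℓ n) ∈ ℝ × (ℝ³ ∖ {0})`.  A point of the spacetime is thus a
vector `x : Fin 4 → ℝ` with `x 0 = t` and `(x 1, x 2, x 3) = e^ℓ n ≠ 0`. -/

/-- Coordinate vectors `(t, x¹, x², x³)`, also used for tangent vectors. -/
abbrev Vec : Type := Fin 4 → ℝ

/-- The Euclidean length of the spatial part; it equals `e^ℓ`. -/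
def rad (x : Vec) : ℝ := √(x 1 ^ 2 + x 2 ^ 2 + x 3 ^ 2)

/-- The spacetime manifold `M ≅ ℝ × ℝ × S²` in its global chart. -/
def spacetime : Set Vec := {x | 0 < rad x}

/-- The radius coordinate `ℓ`. -/
def ell (x : Vec) : ℝ := Real.log (rad x)

/-- The polar angle `ϑ ∈ [0, π]`. -/
def theta (x : Vec) : ℝ := Real.arccos (x 3 / rad x)

/-- The metric coefficients `N(ℓ,ϑ)`, `R(ℓ,ϑ)`, `ω(ℓ,ϑ)` (`twist`) of a rotating traversable wormhole:
smooth functions on `ℝ × S²` (across the axis as well), with `N` and `R` strictly positive, and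
asymptotically flat at both ends, the asymptotics being uniform in `ϑ` and compatible with
differentiation with respect to `ℓ`. Only values at `ϑ ∈ [0, π]` matter. -/
structure Wormhole where
  N : ℝ → ℝ → ℝ
  R : ℝ → ℝ → ℝ
  twist : ℝ → ℝ → ℝ
  smooth_N : ContDiffOn ℝ ∞ (fun x : Vec => N (ell x) (theta x)) spacetime
  smooth_R : ContDiffOn ℝ ∞ (fun x : Vec => R (ell x) (theta x)) spacetime
  smooth_twist : ContDiffOn ℝ ∞ (fun x : Vec => twist (ell x) (theta x)) spacetime
  N_pos : ∀ l, ∀ θ ∈ Set.Icc 0 Real.pi, 0 < N l θ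
  R_pos : ∀ l, ∀ θ ∈ Set.Icc 0 Real.pi, 0 < R l θ
  asymptotics : ∃ C L : ℝ, 0 < L ∧ ∀ l, L ≤ |l| → ∀ θ ∈ Set.Icc 0 Real.pi,
    |N l θ - 1| ≤ C / |l| ∧
    |R l θ - (|l|)| ≤ C ∧
    |twist l θ| ≤ C / |l| ^ 2 ∧
    |deriv (fun l' => N l' θ) l| ≤ C / |l| ^ 2 ∧
    |deriv (fun l' => R l' θ) l - SignType.sign l| ≤ C / |l| ∧
    |deriv (fun l' => twist l' θ) l| ≤ C / |l| ^ 3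

namespace Wormhole

variable (S : Wormhole)

/-- The spatial part of `v - dt(v) (∂_t + ω ∂_φ)`, where `∂_φ = (0, -x², x¹, 0)`; its `φ`-component
is `(dφ - ω dt)(v)`. -/
def shifted (x v : Vec) : Vec :=
  ![0, v 1 + S.twist (ell x) (theta x) * x 2 * v 0, v 2 - S.twist (ell x) (theta x) * x 1 * v 0, v 3]

end Wormhole

/-- The differential `dℓ` at `x`. -/
def dEll (x v : Vec) : ℝ := (x 1 * v 1 + x 2 * v 2 + x 3 * v 3) / rad x ^ 2

/-- The pullback to `x` of the round metric `dϑ² + sin²ϑ dφ²` of the unit sphere. -/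
def roundMetric (x v w : Vec) : ℝ :=
  (v 1 * w 1 + v 2 * w 2 + v 3 * w 3) / rad x ^ 2 - dEll x v * dEll x w

namespace Wormhole

variable (S : Wormhole)

/-- The spacetime metric
`g = -N² dt² + dℓ² + R² (dϑ² + sin²ϑ (dφ - ω dt)²)`. -/
def metric (x v w : Vec) : ℝ :=
  -(S.N (ell x) (theta x)) ^ 2 * v 0 * w 0 + dEll x v * dEll x w +
    (S.R (ell x) (theta x)) ^ 2 * roundMetric x (S.shifted x v) (S.shifted x w)

/-- The component matrix `g_{ij}` in the global chart. -/
def metricMatrix (x : Vec) : Matrix (Fin 4) (Fin 4) ℝ :=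
  Matrix.of fun i j => S.metric x (Pi.single i 1) (Pi.single j 1)

/-- The partial derivative `∂_k g_{ij}`. -/
def dMetric (x : Vec) (k i j : Fin 4) : ℝ :=
  fderiv ℝ (fun y => S.metricMatrix y i j) x (Pi.single k 1)

/-- The Christoffel symbol `Γ^k_{ij}` of the Levi-Civita connection. -/
def christoffel (x : Vec) (k i j : Fin 4) : ℝ :=
  (1 / 2) * ∑ l, (S.metricMatrix x)⁻¹ k l *
    (S.dMetric x i j l + S.dMetric x j i l - S.dMetric x l i j)

/-- The vector `Γ^k_{ij} v^i w^j`. -/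
def Γ (x v w : Vec) : Vec := fun k => ∑ i, ∑ j, S.christoffel x k i j * v i * w j

/-- `c : [0,1] → M` is an affinely parametrised geodesic with tangent field `u`. -/
def IsGeodesic (c u : ℝ → Vec) : Prop :=
  ∀ s ∈ Set.Icc (0 : ℝ) 1, c s ∈ spacetime ∧
    HasDerivWithinAt c (u s) (Set.Icc 0 1) s ∧
    HasDerivWithinAt u (-S.Γ (c s) (u s) (u s)) (Set.Icc 0 1) s

/-- `c : [0,1] → M` is a past-pointing lightlike geodesic with tangent field `u`. -/
def IsPastNullGeodesic (c u : ℝ → Vec) : Prop :=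
  S.IsGeodesic c u ∧ ∀ s ∈ Set.Icc (0 : ℝ) 1, S.metric (c s) (u s) (u s) = 0 ∧ u s 0 < 0

/-- `J` is a Jacobi field along the geodesic `c : [0,1] → M` with tangent field `u`: it solves the
linearised geodesic equation. -/
def IsJacobiField (c u J : ℝ → Vec) : Prop :=
  ∃ P : ℝ → Vec, ∀ s ∈ Set.Icc (0 : ℝ) 1,
    HasDerivWithinAt J (P s) (Set.Icc 0 1) s ∧
    HasDerivWithinAt P
      (-fderiv ℝ (fun y => S.Γ y (u s) (u s)) (c s) (J s) - (2 : ℝ) • S.Γ (c s) (u s) (P s))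
      (Set.Icc 0 1) s

/-- The caustic of the past light-cone of `p`: all points conjugate to `p` along some past-pointing
lightlike geodesic. -/
def caustic (p : Vec) : Set Vec :=
  {q | ∃ c u J : ℝ → Vec, S.IsPastNullGeodesic c u ∧ c 0 = p ∧ c 1 = q ∧
    S.IsJacobiField c u J ∧ J 0 = 0 ∧ J 1 = 0 ∧ ∃ s ∈ Set.Icc (0 : ℝ) 1, J s ≠ 0}

/-- The past-pointing lightlike geodesics from `p` to the set `A`, as unparametrised arcs (the time
coordinate is strictly monotonic along each, so an arc is determined by its point set). -/
def pastNullArcs (p : Vec) (A : Set Vec) : Set (Set Vec) :=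
  {G | ∃ c u : ℝ → Vec, S.IsPastNullGeodesic c u ∧ c 0 = p ∧ c 1 ∈ A ∧ G = c '' Set.Icc 0 1}

/-- The potentials `Ψ_± = -N / (R sin ϑ) ∓ ω`, where `σ = 1` for `Ψ_+` and `σ = -1` for `Ψ_-`. -/
def Psi (σ l θ : ℝ) : ℝ := -S.N l θ / (S.R l θ * Real.sin θ) - σ * S.twist l θ

/-- The radial derivative `∂_ℓ Ψ_±`. On the axis `sin ϑ = 0`, where `Ψ_±` is singular, it is replaced
by `∂_ℓ (-N / R)`, the limit of `sin ϑ ∂_ℓ Ψ_±`, which carries the sign of `∂_ℓ Ψ_±`. -/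
def dPsi (σ l θ : ℝ) : ℝ :=
  if Real.sin θ = 0 then deriv (fun l' => -S.N l' θ / S.R l' θ) l
  else deriv (fun l' => S.Psi σ l' θ) l

/-- The region where `∂_ℓ Ψ_+` and `∂_ℓ Ψ_-` are both positive. -/
def Mout : Set Vec :=
  {x ∈ spacetime | 0 < S.dPsi 1 (ell x) (theta x) ∧ 0 < S.dPsi (-1) (ell x) (theta x)}

/-- The region where `∂_ℓ Ψ_+` and `∂_ℓ Ψ_-` are both negative. -/
def Min : Set Vec :=
  {x ∈ spacetime | S.dPsi 1 (ell x) (theta x) < 0 ∧ S.dPsi (-1) (ell x) (theta x) < 0}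

/-- The closed region `K = M ∖ (M_in ∪ M_out)`. -/
def K : Set Vec := spacetime \ (S.Min ∪ S.Mout)

/-- `γ`, defined for all times `τ < τa`, is a smooth future-pointing timelike curve parametrised by
the time coordinate. -/
def IsTimelikeCurve (τa : EReal) (γ : ℝ → Vec) : Prop :=
  ContDiffOn ℝ ∞ γ {τ : ℝ | (τ : EReal) < τa} ∧
    ∀ τ : ℝ, (τ : EReal) < τa →
      γ τ ∈ spacetime ∧ γ τ 0 = τ ∧ S.metric (γ τ) (deriv γ τ) (deriv γ τ) < 0

end Wormhole

end RotatingWormhole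

end

/-! ### Flows of compactly supported vector fields over the unit time interval. -/

namespace UnitIntervalFlow

open Set Metric Filter Topology
open scoped NNReal

variable {E : Type*} [NormedAddCommGroup E] [NormedSpace ℝ E]

/-! An arc that avoids `W` avoids `K`, so by connectedness it lies entirely in M_out (σ = 1) or
entirely in M_in (σ = -1). Along a lightlike geodesic the second derivative of ℓ is half of the Lie
derivative of the metric along ∂_ℓ, evaluated on the tangent. Where ℓ' = 0, the null condition and a
Cauchy–Schwarz estimate of the rotational term show that this second derivative has the sign σ
(`radialForce_pos`). Hence every turning point of σℓ is a strict local minimum.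

This confines the arcs. From above, σℓ is bounded by its values at the two ends, which are p and a
point of γ. From below it is bounded because asymptotic flatness keeps M_out away from ℓ → -∞ and
M_in away from ℓ → +∞ (`exists_far_bound`). Over a compact set of positions modulo time translation
the geodesic cannot linger: with T = -t and y = σ dℓ/dT, the bounded quantity exp(kσℓ) y grows at a
uniform positive rate in T for a suitable k (`duration_le`). So the duration is bounded, and then
the velocity too; all avoiding arcs live over one compact subset of the tangent bundle
(`exists_compact_confinement`).

Suppose there were infinitely many avoiding initial velocities. They would accumulate at some a,
whose geodesic ends in the closure of γ and hence not on the caustic, so the exponential map at p is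
a local diffeomorphism near a. Pull γ back to a curve v(τ) of initial velocities and put q(τ) =
g(v,v) at p. At a zero of q, the Gauss lemma turns q' = 2 g(v,v') into 2 g(u,γ') at the end of the
geodesic, which is positive because u is past-pointing lightlike and γ' is future-pointing timelike.
Zeros that are all crossed upwards cannot occur twice, so velocities of avoiding arcs close to a
coincide (`exists_nhds_unique`), contradicting accumulation (`finite_avoidingVelocities`). -/

theorem hasDerivWithinAt_Ici {g : ℝ → E} {g' : E} {s : ℝ} (hs : s ∈ Ico (0 : ℝ) 1)
    (h : HasDerivWithinAt g g' (Icc 0 1) s) : HasDerivWithinAt g g' (Ici s) s :=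
  h.mono_of_mem_nhdsWithin <|
    mem_of_superset (Icc_mem_nhdsGE hs.2) (Icc_subset_Icc_left hs.1)

/-- Grönwall's inequality on the unit interval, with a constant that is easy to handle. -/
theorem norm_le_of_norm_deriv_le {g g' : ℝ → E} {K ε : ℝ} (hε : 0 ≤ ε) (hK : 0 ≤ K)
    (hg : ∀ s ∈ Icc (0 : ℝ) 1, HasDerivWithinAt g (g' s) (Icc 0 1) s)
    (bound : ∀ s ∈ Icc (0 : ℝ) 1, ‖g' s‖ ≤ K * ‖g s‖ + ε) :
    ∀ s ∈ Icc (0 : ℝ) 1, ‖g s‖ ≤ (‖g 0‖ + ε) * Real.exp (K + 1) := by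
  intro s hs
  -- The rate `K + 1` instead of `K` avoids the separate formula of `gronwallBound` at rate zero and
  -- gives `ε / (K + 1) ≤ ε`.
  have h := norm_le_gronwallBound_of_norm_deriv_right_le (f := g) (f' := g') (δ := ‖g 0‖)
    (K := K + 1) (ε := ε) (a := 0) (b := 1) (fun s hs => (hg s hs).continuousWithinAt)
    (fun s hs => hasDerivWithinAt_Ici hs (hg s (Ico_subset_Icc_self hs))) le_rfl
    (fun s hs => (bound s (Ico_subset_Icc_self hs)).trans
      (by nlinarith [norm_nonneg (g s)])) s hs
  refine h.trans ?_
  rw [gronwallBound_of_K_ne_0 (by positivity)]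
  have h1 : Real.exp ((K + 1) * (s - 0)) ≤ Real.exp (K + 1) :=
    Real.exp_le_exp.2 (by nlinarith [hs.2])
  have h2 : ε / (K + 1) ≤ ε := div_le_self hε (by linarith)
  have h3 : 1 ≤ Real.exp ((K + 1) * (s - 0)) :=
    Real.one_le_exp (mul_nonneg (by linarith) (by linarith [hs.1]))
  have h4 : 0 ≤ ε / (K + 1) := by positivity
  have h5 := norm_nonneg (g 0)
  calc ‖g 0‖ * Real.exp ((K + 1) * (s - 0)) + ε / (K + 1) * (Real.exp ((K + 1) * (s - 0)) - 1)
      ≤ ‖g 0‖ * Real.exp (K + 1) + ε * Real.exp (K + 1) := by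
        gcongr
        linarith
    _ = _ := by ring

theorem eqOn_of_linear {A : ℝ → E →L[ℝ] E} {K : ℝ} (hK : 0 ≤ K)
    (hA : ∀ s ∈ Icc (0 : ℝ) 1, ‖A s‖ ≤ K) {Y Z : ℝ → E}
    (hY : ∀ s ∈ Icc (0 : ℝ) 1, HasDerivWithinAt Y (A s (Y s)) (Icc 0 1) s)
    (hZ : ∀ s ∈ Icc (0 : ℝ) 1, HasDerivWithinAt Z (A s (Z s)) (Icc 0 1) s) (h0 : Y 0 = Z 0) :
    EqOn Y Z (Icc 0 1) := by
  intro s hs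
  have := norm_le_of_norm_deriv_le (g := Y - Z) (ε := 0) le_rfl hK
    (fun s hs => (hY s hs).sub (hZ s hs)) (fun s hs => by
      rw [← map_sub, add_zero]
      exact (A s).le_of_opNorm_le (hA s hs) _) s hs
  have h0' : (Y - Z) 0 = 0 := by simp [h0]
  rw [h0', norm_zero, zero_add, zero_mul, norm_le_zero_iff] at this
  exact sub_eq_zero.1 this

theorem unique {f : E → E} {K : ℝ≥0} (hf : LipschitzWith K f) {Y Z : ℝ → E}
    (hY : ∀ s ∈ Icc (0 : ℝ) 1, HasDerivWithinAt Y (f (Y s)) (Icc 0 1) s)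
    (hZ : ∀ s ∈ Icc (0 : ℝ) 1, HasDerivWithinAt Z (f (Z s)) (Icc 0 1) s) (h0 : Y 0 = Z 0) :
    EqOn Y Z (Icc 0 1) :=
  ODE_solution_unique_of_mem_Icc_right (v := fun _ => f) (s := fun _ => univ)
    (fun _ _ => hf.lipschitzOnWith) (fun s hs => (hY s hs).continuousWithinAt)
    (fun s hs => hasDerivWithinAt_Ici hs (hY s (Ico_subset_Icc_self hs))) (fun _ _ => mem_univ _)
    (fun s hs => (hZ s hs).continuousWithinAt)
    (fun s hs => hasDerivWithinAt_Ici hs (hZ s (Ico_subset_Icc_self hs))) (fun _ _ => mem_univ _) h0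

/-- Differentiability of a compactly supported vector field, uniformly in the base point. -/
theorem exists_uniform_linearization {f : E → E} (hf : ContDiff ℝ 1 f) (hc : HasCompactSupport f)
    {η : ℝ} (hη : 0 < η) : ∃ r > 0, ∀ z x y, ‖x - z‖ ≤ r → ‖y - z‖ ≤ r →
      ‖f x - f y - fderiv ℝ f z (x - y)‖ ≤ η * ‖x - y‖ := by
  have huc : UniformContinuous (fderiv ℝ f) :=
    (hc.fderiv ℝ).uniformContinuous_of_continuous (hf.continuous_fderiv one_ne_zero)
  obtain ⟨δ, hδ, h⟩ := Metric.uniformContinuous_iff.1 huc η hη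
  refine ⟨δ / 2, by positivity, fun z x y hx hy => ?_⟩
  refine Convex.norm_image_sub_le_of_norm_hasFDerivWithin_le' (s := closedBall z (δ / 2))
    (f' := fderiv ℝ f) (fun v _ => (hf.differentiable one_ne_zero v).hasFDerivAt.hasFDerivWithinAt)
    (fun v hv => ?_) (convex_closedBall _ _) (mem_closedBall_iff_norm.2 hy)
    (mem_closedBall_iff_norm.2 hx)
  rw [← dist_eq_norm]
  exact (h (lt_of_le_of_lt (mem_closedBall.1 hv) (by linarith))).le

variable [FiniteDimensional ℝ E]

/-- A field bounded by `L` moves a point by at most `L` in unit time, so Picard–Lindelöf on the ball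
of radius `L` about `w` already covers all of `[0,1]`. -/
theorem exists_solution_of_bounded {f : ℝ → E → E} {K L : ℝ≥0} (hf : ∀ s, LipschitzWith K (f s))
    (hc : ∀ x, ContinuousOn (fun s => f s x) (Icc 0 1))
    (hL : ∀ s ∈ Icc (0 : ℝ) 1, ∀ x, ‖f s x‖ ≤ L) (w : E) :
    ∃ Y : ℝ → E, Y 0 = w ∧ ∀ s ∈ Icc (0 : ℝ) 1, HasDerivWithinAt Y (f s (Y s)) (Icc 0 1) s := by
  have := FiniteDimensional.complete ℝ E
  have hpl : IsPicardLindelof f (tmin := 0) (tmax := 1) ⟨0, by simp⟩ w L 0 L K :=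
    { lipschitzOnWith := fun t _ => (hf t).lipschitzOnWith
      continuousOn := fun x _ => hc x
      norm_le := fun t ht x _ => hL t ht x
      mul_max_le := by simp }
  exact hpl.exists_eq_forall_mem_Icc_hasDerivWithinAt₀

/-- A linear field is unbounded, so it is cut off outside a ball whose radius exceeds the Grönwall
bound. The solution of the truncated equation never leaves that ball and therefore solves the
original one. -/
theorem exists_linear_solution {A : ℝ → E →L[ℝ] E} (hA : ContinuousOn A (Icc 0 1)) (w : E) :
    ∃ Y : ℝ → E, Y 0 = w ∧ ∀ s ∈ Icc (0 : ℝ) 1, HasDerivWithinAt Y (A s (Y s)) (Icc 0 1) s := by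
  obtain ⟨K, hK⟩ := isCompact_Icc.exists_bound_of_continuousOn hA
  have hK0 : 0 ≤ K := (norm_nonneg _).trans (hK 0 (by simp))
  set r : ℝ := ‖w‖ * Real.exp (K + 1) + 1 with hr
  have hr0 : 0 < r := by positivity
  let χ : ContDiffBump (0 : E) := ⟨r, 2 * r, hr0, by linarith⟩
  set ρ : E → E := fun Y => χ Y • Y with hρ
  have hρc : ContDiff ℝ 1 ρ := χ.contDiff.smul contDiff_id
  have hρs : HasCompactSupport ρ := χ.hasCompactSupport.smul_right
  obtain ⟨Kρ, hKρ⟩ : ∃ K, LipschitzWith K ρ :=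
    ContDiff.lipschitzWith_of_hasCompactSupport hρs hρc one_ne_zero
  have hρ1 : ∀ Y, ‖ρ Y‖ ≤ ‖Y‖ := fun Y => by
    rw [hρ, norm_smul, Real.norm_of_nonneg χ.nonneg]
    exact mul_le_of_le_one_left (norm_nonneg _) χ.le_one
  obtain ⟨L, hL⟩ := hρs.exists_bound_of_continuous hρc.continuous
  have hL0 : 0 ≤ L := (norm_nonneg _).trans (hL 0)
  obtain ⟨Y, hY0, hY⟩ := exists_solution_of_bounded (E := E)
    (f := fun s Y => A (projIcc 0 1 zero_le_one s) (ρ Y)) (K := K.toNNReal * Kρ)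
    (L := (K * L).toNNReal)
    (fun s => (((A _).lipschitz.weaken (by
      rw [← NNReal.coe_le_coe, Real.coe_toNNReal _ hK0]
      exact hK _ (projIcc 0 1 zero_le_one s).2)).comp hKρ))
    (fun x => ((hA.congr fun s hs => by rw [projIcc_of_mem zero_le_one hs]).clm_apply
      continuousOn_const))
    (fun s _ x => by
      rw [Real.coe_toNNReal _ (by positivity)]
      exact ((A _).le_opNorm _).trans
        (mul_le_mul (hK _ (projIcc 0 1 zero_le_one s).2) (hL _) (norm_nonneg _) hK0)) w
  have hY' : ∀ s ∈ Icc (0 : ℝ) 1, HasDerivWithinAt Y (A s (ρ (Y s))) (Icc 0 1) s := fun s hs => by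
    simpa only [projIcc_of_mem zero_le_one hs] using hY s hs
  have hb := norm_le_of_norm_deriv_le le_rfl hK0 hY' (fun s hs => by
    rw [add_zero]
    exact ((A s).le_of_opNorm_le (hK s hs) _).trans (mul_le_mul_of_nonneg_left (hρ1 _) hK0))
  refine ⟨Y, hY0, fun s hs => ?_⟩
  have h1 : χ (Y s) = 1 := χ.one_of_mem_closedBall (by
    rw [mem_closedBall_zero_iff]
    have := hb s hs
    rw [hY0, add_zero] at this
    change ‖Y s‖ ≤ r
    linarith)
  have := hY' s hs
  rwa [show ρ (Y s) = Y s by rw [hρ]; simp only [h1, one_smul]] at this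

/-- The propagator of a linear differential equation. -/
theorem exists_propagator {A : ℝ → E →L[ℝ] E} (hA : ContinuousOn A (Icc 0 1)) :
    ∃ D : ℝ → E →L[ℝ] E, D 0 = ContinuousLinearMap.id ℝ E ∧
      ∀ s ∈ Icc (0 : ℝ) 1, ∀ w, HasDerivWithinAt (fun s => D s w) (A s (D s w)) (Icc 0 1) s := by
  obtain ⟨K, hK⟩ := isCompact_Icc.exists_bound_of_continuousOn hA
  have hK0 : 0 ≤ K := (norm_nonneg _).trans (hK 0 (by simp))
  choose Y hY0 hY using exists_linear_solution hA
  have h0 : (0 : ℝ) ∈ Icc (0 : ℝ) 1 := by simp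
  classical
  have hadd : ∀ s ∈ Icc (0 : ℝ) 1, ∀ w w', Y (w + w') s = Y w s + Y w' s := fun s hs w w' =>
    eqOn_of_linear hK0 hK (hY _) (Z := fun s => Y w s + Y w' s)
      (fun s hs => by rw [map_add]; exact (hY w s hs).add (hY w' s hs))
      (by simp only [hY0]) hs
  have hsmul : ∀ s ∈ Icc (0 : ℝ) 1, ∀ (a : ℝ) w, Y (a • w) s = a • Y w s := fun s hs a w =>
    eqOn_of_linear hK0 hK (hY _) (Z := fun s => a • Y w s)
      (fun s hs => by rw [map_smul]; exact (hY w s hs).const_smul a)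
      (by simp only [hY0]) hs
  let D : ℝ → E →L[ℝ] E := fun s => LinearMap.toContinuousLinearMap
    { toFun := fun w => Y w (projIcc 0 1 zero_le_one s)
      map_add' := hadd _ (projIcc 0 1 zero_le_one s).2
      map_smul' := hsmul _ (projIcc 0 1 zero_le_one s).2 }
  have hD : ∀ s ∈ Icc (0 : ℝ) 1, ∀ w, D s w = Y w s := fun s hs w => by
    change Y w (projIcc 0 1 zero_le_one s) = _
    rw [projIcc_of_mem zero_le_one hs]
  refine ⟨D, ContinuousLinearMap.ext fun w => by rw [hD 0 h0, hY0]; rfl, fun s hs w => ?_⟩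
  rw [hD s hs]
  exact (hY w s hs).congr_of_mem (fun s hs => hD s hs w) hs

/-- The flow of a compactly supported `C¹` vector field for times in `[0,1]` is Lipschitz and
strictly differentiable in the initial value; its derivative solves the linearised equation. -/
theorem exists_flow {f : E → E} (hf : ContDiff ℝ 1 f) (hc : HasCompactSupport f) :
    ∃ φ : E → ℝ → E, (∀ z, φ z 0 = z) ∧
      (∀ z, ∀ s ∈ Icc (0 : ℝ) 1, HasDerivWithinAt (φ z) (f (φ z s)) (Icc 0 1) s) ∧
      (∃ C : ℝ, 0 ≤ C ∧ ∀ z z', ∀ s ∈ Icc (0 : ℝ) 1, ‖φ z s - φ z' s‖ ≤ C * ‖z - z'‖) ∧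
      ∀ z, ∃ D : ℝ → E →L[ℝ] E, D 0 = ContinuousLinearMap.id ℝ E ∧
        (∀ s ∈ Icc (0 : ℝ) 1, ∀ w,
          HasDerivWithinAt (fun s => D s w) (fderiv ℝ f (φ z s) (D s w)) (Icc 0 1) s) ∧
        ∀ s ∈ Icc (0 : ℝ) 1, HasStrictFDerivAt (fun z => φ z s) (D s) z := by
  obtain ⟨K, hK⟩ : ∃ K, LipschitzWith K f :=
    ContDiff.lipschitzWith_of_hasCompactSupport hc hf one_ne_zero
  obtain ⟨L, hL⟩ := hc.exists_bound_of_continuous hf.continuous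
  choose φ hφ0 hφ using exists_solution_of_bounded (f := fun _ : ℝ => f) (K := K)
    (L := L.toNNReal) (fun _ => hK) (fun _ => continuousOn_const)
    (fun _ _ x => (hL x).trans (Real.le_coe_toNNReal L))
  have hlip : ∀ z z', ∀ s ∈ Icc (0 : ℝ) 1,
      ‖φ z s - φ z' s‖ ≤ Real.exp (K + 1) * ‖z - z'‖ := fun z z' s hs => by
    have := norm_le_of_norm_deriv_le (g := φ z - φ z') le_rfl K.2
      (fun s hs => (hφ z s hs).sub (hφ z' s hs))
      (fun s hs => by simpa using hK.norm_sub_le (φ z s) (φ z' s)) s hs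
    simpa [hφ0, mul_comm] using this
  refine ⟨φ, hφ0, hφ, ⟨_, (Real.exp_pos _).le, hlip⟩, fun z => ?_⟩
  have hAc : ContinuousOn (fun s => fderiv ℝ f (φ z s)) (Icc 0 1) :=
    (hf.continuous_fderiv one_ne_zero).comp_continuousOn
      fun s hs => (hφ z s hs).continuousWithinAt
  obtain ⟨D, hD0, hD⟩ := exists_propagator hAc
  refine ⟨D, hD0, fun s hs w => hD s hs w, fun s hs => ?_⟩
  obtain ⟨K', hK'⟩ := isCompact_Icc.exists_bound_of_continuousOn hAc
  have hK'0 : 0 ≤ K' := (norm_nonneg _).trans (hK' 0 (by simp))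
  rw [hasStrictFDerivAt_iff_isLittleO, Asymptotics.isLittleO_iff]
  intro ε hε
  set C := Real.exp (K + 1)
  have hC : 0 < C := Real.exp_pos _
  set C' := Real.exp (K' + 1)
  have hC' : 0 < C' := Real.exp_pos _
  -- The remainder `φ x - φ y - D (x - y)` solves the linearised equation up to an error `η ‖φ x - φ
  -- y‖ ≤ η C ‖x - y‖`. Grönwall multiplies this by `C'`, so `η = ε / (C C')` leaves exactly `ε ‖x -
  -- y‖`.
  obtain ⟨r, hr, hlin⟩ := exists_uniform_linearization hf hc (η := ε / (C * C')) (by positivity)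
  have hnear : ∀ᶠ x in 𝓝 z, ‖x - z‖ ≤ r / C := by
    filter_upwards [closedBall_mem_nhds z (show 0 < r / C by positivity)] with x hx
    exact mem_closedBall_iff_norm.1 hx
  rw [nhds_prod_eq]
  filter_upwards [hnear.prod_mk hnear] with ⟨x, y⟩ ⟨hx, hy⟩
  have hclose : ∀ x, ‖x - z‖ ≤ r / C → ∀ s ∈ Icc (0 : ℝ) 1, ‖φ x s - φ z s‖ ≤ r :=
    fun x hx s hs => (hlip x z s hs).trans (by rw [mul_comm]; exact (le_div_iff₀ hC).1 hx)
  have := norm_le_of_norm_deriv_le (g := fun s => φ x s - φ y s - D s (x - y))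
    (ε := ε / (C * C') * (C * ‖x - y‖)) (by positivity) hK'0
    (fun s hs => ((hφ x s hs).sub (hφ y s hs)).sub (hD s hs (x - y))) (fun s hs => by
      have e : f (φ x s) - f (φ y s) - fderiv ℝ f (φ z s) (D s (x - y)) =
          fderiv ℝ f (φ z s) (φ x s - φ y s - D s (x - y)) +
          (f (φ x s) - f (φ y s) - fderiv ℝ f (φ z s) (φ x s - φ y s)) := by
        simp only [map_sub]; abel
      rw [e]
      refine (norm_add_le _ _).trans (add_le_add ?_ ?_)
      · exact ContinuousLinearMap.le_of_opNorm_le _ (hK' s hs) _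
      · refine (hlin _ _ _ (hclose x hx s hs) (hclose y hy s hs)).trans ?_
        gcongr
        exact hlip x y s hs) s hs
  refine this.trans (le_of_eq ?_)
  simp only [hφ0, hD0, ContinuousLinearMap.id_apply, sub_self, norm_zero, zero_add]
  change ε / (C * C') * (C * ‖x - y‖) * C' = _
  field_simp

end UnitIntervalFlow

/-! ### The metric as a smooth nondegenerate form, and its Christoffel symbols. -/

noncomputable section

namespace RotatingWormhole

open Set Filter Topology

theorem rad_sq (x : Vec) : rad x ^ 2 = x 1 ^ 2 + x 2 ^ 2 + x 3 ^ 2 :=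
  Real.sq_sqrt (by positivity)

theorem continuous_rad : Continuous rad := by
  unfold rad
  fun_prop

theorem isOpen_spacetime : IsOpen spacetime := isOpen_lt continuous_const continuous_rad

theorem rad_sq_pos {x : Vec} (hx : x ∈ spacetime) : 0 < rad x ^ 2 := pow_pos hx 2

theorem contDiff_rad_sq : ContDiff ℝ ∞ (fun x => rad x ^ 2) := by
  simp only [rad_sq]
  fun_prop

theorem contDiffOn_dEll (v : Vec) : ContDiffOn ℝ ∞ (fun x => dEll x v) spacetime := by
  unfold dEll
  exact ContDiffOn.div (by fun_prop) contDiff_rad_sq.contDiffOn fun x hx => (rad_sq_pos hx).ne'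

/-- Lagrange's identity for the round metric. -/
theorem roundMetric_self {x : Vec} (hx : x ∈ spacetime) (v : Vec) :
    roundMetric x v v = ((x 1 * v 2 - x 2 * v 1) ^ 2 + (x 2 * v 3 - x 3 * v 2) ^ 2 +
      (x 3 * v 1 - x 1 * v 3) ^ 2) / (rad x ^ 2) ^ 2 := by
  have h := (rad_sq_pos hx).ne'
  unfold roundMetric dEll
  rw [rad_sq] at *
  field_simp
  ring

theorem roundMetric_self_nonneg {x : Vec} (hx : x ∈ spacetime) (v : Vec) :
    0 ≤ roundMetric x v v := by
  rw [roundMetric_self hx]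
  positivity

theorem eq_sum_single (v : Vec) : v = ∑ i, v i • (Pi.single i 1 : Vec) := by
  funext j
  simp [Finset.sum_apply, Pi.single_apply]

namespace Wormhole

variable (S : Wormhole)

/-- The lapse as a function on the spacetime. -/
def lapse (x : Vec) : ℝ := S.N (ell x) (theta x)

/-- The areal radius as a function on the spacetime. -/
def areal (x : Vec) : ℝ := S.R (ell x) (theta x)

/-- The angular velocity as a function on the spacetime. -/
def rot (x : Vec) : ℝ := S.twist (ell x) (theta x)

theorem contDiffOn_lapse : ContDiffOn ℝ ∞ S.lapse spacetime := S.smooth_N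
theorem contDiffOn_areal : ContDiffOn ℝ ∞ S.areal spacetime := S.smooth_R
theorem contDiffOn_rot : ContDiffOn ℝ ∞ S.rot spacetime := S.smooth_twist

theorem theta_mem (x : Vec) : theta x ∈ Icc 0 Real.pi :=
  ⟨Real.arccos_nonneg _, Real.arccos_le_pi _⟩

theorem lapse_pos (x : Vec) : 0 < S.lapse x := S.N_pos _ _ (theta_mem x)
theorem areal_pos (x : Vec) : 0 < S.areal x := S.R_pos _ _ (theta_mem x)

theorem metric_def (x v w : Vec) : S.metric x v w =
    -(S.lapse x) ^ 2 * v 0 * w 0 + dEll x v * dEll x w +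
      (S.areal x) ^ 2 * roundMetric x (S.shifted x v) (S.shifted x w) := rfl

theorem shifted_one (x v : Vec) : S.shifted x v 1 = v 1 + S.rot x * x 2 * v 0 := rfl
theorem shifted_two (x v : Vec) : S.shifted x v 2 = v 2 - S.rot x * x 1 * v 0 := rfl
theorem shifted_three (x v : Vec) : S.shifted x v 3 = v 3 := rfl

theorem dEll_shifted (x v : Vec) : dEll x (S.shifted x v) = dEll x v := by
  unfold dEll
  rw [shifted_one, shifted_two, shifted_three]
  ring

theorem roundMetric_shifted (x v w : Vec) : roundMetric x (S.shifted x v) (S.shifted x w) =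
    ((v 1 + S.rot x * x 2 * v 0) * (w 1 + S.rot x * x 2 * w 0) +
      (v 2 - S.rot x * x 1 * v 0) * (w 2 - S.rot x * x 1 * w 0) + v 3 * w 3) / rad x ^ 2 -
      dEll x v * dEll x w := by
  rw [roundMetric, dEll_shifted, dEll_shifted]
  simp only [shifted_one, shifted_two, shifted_three]

theorem metric_comm (x v w : Vec) : S.metric x v w = S.metric x w v := by
  rw [metric_def, metric_def, roundMetric_shifted, roundMetric_shifted]
  ring

theorem metric_add_left (x v v' w : Vec) :
    S.metric x (v + v') w = S.metric x v w + S.metric x v' w := by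
  simp only [metric_def, roundMetric_shifted, dEll, Pi.add_apply]
  ring

theorem metric_smul_left (x : Vec) (a : ℝ) (v w : Vec) :
    S.metric x (a • v) w = a * S.metric x v w := by
  simp only [metric_def, roundMetric_shifted, dEll, Pi.smul_apply, smul_eq_mul]
  ring

/-- The metric as a bilinear form. -/
def form (x : Vec) : LinearMap.BilinForm ℝ Vec :=
  LinearMap.mk₂ ℝ (S.metric x) (S.metric_add_left x) (S.metric_smul_left x)
    (fun v w w' => by rw [metric_comm, metric_add_left, metric_comm, S.metric_comm x w'])
    (fun a v w => by rw [metric_comm, metric_smul_left, metric_comm, smul_eq_mul])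

theorem form_apply (x v w : Vec) : S.form x v w = S.metric x v w := rfl

theorem metric_eq_sum (x v w : Vec) :
    S.metric x v w = ∑ i, ∑ j, S.metricMatrix x i j * v i * w j := by
  conv_lhs => rw [← form_apply, eq_sum_single v, eq_sum_single w]
  simp only [map_sum, LinearMap.sum_apply, map_smul, LinearMap.smul_apply, smul_eq_mul, form_apply,
    metricMatrix, Matrix.of_apply, Finset.mul_sum]
  rw [Finset.sum_comm]
  refine Finset.sum_congr rfl fun i _ => Finset.sum_congr rfl fun j _ => ?_
  ring

theorem contDiffOn_metric (v w : Vec) : ContDiffOn ℝ ∞ (fun x => S.metric x v w) spacetime := by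
  have hN := S.contDiffOn_lapse
  have hR := S.contDiffOn_areal
  have hω := S.contDiffOn_rot
  simp only [metric_def, roundMetric_shifted]
  have hv := contDiffOn_dEll v
  have hw := contDiffOn_dEll w
  have hdiv : ContDiffOn ℝ ∞ (fun x : Vec => ((v 1 + S.rot x * x 2 * v 0) *
      (w 1 + S.rot x * x 2 * w 0) + (v 2 - S.rot x * x 1 * v 0) *
      (w 2 - S.rot x * x 1 * w 0) + v 3 * w 3) / rad x ^ 2) spacetime :=
    ContDiffOn.div (by fun_prop) contDiff_rad_sq.contDiffOn fun x hx => (rad_sq_pos hx).ne'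
  fun_prop

/-- The derivative of the metric coefficients in the direction `a`, applied to `b` and `c`. -/
def dg (x a b c : Vec) : ℝ := fderiv ℝ (fun y => S.metric y b c) x a

variable {S} in
theorem hasFDerivAt_metric {x : Vec} (hx : x ∈ spacetime) (b c : Vec) :
    HasFDerivAt (fun y => S.metric y b c) (fderiv ℝ (fun y => S.metric y b c) x) x :=
  (((S.contDiffOn_metric b c).contDiffAt (isOpen_spacetime.mem_nhds hx)).differentiableAt
    (by simp)).hasFDerivAt

variable {S} in
theorem dg_eq_sum_fderiv {x : Vec} (hx : x ∈ spacetime) (a b c : Vec) :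
    S.dg x a b c = ∑ i, ∑ j, fderiv ℝ (fun y => S.metricMatrix y i j) x a * b i * c j := by
  have h : HasFDerivAt (fun y => S.metric y b c)
      (∑ j, ∑ k, (b j * c k) • fderiv ℝ (fun y => S.metricMatrix y j k) x) x := by
    simp only [metric_eq_sum]
    refine HasFDerivAt.fun_sum fun j _ => HasFDerivAt.fun_sum fun k _ => ?_
    have := (hasFDerivAt_metric (S := S) hx (Pi.single j 1) (Pi.single k 1)).const_mul (b j * c k)
    refine this.congr_of_eventuallyEq (Eventually.of_forall fun y => ?_)
    simp only [metricMatrix, Matrix.of_apply]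
    ring
  rw [dg, h.fderiv]
  simp only [sum_apply, smul_apply, smul_eq_mul]
  exact Finset.sum_congr rfl fun i _ => Finset.sum_congr rfl fun j _ => by ring

variable {S} in
theorem dg_eq_sum {x : Vec} (hx : x ∈ spacetime) (a b c : Vec) :
    S.dg x a b c = ∑ i, ∑ j, ∑ k, S.dMetric x i j k * a i * b j * c k := by
  have e : S.dg x a b c = ∑ i, a i * S.dg x (Pi.single i 1) b c := by
    simp only [dg]
    conv_lhs => rw [eq_sum_single a, map_sum]
    exact Finset.sum_congr rfl fun i _ => by rw [map_smul, smul_eq_mul]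
  rw [e]
  refine Finset.sum_congr rfl fun i _ => ?_
  rw [dg_eq_sum_fderiv hx, Finset.mul_sum]
  refine Finset.sum_congr rfl fun j _ => ?_
  rw [Finset.mul_sum]
  refine Finset.sum_congr rfl fun k _ => ?_
  rw [dMetric]
  ring

variable {S} in
/-- The product rule for the metric along curves. -/
theorem hasDerivWithinAt_metric {I : Set ℝ} {c a b : ℝ → Vec} {c' a' b' : Vec} {s : ℝ}
    (hx : c s ∈ spacetime) (hc : HasDerivWithinAt c c' I s) (ha : HasDerivWithinAt a a' I s)
    (hb : HasDerivWithinAt b b' I s) :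
    HasDerivWithinAt (fun s => S.metric (c s) (a s) (b s))
      (S.dg (c s) c' (a s) (b s) + S.metric (c s) a' (b s) + S.metric (c s) (a s) b') I s := by
  have h : HasDerivWithinAt (fun s => ∑ i, ∑ j, S.metricMatrix (c s) i j * a s i * b s j)
      (∑ i, ∑ j, ((fderiv ℝ (fun y => S.metricMatrix y i j) (c s) c' * a s i +
        S.metricMatrix (c s) i j * a' i) * b s j + S.metricMatrix (c s) i j * a s i * b' j)) I s :=
    HasDerivWithinAt.fun_sum fun i _ => HasDerivWithinAt.fun_sum fun j _ =>
      (((hasFDerivAt_metric (S := S) hx (Pi.single i 1) (Pi.single j 1)).comp_hasDerivWithinAt s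
        hc).mul (hasDerivWithinAt_pi.1 ha i)).mul (hasDerivWithinAt_pi.1 hb j)
  simp only [metric_eq_sum]
  convert h using 1
  rw [dg_eq_sum_fderiv hx]
  simp only [← Finset.sum_add_distrib]
  exact Finset.sum_congr rfl fun i _ => Finset.sum_congr rfl fun j _ => by ring

variable {S}

/-- Slices of constant time are spacelike: for `v 0 = 0` the shift drops out and the metric is a sum
of two nonnegative terms, whose vanishing kills the radial and the angular part of `v`. -/
theorem eq_zero_of_metric_self_nonpos {x : Vec} (hx : x ∈ spacetime) {v : Vec} (h0 : v 0 = 0)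
    (hv : S.metric x v v ≤ 0) : v = 0 := by
  have hR := S.areal_pos x
  have h1 : S.metric x v v = dEll x v ^ 2 + S.areal x ^ 2 * roundMetric x v v := by
    rw [metric_def, roundMetric_shifted, h0, roundMetric]
    ring
  have h2 := roundMetric_self_nonneg hx v
  have h4 : 0 ≤ S.areal x ^ 2 * roundMetric x v v := by positivity
  have h3 : dEll x v ^ 2 = 0 := le_antisymm (by linarith) (sq_nonneg _)
  have h5 : roundMetric x v v = 0 := by
    have : S.areal x ^ 2 * roundMetric x v v = 0 := le_antisymm (by nlinarith) h4
    exact (mul_eq_zero.1 this).resolve_left (by positivity)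
  rw [roundMetric, ← sq (dEll x v), h3, sub_zero, div_eq_zero_iff] at h5
  have h6 := h5.resolve_right (rad_sq_pos hx).ne'
  funext i
  fin_cases i
  · exact h0
  all_goals
    simp only [Fin.mk_one, Fin.reduceFinMk, Pi.zero_apply]
    nlinarith [sq_nonneg (v 1), sq_nonneg (v 2), sq_nonneg (v 3)]

/-- The vector `∂_t + ω ∂_φ`, orthogonal to the slices of constant time. -/
theorem exists_normal (x : Vec) :
    ∃ n : Vec, n 0 = 1 ∧ ∀ v, S.metric x v n = -(S.lapse x) ^ 2 * v 0 := by
  refine ⟨![1, -S.rot x * x 2, S.rot x * x 1, 0], rfl, fun v => ?_⟩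
  rw [metric_def, roundMetric_shifted]
  simp [dEll]
  ring

/-- Pairing with the normal of the slice forces `v 0 = 0`; then `v` is a null vector tangent to a
spacelike slice. -/
theorem eq_zero_of_metric_eq_zero {x : Vec} (hx : x ∈ spacetime) {v : Vec}
    (h : ∀ w, S.metric x w v = 0) : v = 0 := by
  obtain ⟨n, -, hn⟩ := exists_normal (S := S) x
  have h0 : v 0 = 0 := by
    have := hn v
    rw [metric_comm, h, eq_comm, mul_eq_zero] at this
    exact this.resolve_left (neg_ne_zero.2 (pow_pos (S.lapse_pos x) 2).ne')
  exact eq_zero_of_metric_self_nonpos hx h0 (h v).le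

theorem metric_eq_dotProduct (x v w : Vec) :
    S.metric x v w = v ⬝ᵥ (S.metricMatrix x).mulVec w := by
  rw [metric_eq_sum]
  simp only [dotProduct, Matrix.mulVec, Finset.mul_sum]
  exact Finset.sum_congr rfl fun i _ => Finset.sum_congr rfl fun j _ => by ring

theorem det_metricMatrix_ne_zero {x : Vec} (hx : x ∈ spacetime) : (S.metricMatrix x).det ≠ 0 := by
  intro h
  obtain ⟨v, hv, h⟩ := Matrix.exists_mulVec_eq_zero_iff.2 h
  exact hv (eq_zero_of_metric_eq_zero (S := S) hx fun w => by
    rw [metric_eq_dotProduct, h, dotProduct_zero])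

/-- The Christoffel formula in invariant form. -/
theorem metric_Γ {x : Vec} (hx : x ∈ spacetime) (v w z : Vec) :
    S.metric x z (S.Γ x v w) = (1 / 2) * (S.dg x v w z + S.dg x w v z - S.dg x z v w) := by
  -- The Christoffel symbols with the upper index lowered, contracted with `v` and `w`; pairing with
  -- the metric cancels the inverse matrix.
  set B : Vec := fun l => (1 / 2) * ∑ i, ∑ j,
    (S.dMetric x i j l + S.dMetric x j i l - S.dMetric x l i j) * v i * w j with hB
  have h1 : S.Γ x v w = (S.metricMatrix x)⁻¹.mulVec B := by
    funext k
    simp only [Γ, christoffel, Matrix.mulVec, dotProduct, hB, Finset.mul_sum, Finset.sum_mul]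
    rw [Finset.sum_comm' (t' := Finset.univ) (s' := fun _ => Finset.univ) (by simp)]
    conv_rhs => rw [Finset.sum_comm]
    rw [Finset.sum_comm]
    refine Finset.sum_congr rfl fun i _ => ?_
    rw [Finset.sum_comm]
    refine Finset.sum_congr rfl fun j _ => Finset.sum_congr rfl fun l _ => ?_
    ring
  rw [metric_eq_dotProduct, h1, Matrix.mulVec_mulVec, Matrix.mul_nonsing_inv _
    (isUnit_iff_ne_zero.2 (det_metricMatrix_ne_zero hx)), Matrix.one_mulVec]
  rw [dg_eq_sum hx, dg_eq_sum hx, dg_eq_sum hx]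
  simp only [dotProduct, hB, Fin.sum_univ_four]
  ring

end Wormhole

end RotatingWormhole

end

/-! ### The geodesic spray, its linearisation, conservation of energy, and stationarity. -/

noncomputable section

namespace RotatingWormhole

open Set Filter Topology

theorem hasDerivAt_quadratic {E : Type*} [NormedAddCommGroup E] [NormedSpace ℝ E] (A B C : E) :
    HasDerivAt (fun ε : ℝ => A + ε • B + ε ^ 2 • C) B 0 := by
  have h1 : HasDerivAt (fun ε : ℝ => A + ε • B) B 0 := by
    simpa using ((hasDerivAt_id (0 : ℝ)).smul_const B).const_add A
  have h2 : HasDerivAt (fun ε : ℝ => ε ^ 2 • C) 0 0 := by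
    simpa using (hasDerivAt_pow 2 (0 : ℝ)).smul_const C
  simpa using h1.fun_add h2

theorem contDiffOn_det {n : ℕ} {A : Vec → Matrix (Fin n) (Fin n) ℝ} {s : Set Vec}
    (hA : ∀ i j, ContDiffOn ℝ ∞ (fun x => A x i j) s) : ContDiffOn ℝ ∞ (fun x => (A x).det) s := by
  simp only [Matrix.det_apply, Units.smul_def, zsmul_eq_mul]
  exact ContDiffOn.sum fun σ _ => contDiffOn_const.mul (contDiffOn_prod fun i _ => hA _ _)

theorem contDiffOn_inv_apply {n : ℕ} {A : Vec → Matrix (Fin n) (Fin n) ℝ} {s : Set Vec}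
    (hA : ∀ i j, ContDiffOn ℝ ∞ (fun x => A x i j) s) (h0 : ∀ x ∈ s, (A x).det ≠ 0) (i j : Fin n) :
    ContDiffOn ℝ ∞ (fun x => (A x)⁻¹ i j) s := by
  simp only [Matrix.inv_def, Ring.inverse_eq_inv', Matrix.smul_apply, smul_eq_mul,
    Matrix.adjugate_apply]
  refine ((contDiffOn_det hA).inv h0).mul (contDiffOn_det fun k l => ?_)
  by_cases h : k = j
  · subst h
    simp only [Matrix.updateRow_self]
    exact contDiffOn_const
  · simp only [Matrix.updateRow_ne h]
    exact hA k l

namespace Wormhole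

variable (S : Wormhole)

theorem contDiffOn_dMetric (k i j : Fin 4) :
    ContDiffOn ℝ ∞ (fun x => S.dMetric x k i j) spacetime :=
  (((S.contDiffOn_metric (Pi.single i 1) (Pi.single j 1)).fderiv_of_isOpen isOpen_spacetime
    (m := ∞) (by simp)).clm_apply contDiffOn_const)

theorem contDiffOn_christoffel (k i j : Fin 4) :
    ContDiffOn ℝ ∞ (fun x => S.christoffel x k i j) spacetime :=
  contDiffOn_const.mul <| ContDiffOn.sum fun l _ =>
    (contDiffOn_inv_apply (fun i j => S.contDiffOn_metric (Pi.single i 1) (Pi.single j 1))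
      (fun _ hx => det_metricMatrix_ne_zero hx) k l).mul
    (((S.contDiffOn_dMetric i j l).add (S.contDiffOn_dMetric j i l)).sub
      (S.contDiffOn_dMetric l i j))

theorem christoffel_comm (x : Vec) (k i j : Fin 4) :
    S.christoffel x k i j = S.christoffel x k j i := by
  have h : ∀ l, S.dMetric x l i j = S.dMetric x l j i := fun l => by
    simp only [dMetric, metricMatrix, Matrix.of_apply, S.metric_comm _ (Pi.single i 1)]
  simp only [christoffel, h, add_comm (S.dMetric x i j _)]

theorem Γ_comm (x v w : Vec) : S.Γ x v w = S.Γ x w v := by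
  funext k
  simp only [Γ]
  rw [Finset.sum_comm]
  refine Finset.sum_congr rfl fun i _ => Finset.sum_congr rfl fun j _ => ?_
  rw [christoffel_comm]
  ring

theorem Γ_add_left (x v v' w : Vec) : S.Γ x (v + v') w = S.Γ x v w + S.Γ x v' w := by
  funext k
  simp only [Γ, Pi.add_apply, ← Finset.sum_add_distrib]
  exact Finset.sum_congr rfl fun i _ => Finset.sum_congr rfl fun j _ => by ring

theorem Γ_smul_left (x : Vec) (a : ℝ) (v w : Vec) : S.Γ x (a • v) w = a • S.Γ x v w := by
  funext k
  simp only [Γ, Pi.smul_apply, smul_eq_mul, Finset.mul_sum]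
  exact Finset.sum_congr rfl fun i _ => Finset.sum_congr rfl fun j _ => by ring

theorem Γ_add_right (x v w w' : Vec) : S.Γ x v (w + w') = S.Γ x v w + S.Γ x v w' := by
  rw [Γ_comm, Γ_add_left, Γ_comm, S.Γ_comm x w']

theorem Γ_smul_right (x : Vec) (a : ℝ) (v w : Vec) : S.Γ x v (a • w) = a • S.Γ x v w := by
  rw [Γ_comm, Γ_smul_left, Γ_comm]

theorem Γ_zero_left (x w : Vec) : S.Γ x 0 w = 0 := by
  simpa using S.Γ_smul_left x 0 0 w

/-- The geodesic vector field on the tangent bundle. -/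
def spray (z : Vec × Vec) : Vec × Vec := (z.2, -S.Γ z.1 z.2 z.2)

theorem contDiffOn_Γ :
    ContDiffOn ℝ ∞ (fun z : Vec × Vec => S.Γ z.1 z.2 z.2) (spacetime ×ˢ univ) := by
  refine contDiffOn_pi.2 fun k => ContDiffOn.sum fun i _ => ContDiffOn.sum fun j _ => ?_
  refine ((S.contDiffOn_christoffel k i j).comp contDiffOn_fst fun z hz => hz.1).mul ?_ |>.mul ?_
  · fun_prop
  · fun_prop

theorem contDiffOn_spray : ContDiffOn ℝ ∞ S.spray (spacetime ×ˢ univ) :=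
  contDiffOn_snd.prodMk S.contDiffOn_Γ.neg

theorem contDiffOn_energy :
    ContDiffOn ℝ ∞ (fun z : Vec × Vec => S.metric z.1 z.2 z.2) (spacetime ×ˢ univ) := by
  simp only [metric_eq_sum]
  refine ContDiffOn.sum fun i _ => ContDiffOn.sum fun j _ => ?_
  refine ((S.contDiffOn_metric (Pi.single i 1) (Pi.single j 1)).comp contDiffOn_fst
    fun z hz => hz.1).mul ?_ |>.mul ?_
  · fun_prop
  · fun_prop

variable {S}

theorem differentiableAt_Γ {x : Vec} (hx : x ∈ spacetime) (v : Vec) :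
    DifferentiableAt ℝ (fun z : Vec × Vec => S.Γ z.1 z.2 z.2) (x, v) :=
  ((S.contDiffOn_Γ).contDiffAt ((isOpen_spacetime.prod isOpen_univ).mem_nhds
    ⟨hx, mem_univ _⟩)).differentiableAt (by simp)

/-- Identifies the variational equation of the spray with the equation in `IsJacobiField`. Since `Γ`
is symmetric and bilinear in the velocities, its derivative in the fibre direction `P` is `2
Γ(v,P)`. -/
theorem fderiv_spray {x : Vec} (hx : x ∈ spacetime) (v J P : Vec) :
    fderiv ℝ S.spray (x, v) (J, P) =
      (P, -fderiv ℝ (fun y => S.Γ y v v) x J - (2 : ℝ) • S.Γ x v P) := by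
  have hΓ := (differentiableAt_Γ (S := S) hx v).hasFDerivAt
  have h1 : HasFDerivAt S.spray _ (x, v) := hasFDerivAt_snd.prodMk hΓ.neg
  rw [h1.fderiv]
  set Q := fderiv ℝ (fun z : Vec × Vec => S.Γ z.1 z.2 z.2) (x, v) with hQ
  have h2 : fderiv ℝ (fun y => S.Γ y v v) x J = Q (J, 0) := by
    have hl : HasFDerivAt (fun y : Vec => (y, v)) (ContinuousLinearMap.inl ℝ Vec Vec) x :=
      hasFDerivAt_prodMk_left x v
    have : HasFDerivAt (fun y => S.Γ y v v) (Q.comp (ContinuousLinearMap.inl ℝ Vec Vec)) x :=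
      HasFDerivAt.comp (g := fun z : Vec × Vec => S.Γ z.1 z.2 z.2) (f := fun y : Vec => (y, v)) x
        hΓ hl
    rw [this.fderiv, ContinuousLinearMap.comp_apply, ContinuousLinearMap.inl_apply]
  have h3 : (2 : ℝ) • S.Γ x v P = Q (0, P) := by
    have e1 : HasDerivAt (fun ε : ℝ => S.Γ x (v + ε • P) (v + ε • P)) (Q (0, P)) 0 := by
      have hl : HasDerivAt (fun ε : ℝ => ((x, v + ε • P) : Vec × Vec)) (0, P) 0 := by
        have := ((hasDerivAt_id (0 : ℝ)).smul_const P).const_add v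
        rw [one_smul] at this
        exact (hasDerivAt_const (0 : ℝ) x).prodMk this
      have hΓ' : HasFDerivAt (fun z : Vec × Vec => S.Γ z.1 z.2 z.2) Q (x, v + (0 : ℝ) • P) := by
        simpa using hΓ
      exact hΓ'.comp_hasDerivAt (0 : ℝ) hl
    have e2 : HasDerivAt (fun ε : ℝ => S.Γ x (v + ε • P) (v + ε • P)) ((2 : ℝ) • S.Γ x v P) 0 := by
      have e : (fun ε : ℝ => S.Γ x (v + ε • P) (v + ε • P)) =
          fun ε => S.Γ x v v + ε • ((2 : ℝ) • S.Γ x v P) + ε ^ 2 • S.Γ x P P := by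
        funext ε
        simp only [Γ_add_left, Γ_add_right, Γ_smul_left, Γ_smul_right]
        rw [S.Γ_comm x P v]
        module
      rw [e]
      exact hasDerivAt_quadratic _ _ _
    exact e2.unique e1
  rw [h2, h3]
  have h4 : Q (J, P) = Q (J, 0) + Q (0, P) := by rw [← map_add]; simp
  simp only [ContinuousLinearMap.prod_apply, ContinuousLinearMap.coe_snd', Prod.mk.injEq, true_and]
  rw [neg_apply, h4]
  abel

theorem metric_zero_left (x w : Vec) : S.metric x 0 w = 0 := (S.form x).map_zero₂ w

theorem metric_neg_left (x v w : Vec) : S.metric x (-v) w = -S.metric x v w :=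
  (S.form x).map_neg₂ v w

/-- The Lagrangian is conserved along geodesics. -/
theorem hasDerivWithinAt_energy {I : Set ℝ} {c u : ℝ → Vec} {s : ℝ} (hx : c s ∈ spacetime)
    (hc : HasDerivWithinAt c (u s) I s) (hu : HasDerivWithinAt u (-S.Γ (c s) (u s) (u s)) I s) :
    HasDerivWithinAt (fun s => S.metric (c s) (u s) (u s)) 0 I s := by
  convert hasDerivWithinAt_metric hx hc hu hu using 1
  rw [metric_neg_left, S.metric_comm _ (u s), metric_neg_left, metric_comm, metric_Γ hx]
  ring

/-- The Euler-Lagrange equation paired with a vector field along a geodesic. -/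
theorem hasDerivWithinAt_momentum {I : Set ℝ} {c u J : ℝ → Vec} {P : Vec} {s : ℝ}
    (hx : c s ∈ spacetime) (hc : HasDerivWithinAt c (u s) I s)
    (hu : HasDerivWithinAt u (-S.Γ (c s) (u s) (u s)) I s) (hJ : HasDerivWithinAt J P I s) :
    HasDerivWithinAt (fun s => S.metric (c s) (u s) (J s))
      ((1 / 2) * S.dg (c s) (J s) (u s) (u s) + S.metric (c s) (u s) P) I s := by
  convert hasDerivWithinAt_metric hx hc hu hJ using 1
  rw [metric_neg_left, metric_comm, S.metric_comm _ (S.Γ _ _ _), metric_Γ hx, S.metric_comm _ P]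
  ring

/-- The Lagrangian as a function on the tangent bundle. -/
theorem hasFDerivAt_energy {x : Vec} (hx : x ∈ spacetime) (v : Vec) :
    ∃ Q : Vec × Vec →L[ℝ] ℝ, HasFDerivAt (fun z : Vec × Vec => S.metric z.1 z.2 z.2) Q (x, v) ∧
      ∀ J P, Q (J, P) = S.dg x J v v + 2 * S.metric x v P := by
  have hQ := ((S.contDiffOn_energy.contDiffAt ((isOpen_spacetime.prod isOpen_univ).mem_nhds
    (x := (x, v)) ⟨hx, mem_univ _⟩)).differentiableAt (by simp)).hasFDerivAt
  refine ⟨_, hQ, fun J P => ?_⟩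
  set Q := fderiv ℝ (fun z : Vec × Vec => S.metric z.1 z.2 z.2) (x, v)
  have hJ : HasDerivAt (fun ε : ℝ => x + ε • J) J 0 := by
    simpa using ((hasDerivAt_id (0 : ℝ)).smul_const J).const_add x
  have hP : HasDerivAt (fun ε : ℝ => v + ε • P) P 0 := by
    simpa using ((hasDerivAt_id (0 : ℝ)).smul_const P).const_add v
  have e1 : HasDerivAt (fun ε : ℝ => S.metric (x + ε • J) (v + ε • P) (v + ε • P)) (Q (J, P)) 0 := by
    have hQ' : HasFDerivAt (fun z : Vec × Vec => S.metric z.1 z.2 z.2) Q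
        (x + (0 : ℝ) • J, v + (0 : ℝ) • P) := by simpa using hQ
    exact hQ'.comp_hasDerivAt (0 : ℝ) (hJ.prodMk hP)
  have e2 := (hasDerivWithinAt_metric (S := S) (I := univ) (s := 0) (c := fun ε : ℝ => x + ε • J)
    (by simpa using hx) hJ.hasDerivWithinAt hP.hasDerivWithinAt hP.hasDerivWithinAt).hasDerivAt
    univ_mem
  rw [e1.unique e2]
  simp only [zero_smul, add_zero]
  rw [S.metric_comm x P v]
  ring

/-- This and the following invariances express stationarity. They allow the compactness arguments to
be carried out on the slice of time zero. -/
theorem rad_add_single (x : Vec) (a : ℝ) : rad (x + Pi.single 0 a) = rad x := by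
  simp [rad]

theorem ell_add_single (x : Vec) (a : ℝ) : ell (x + Pi.single 0 a) = ell x := by
  rw [ell, rad_add_single, ell]

theorem theta_add_single (x : Vec) (a : ℝ) : theta (x + Pi.single 0 a) = theta x := by
  rw [theta, rad_add_single, theta]
  simp

theorem dEll_add_single (x v : Vec) (a : ℝ) : dEll (x + Pi.single 0 a) v = dEll x v := by
  rw [dEll, rad_add_single, dEll]
  simp

theorem metric_add_single (x v w : Vec) (a : ℝ) :
    S.metric (x + Pi.single 0 a) v w = S.metric x v w := by
  simp only [metric_def, roundMetric_shifted, lapse, areal, rot, ell_add_single, theta_add_single,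
    dEll_add_single, rad_add_single]
  simp

theorem Γ_add_single (x v w : Vec) (a : ℝ) : S.Γ (x + Pi.single 0 a) v w = S.Γ x v w := by
  have h1 : ∀ y, S.metricMatrix (y + Pi.single 0 a) = S.metricMatrix y := fun y => by
    ext i j
    simp only [metricMatrix, Matrix.of_apply, metric_add_single]
  have h2 : ∀ k i j, S.dMetric (x + Pi.single 0 a) k i j = S.dMetric x k i j := fun k i j => by
    rw [dMetric, ← fderiv_comp_add_right, dMetric]
    congr 2
    funext y
    rw [h1]
  funext k
  simp only [Γ, christoffel, h1, h2]

end Wormhole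

end RotatingWormhole

end

/-! ### The radial field, the regions M_out and M_in, and radial acceleration. -/

noncomputable section

namespace RotatingWormhole

open Set Filter Topology

/-- The flow of `∂_ℓ`. -/
def scale (r : ℝ) (x : Vec) : Vec :=
  ![x 0, Real.exp r * x 1, Real.exp r * x 2, Real.exp r * x 3]

/-- The vector field `∂_ℓ`, a linear vector field in the global chart. -/
def radial (x : Vec) : Vec := ![0, x 1, x 2, x 3]

theorem scale_zero (x : Vec) : scale 0 x = x := by
  funext i
  fin_cases i <;> simp [scale]

theorem rad_scale (r : ℝ) (x : Vec) : rad (scale r x) = Real.exp r * rad x := by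
  have : (scale r x 1) ^ 2 + (scale r x 2) ^ 2 + (scale r x 3) ^ 2 =
      Real.exp r ^ 2 * (x 1 ^ 2 + x 2 ^ 2 + x 3 ^ 2) := by
    simp [scale]
    ring
  rw [rad, this, Real.sqrt_mul (by positivity), Real.sqrt_sq (Real.exp_pos r).le, rad]

theorem ell_scale {x : Vec} (hx : x ∈ spacetime) (r : ℝ) : ell (scale r x) = r + ell x := by
  rw [ell, rad_scale, Real.log_mul (Real.exp_pos r).ne' (ne_of_gt hx), Real.log_exp, ell]

theorem theta_scale (r : ℝ) (x : Vec) : theta (scale r x) = theta x := by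
  rw [theta, rad_scale, theta]
  have : scale r x 3 = Real.exp r * x 3 := by simp [scale]
  rw [this, mul_div_mul_left _ _ (Real.exp_pos r).ne']

theorem dEll_scale (r : ℝ) (x v : Vec) : dEll (scale r x) (scale r v) = dEll x v := by
  have h := (Real.exp_pos r).ne'
  rw [dEll, rad_scale, dEll]
  simp only [scale, Matrix.cons_val]
  rw [mul_pow, ← mul_div_mul_left _ (rad x ^ 2) (pow_ne_zero 2 h)]
  congr 1
  ring

theorem hasDerivAt_scale (x : Vec) : HasDerivAt (fun r => scale r x) (radial x) 0 := by
  refine hasDerivAt_pi.2 fun i => ?_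
  fin_cases i
  · exact hasDerivAt_const _ _
  all_goals simpa [scale, radial] using (Real.hasDerivAt_exp 0).mul_const _

theorem hasFDerivAt_radial (x : Vec) :
    ∃ Q : Vec →L[ℝ] Vec, HasFDerivAt radial Q x ∧ ∀ v, Q v = radial v := by
  let Q : Vec →ₗ[ℝ] Vec :=
    { toFun := radial
      map_add' := fun v w => by funext i; fin_cases i <;> simp [radial]
      map_smul' := fun a v => by funext i; fin_cases i <;> simp [radial] }
  exact ⟨Q.toContinuousLinearMap, Q.toContinuousLinearMap.hasFDerivAt, fun _ => rfl⟩

theorem continuous_radial : Continuous radial :=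
  continuous_iff_continuousAt.2 fun x => by
    obtain ⟨Q, hQ, -⟩ := hasFDerivAt_radial x
    exact hQ.continuousAt

theorem hasDerivAt_along_scale {H : Vec → ℝ} {x : Vec} (hx : x ∈ spacetime)
    (hH : ContDiffOn ℝ ∞ H spacetime) :
    HasDerivAt (fun r => H (scale r x)) (fderiv ℝ H x (radial x)) 0 := by
  have h1 : HasFDerivAt H (fderiv ℝ H x) (scale 0 x) := by
    rw [scale_zero]
    exact ((hH.contDiffAt (isOpen_spacetime.mem_nhds hx)).differentiableAt (by simp)).hasFDerivAt
  exact h1.comp_hasDerivAt (0 : ℝ) (hasDerivAt_scale x)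

/-- The partial derivative in `ℓ` of a smooth function of `(ℓ,ϑ)` is its derivative along `∂_ℓ`. -/
theorem hasDerivAt_ell {h : ℝ → ℝ → ℝ} {x : Vec} (hx : x ∈ spacetime)
    (hH : ContDiffOn ℝ ∞ (fun x : Vec => h (ell x) (theta x)) spacetime) :
    HasDerivAt (fun l => h l (theta x))
      (fderiv ℝ (fun x : Vec => h (ell x) (theta x)) x (radial x)) (ell x) := by
  have h1 := hasDerivAt_along_scale hx hH
  have h2 : HasDerivAt (fun l => l - ell x) 1 (ell x) := (hasDerivAt_id _).sub_const _
  have h3 : HasDerivAt (fun r => h (ell (scale r x)) (theta (scale r x)))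
      (fderiv ℝ (fun x : Vec => h (ell x) (theta x)) x (radial x)) (ell x - ell x) := by
    rwa [sub_self]
  have := HasDerivAt.comp (h := fun l => l - ell x) (ell x) h3 h2
  rw [mul_one] at this
  refine this.congr_of_eventuallyEq (Eventually.of_forall fun l => ?_)
  simp only [Function.comp, ell_scale hx, theta_scale, sub_add_cancel]

theorem continuousOn_radial_deriv {H : Vec → ℝ} (hH : ContDiffOn ℝ ∞ H spacetime) :
    ContinuousOn (fun x => fderiv ℝ H x (radial x)) spacetime :=
  (hH.continuousOn_fderiv_of_isOpen isOpen_spacetime (by simp)).clm_apply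
    continuous_radial.continuousOn

theorem continuousOn_theta : ContinuousOn theta spacetime :=
  Real.continuous_arccos.comp_continuousOn
    ((continuous_apply 3).continuousOn.div continuous_rad.continuousOn fun _ hx => ne_of_gt hx)

theorem continuousOn_ell : ContinuousOn ell spacetime :=
  continuous_rad.continuousOn.log fun _ hx => ne_of_gt hx

theorem sin_theta_nonneg (x : Vec) : 0 ≤ Real.sin (theta x) :=
  Real.sin_nonneg_of_nonneg_of_le_pi (Real.arccos_nonneg _) (Real.arccos_le_pi _)

theorem sin_theta_sq {x : Vec} (hx : x ∈ spacetime) :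
    Real.sin (theta x) ^ 2 = (x 1 ^ 2 + x 2 ^ 2) / rad x ^ 2 := by
  have h := rad_sq_pos hx
  have e : (x 3 / rad x) ^ 2 = x 3 ^ 2 / rad x ^ 2 := div_pow _ _ _
  have e' : x 3 ^ 2 / rad x ^ 2 ≤ 1 := by
    rw [div_le_one h, rad_sq]
    nlinarith [sq_nonneg (x 1), sq_nonneg (x 2)]
  rw [theta, Real.sin_arccos, Real.sq_sqrt (by rw [e]; linarith), e, eq_div_iff h.ne',
    sub_mul, div_mul_cancel₀ _ h.ne', one_mul, rad_sq]
  ring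

namespace Wormhole

variable (S : Wormhole)

/-- `∂_ℓ N`. -/
def dLapse (x : Vec) : ℝ := fderiv ℝ S.lapse x (radial x)

/-- `∂_ℓ R`. -/
def dAreal (x : Vec) : ℝ := fderiv ℝ S.areal x (radial x)

/-- `∂_ℓ ω`. -/
def dRot (x : Vec) : ℝ := fderiv ℝ S.rot x (radial x)

/-- `∂_ℓ (-N / R)`. -/
def slope (x : Vec) : ℝ := (S.lapse x * S.dAreal x - S.dLapse x * S.areal x) / S.areal x ^ 2

theorem continuousOn_dLapse : ContinuousOn S.dLapse spacetime :=
  continuousOn_radial_deriv S.contDiffOn_lapse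

theorem continuousOn_dAreal : ContinuousOn S.dAreal spacetime :=
  continuousOn_radial_deriv S.contDiffOn_areal

theorem continuousOn_dRot : ContinuousOn S.dRot spacetime :=
  continuousOn_radial_deriv S.contDiffOn_rot

theorem continuousOn_slope : ContinuousOn S.slope spacetime :=
  ((S.contDiffOn_lapse.continuousOn.mul S.continuousOn_dAreal).sub
    (S.continuousOn_dLapse.mul S.contDiffOn_areal.continuousOn)).div
    (S.contDiffOn_areal.continuousOn.pow 2) fun x _ => (pow_pos (S.areal_pos x) 2).ne'

theorem hasDerivAt_neg_div {x : Vec} (hx : x ∈ spacetime) :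
    HasDerivAt (fun l => -S.N l (theta x) / S.R l (theta x)) (S.slope x) (ell x) := by
  have h := (hasDerivAt_ell hx S.smooth_N).neg.div (hasDerivAt_ell hx S.smooth_R)
    (S.areal_pos x).ne'
  refine h.congr_deriv ?_
  simp only [Pi.neg_apply]
  change (-S.dLapse x * S.areal x - -S.lapse x * S.dAreal x) / S.areal x ^ 2 = _
  rw [slope]
  ring

theorem dPsi_of_sin_eq_zero {x : Vec} (hx : x ∈ spacetime) (h : Real.sin (theta x) = 0) (σ : ℝ) :
    S.dPsi σ (ell x) (theta x) = S.slope x := by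
  rw [dPsi, if_pos h, (S.hasDerivAt_neg_div hx).deriv]

theorem dPsi_of_sin_ne_zero {x : Vec} (hx : x ∈ spacetime) (h : Real.sin (theta x) ≠ 0) (σ : ℝ) :
    S.dPsi σ (ell x) (theta x) = S.slope x / Real.sin (theta x) - σ * S.dRot x := by
  rw [dPsi, if_neg h]
  have h1 := ((S.hasDerivAt_neg_div hx).div_const (Real.sin (theta x))).fun_sub
    ((hasDerivAt_ell hx S.smooth_twist).const_mul σ)
  refine HasDerivAt.deriv (h1.congr_of_eventuallyEq (Eventually.of_forall fun l => ?_))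
  simp only [Psi, div_div]

/-- The region `M_out` for `σ = 1` and `M_in` for `σ = -1`. -/
def region (σ : ℝ) : Set Vec :=
  {x ∈ spacetime | Real.sin (theta x) * |S.dRot x| < σ * S.slope x}

/-- Off the axis, the two potentials have radial derivatives `slope / sin ϑ ∓ dRot`. Multiplying by
`sin ϑ` merges the two sign conditions into one inequality whose terms are continuous across the
axis, where it reduces to the convention of `dPsi`. -/
theorem Mout_eq_region : S.Mout = S.region 1 := by
  ext x
  refine and_congr_right fun hx => ?_
  rw [one_mul]
  by_cases h : Real.sin (theta x) = 0
  · rw [S.dPsi_of_sin_eq_zero hx h, S.dPsi_of_sin_eq_zero hx h, h, zero_mul, and_self]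
  · rw [S.dPsi_of_sin_ne_zero hx h, S.dPsi_of_sin_ne_zero hx h]
    have h0 : 0 < Real.sin (theta x) := lt_of_le_of_ne (sin_theta_nonneg x) (Ne.symm h)
    rw [mul_comm (Real.sin _), ← lt_div_iff₀ h0, abs_lt]
    constructor
    · rintro ⟨h1, h2⟩
      constructor <;> linarith
    · rintro ⟨h1, h2⟩
      constructor <;> linarith

theorem Min_eq_region : S.Min = S.region (-1) := by
  ext x
  refine and_congr_right fun hx => ?_
  rw [neg_one_mul]
  by_cases h : Real.sin (theta x) = 0
  · rw [S.dPsi_of_sin_eq_zero hx h, S.dPsi_of_sin_eq_zero hx h, h, zero_mul, and_self,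
      Left.neg_pos_iff]
  · rw [S.dPsi_of_sin_ne_zero hx h, S.dPsi_of_sin_ne_zero hx h]
    have h0 : 0 < Real.sin (theta x) := lt_of_le_of_ne (sin_theta_nonneg x) (Ne.symm h)
    rw [mul_comm (Real.sin _), ← lt_div_iff₀ h0, abs_lt, neg_div]
    constructor
    · rintro ⟨h1, h2⟩
      constructor <;> linarith
    · rintro ⟨h1, h2⟩
      constructor <;> linarith

theorem isOpen_region (σ : ℝ) : IsOpen (S.region σ) := by
  have h : ContinuousOn (fun x => σ * S.slope x - Real.sin (theta x) * |S.dRot x|) spacetime :=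
    (continuousOn_const.mul S.continuousOn_slope).sub
      ((Real.continuous_sin.comp_continuousOn continuousOn_theta).mul S.continuousOn_dRot.abs)
  convert h.isOpen_inter_preimage isOpen_spacetime (isOpen_Ioi (a := (0 : ℝ))) using 1
  ext x
  simp [region, sub_pos]

theorem disjoint_region (σ : ℝ) : Disjoint (S.region σ) (S.region (-σ)) := by
  refine disjoint_left.2 fun x hx hx' => ?_
  have h : 0 ≤ Real.sin (theta x) * |S.dRot x| := mul_nonneg (sin_theta_nonneg x) (abs_nonneg _)
  have h1 := hx.2
  have h2 := hx'.2
  linarith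

/-- Half of the Lie derivative of the metric along `∂_ℓ`. -/
def radialForce (x u : Vec) : ℝ :=
  -(S.lapse x * S.dLapse x) * u 0 ^ 2 +
    S.areal x * S.dAreal x * roundMetric x (S.shifted x u) (S.shifted x u) +
    S.areal x ^ 2 * S.dRot x * u 0 *
      ((S.shifted x u 1 * x 2 - S.shifted x u 2 * x 1) / rad x ^ 2)

variable {S}

/-- The metric is differentiated along the flow of ∂_ℓ, acting on the base point and on `u`, in two
ways: by the product rule, and from the explicit formula, in which only the lapse, the areal radius
and the rotation vary with the scaling parameter. -/
theorem radialForce_eq {x : Vec} (hx : x ∈ spacetime) (u : Vec) :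
    (1 / 2) * S.dg x (radial x) u u + S.metric x u (radial u) = S.radialForce x u := by
  have h1 := (hasDerivWithinAt_metric (S := S) (I := univ) (s := 0) (c := fun r => scale r x)
    (by simpa only [scale_zero] using hx) (hasDerivAt_scale x).hasDerivWithinAt
    (hasDerivAt_scale u).hasDerivWithinAt (hasDerivAt_scale u).hasDerivWithinAt).hasDerivAt
    univ_mem
  simp only [scale_zero] at h1
  have hN := hasDerivAt_along_scale hx S.contDiffOn_lapse
  have hR := hasDerivAt_along_scale hx S.contDiffOn_areal
  have hω := hasDerivAt_along_scale hx S.contDiffOn_rot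
  have e : (fun r => S.metric (scale r x) (scale r u) (scale r u)) = fun r =>
      -(S.lapse (scale r x)) ^ 2 * (u 0 * u 0) + dEll x u * dEll x u +
        S.areal (scale r x) ^ 2 * (((u 1 + S.rot (scale r x) * (x 2 * u 0)) ^ 2 +
        (u 2 - S.rot (scale r x) * (x 1 * u 0)) ^ 2 + u 3 ^ 2) / rad x ^ 2 -
        dEll x u * dEll x u) := by
    funext r
    have h := (Real.exp_pos r).ne'
    rw [metric_def, roundMetric_shifted, dEll_scale, rad_scale, mul_pow,
      ← mul_div_mul_left _ (rad x ^ 2) (pow_ne_zero 2 h)]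
    have e0 : ∀ v : Vec, scale r v 0 = v 0 := fun v => rfl
    have e1 : ∀ v : Vec, scale r v 1 = Real.exp r * v 1 := fun v => rfl
    have e2 : ∀ v : Vec, scale r v 2 = Real.exp r * v 2 := fun v => rfl
    have e3 : ∀ v : Vec, scale r v 3 = Real.exp r * v 3 := fun v => rfl
    simp only [e0, e1, e2, e3]
    ring
  rw [e] at h1
  have h2 := (((hN.fun_pow 2).fun_neg.mul_const (u 0 * u 0)).add_const (dEll x u * dEll x u)).fun_add
    ((hR.fun_pow 2).fun_mul ((((((hω.mul_const (x 2 * u 0)).const_add (u 1)).fun_pow 2).fun_add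
      (((hω.mul_const (x 1 * u 0)).const_sub (u 2)).fun_pow 2)).add_const (u 3 ^ 2)).div_const
      (rad x ^ 2) |>.sub_const (dEll x u * dEll x u)))
  have h3 := h1.unique h2
  simp only [scale_zero] at h3
  rw [S.metric_comm x (radial u) u] at h3
  rw [radialForce, roundMetric_shifted, shifted_one, shifted_two]
  change _ = -(S.lapse x * fderiv ℝ S.lapse x (radial x)) * u 0 ^ 2 +
    S.areal x * fderiv ℝ S.areal x (radial x) * _ +
    S.areal x ^ 2 * fderiv ℝ S.rot x (radial x) * u 0 * _
  have h4 : (1 / 2) * S.dg x (radial x) u u + S.metric x u (radial u) =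
    (1 / 2) * (S.dg x (radial x) u u + S.metric x u (radial u) + S.metric x u (radial u)) := by ring
  rw [h4, h3]
  push_cast
  ring

theorem metric_radial {x : Vec} (hx : x ∈ spacetime) (v : Vec) :
    S.metric x v (radial x) = dEll x v := by
  have h := (rad_sq_pos hx).ne'
  have h1 : dEll x (radial x) = 1 := by
    rw [dEll, div_eq_one_iff_eq h, rad_sq]
    simp [radial]
    ring
  rw [metric_def, roundMetric_shifted, h1, dEll]
  simp [radial]
  right
  rw [← sub_div]
  convert zero_div _ using 2
  ring

/-- Since `g(u, ∂_ℓ) = dℓ(u)`, the radial velocity is the momentum paired with ∂_ℓ, and the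
Euler–Lagrange equation gives its rate of change. -/
theorem hasDerivWithinAt_dEll {I : Set ℝ} {c u : ℝ → Vec} {s : ℝ}
    (hc0 : ∀ s ∈ I, c s ∈ spacetime) (hs : s ∈ I) (hc : HasDerivWithinAt c (u s) I s)
    (hu : HasDerivWithinAt u (-S.Γ (c s) (u s) (u s)) I s) :
    HasDerivWithinAt (fun s => dEll (c s) (u s)) (S.radialForce (c s) (u s)) I s := by
  obtain ⟨Q, hQ, hQ'⟩ := hasFDerivAt_radial (c s)
  have hJ := hQ.comp_hasDerivWithinAt s hc
  rw [hQ'] at hJ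
  have h := hasDerivWithinAt_momentum (S := S) (hc0 s hs) hc hu hJ
  rw [← radialForce_eq (hc0 s hs)]
  exact h.congr_of_mem (fun r hr => (metric_radial (hc0 r hr) _).symm) hs

theorem hasFDerivAt_ell {x : Vec} (hx : x ∈ spacetime) :
    ∃ Q : Vec →L[ℝ] ℝ, HasFDerivAt ell Q x ∧ ∀ v, Q v = dEll x v := by
  have e : ell = fun x : Vec => (1 / 2) * Real.log (x 1 ^ 2 + x 2 ^ 2 + x 3 ^ 2) := by
    funext x
    rw [ell, rad, Real.log_sqrt (by positivity)]
    ring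
  have h0 : x 1 ^ 2 + x 2 ^ 2 + x 3 ^ 2 ≠ 0 := by
    rw [← rad_sq]
    exact (rad_sq_pos hx).ne'
  have hp : ∀ i, HasFDerivAt (fun x : Vec => x i ^ 2)
      (((2 : ℕ) * x i ^ (2 - 1)) • ContinuousLinearMap.proj (R := ℝ) (φ := fun _ => ℝ) i) x :=
    fun i => HasDerivAt.comp_hasFDerivAt (h₂ := fun y : ℝ => y ^ 2) x (hasDerivAt_pow 2 (x i))
      (ContinuousLinearMap.proj (R := ℝ) (φ := fun _ : Fin 4 => ℝ) i).hasFDerivAt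
  have h := (((hp 1).fun_add (hp 2)).fun_add (hp 3)).log h0 |>.const_mul (1 / 2)
  rw [← e] at h
  refine ⟨_, h, fun v => ?_⟩
  simp only [smul_apply, add_apply, ContinuousLinearMap.proj_apply, smul_eq_mul,
    dEll, rad_sq]
  field_simp
  push_cast
  ring

/-- The radial acceleration of a lightlike geodesic at a turning point has the sign of the
region. -/
theorem radialForce_pos {σ : ℝ} (hσ : σ ^ 2 = 1) {x u : Vec} (hx : x ∈ S.region σ)
    (hnull : S.metric x u u = 0) (hu : u 0 ≠ 0) (hturn : dEll x u = 0) :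
    0 < σ * S.radialForce x u := by
  obtain ⟨hxs, hlt⟩ := hx
  have hN := S.lapse_pos x
  have hR := S.areal_pos x
  have hr := rad_sq_pos hxs
  set ρ := roundMetric x (S.shifted x u) (S.shifted x u) with hρ
  set A := (S.shifted x u 1 * x 2 - S.shifted x u 2 * x 1) / rad x ^ 2 with hA
  have hn : S.areal x ^ 2 * ρ = S.lapse x ^ 2 * u 0 ^ 2 := by
    rw [metric_def, hturn] at hnull
    linear_combination hnull
  -- Cauchy–Schwarz on the unit sphere: up to sign, `A` is the product of the shifted vector with
  -- ∂_φ, which has length `sin ϑ`.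
  have hAρ : A ^ 2 ≤ Real.sin (theta x) ^ 2 * ρ := by
    rw [sin_theta_sq hxs, hρ, roundMetric_self hxs, hA, div_pow, div_mul_div_comm,
      div_le_div_iff₀ (by positivity) (by positivity), rad_sq]
    set v := S.shifted x u
    -- With `L = x × v`, orthogonality of `L` to `x` gives `x₃ L₃ = -(x₁ L₁ + x₂ L₂)`, so the claim
    -- is Cauchy–Schwarz in the plane; the hint is its defect `(x₁ L₂ - x₂ L₁)²`.
    have key : (v 1 * x 2 - v 2 * x 1) ^ 2 * (x 1 ^ 2 + x 2 ^ 2 + x 3 ^ 2) ≤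
        (x 1 ^ 2 + x 2 ^ 2) * ((x 1 * v 2 - x 2 * v 1) ^ 2 + (x 2 * v 3 - x 3 * v 2) ^ 2 +
          (x 3 * v 1 - x 1 * v 3) ^ 2) := by
      nlinarith [sq_nonneg (x 1 * (x 3 * v 1 - x 1 * v 3) - x 2 * (x 2 * v 3 - x 3 * v 2))]
    have hp : 0 ≤ (x 1 ^ 2 + x 2 ^ 2 + x 3 ^ 2) ^ 2 := by positivity
    nlinarith [mul_le_mul_of_nonneg_right key hp]
  have hRA : |S.areal x * A| ≤ Real.sin (theta x) * (S.lapse x * |u 0|) := by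
    have h0 := sin_theta_nonneg x
    refine abs_le_of_sq_le_sq ?_ (by positivity)
    calc (S.areal x * A) ^ 2 ≤ S.areal x ^ 2 * (Real.sin (theta x) ^ 2 * ρ) := by
          rw [mul_pow]; gcongr
      _ = Real.sin (theta x) ^ 2 * (S.areal x ^ 2 * ρ) := by ring
      _ = _ := by rw [hn, mul_pow, mul_pow, sq_abs]
  -- Eliminating the round part by the null condition combines the lapse and areal terms into a
  -- multiple of `∂_ℓ(-N/R)`. What remains is the rotational term, which the defining inequality of
  -- the region dominates.
  have hb : S.radialForce x u = S.lapse x * S.areal x * S.slope x * u 0 ^ 2 +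
      S.areal x * S.dRot x * u 0 * (S.areal x * A) := by
    have e : S.areal x * S.dAreal x * ρ = S.dAreal x / S.areal x * (S.lapse x ^ 2 * u 0 ^ 2) := by
      rw [← hn]
      field_simp
    rw [radialForce, ← hρ, ← hA, e, slope]
    field_simp
    ring
  have hσ1 : |σ| = 1 := by
    rw [← sq_eq_sq₀ (abs_nonneg _) zero_le_one, sq_abs, hσ, one_pow]
  have h1 : |σ * (S.areal x * S.dRot x * u 0 * (S.areal x * A))| ≤
      S.areal x * |S.dRot x| * |u 0| * (Real.sin (theta x) * (S.lapse x * |u 0|)) := by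
    rw [abs_mul, hσ1, one_mul, abs_mul, abs_mul, abs_mul, abs_of_pos hR]
    gcongr
  have h2 := neg_le_of_abs_le h1
  have h3 : 0 < S.lapse x * S.areal x * u 0 ^ 2 *
      (σ * S.slope x - Real.sin (theta x) * |S.dRot x|) :=
    mul_pos (by positivity) (sub_pos.2 hlt)
  have h4 : |u 0| * |u 0| = u 0 ^ 2 := by rw [← sq, sq_abs]
  rw [hb]
  calc 0 < _ := h3
    _ = σ * (S.lapse x * S.areal x * S.slope x * u 0 ^ 2) +
      -(S.areal x * |S.dRot x| * |u 0| * (Real.sin (theta x) * (S.lapse x * |u 0|))) := by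
        linear_combination (S.areal x * |S.dRot x| * Real.sin (theta x) * S.lapse x) * h4
    _ ≤ _ := by rw [mul_add]; linarith

/-- At both ends `-N/R` behaves like `-1/|ℓ|`, so its ℓ-derivative has the sign of ℓ. A point of the
region σ needs the sign σ, and so cannot lie far out at the opposite end. -/
theorem exists_far_bound (S : Wormhole) : ∃ L > 0, ∀ σ : ℝ, σ = 1 ∨ σ = -1 → ∀ x ∈ S.region σ,
    -L < σ * ell x := by
  obtain ⟨C, L, hL, h⟩ := S.asymptotics
  -- For `|ℓ| ≥ 8 C` the quantities `N` and `|∂_ℓ R|` are within 1/8 of 1 and `|∂_ℓ N| R ≤ 9/64`, so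
  -- `N ∂_ℓ R`, of size at least 49/64, decides the sign of the slope.
  have hL' : 0 < max L (8 * C) := lt_max_of_lt_left hL
  refine ⟨max L (8 * C), hL', fun σ hσ x hx => ?_⟩
  by_contra! hlt
  have hN := S.lapse_pos x
  have hR := S.areal_pos x
  have hpos : 0 < σ * S.slope x :=
    lt_of_le_of_lt (mul_nonneg (sin_theta_nonneg x) (abs_nonneg _)) hx.2
  have habs : |ell x| = -(σ * ell x) := by
    rcases hσ with rfl | rfl
    · rw [one_mul, abs_of_neg (by linarith)]
    · rw [abs_of_pos (by linarith)]; ring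
  have hsign : (SignType.sign (ell x) : ℝ) = -σ := by
    rcases hσ with rfl | rfl
    · rw [sign_neg (by linarith)]; simp
    · rw [sign_pos (by linarith)]; simp
  have ha : L ≤ |ell x| := by rw [habs]; linarith [le_max_left L (8 * C)]
  have ha8 : 8 * C ≤ |ell x| := by rw [habs]; linarith [le_max_right L (8 * C)]
  obtain ⟨h1, h2, -, h4, h5, -⟩ := h (ell x) ha (theta x) (theta_mem x)
  have hd1 : deriv (fun l' => S.N l' (theta x)) (ell x) = S.dLapse x :=
    (hasDerivAt_ell hx.1 S.smooth_N).deriv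
  have hd2 : deriv (fun l' => S.R l' (theta x)) (ell x) = S.dAreal x :=
    (hasDerivAt_ell hx.1 S.smooth_R).deriv
  rw [hd1] at h4
  rw [hd2, hsign] at h5
  change |S.lapse x - 1| ≤ _ at h1
  change |S.areal x - _| ≤ _ at h2
  set a := |ell x|
  have ha0 : 0 < a := lt_of_lt_of_le hL ha
  have hq : C / a ≤ 1 / 8 := by rw [div_le_iff₀ ha0]; linarith
  have hq' : C / a ^ 2 ≤ 1 / 8 / a := by
    rw [sq, ← div_div]
    gcongr
  have hC : 0 ≤ C := (abs_nonneg _).trans h2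
  have b1 := abs_le.1 (h1.trans hq)
  have b5 := abs_le.1 (h5.trans hq)
  have b4 : |S.dLapse x| * S.areal x ≤ 1 / 8 * (9 / 8) := by
    have hR' : S.areal x ≤ 9 / 8 * a := by have := (abs_le.1 h2).2; linarith
    calc |S.dLapse x| * S.areal x ≤ (1 / 8 / a) * (9 / 8 * a) :=
          mul_le_mul (h4.trans hq') hR' hR.le (by positivity)
      _ = _ := by field_simp
  have b6 := abs_le.1 (show |S.dLapse x * S.areal x| ≤ 1 / 8 * (9 / 8) by
    rwa [abs_mul, abs_of_pos hR])
  rw [slope, ← mul_div_assoc, lt_div_iff₀ (by positivity), zero_mul] at hpos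
  rcases hσ with rfl | rfl
  · nlinarith
  · nlinarith

end Wormhole

end RotatingWormhole

end

/-! ### Bounded duration and velocity of lightlike geodesics over a compact part of one region. -/

noncomputable section

namespace RotatingWormhole

open Set Filter Topology

/-- The set of events with `|ℓ| ≤ L` and time in `[a, b]`. -/
def slab (L a b : ℝ) : Set Vec := {x ∈ spacetime | |ell x| ≤ L ∧ x 0 ∈ Icc a b}

theorem slab_subset (L a b : ℝ) : slab L a b ⊆ spacetime := fun _ hx => hx.1

theorem isCompact_slab (L a b : ℝ) : IsCompact (slab L a b) := by
  have e : slab L a b = {x | rad x ∈ Icc (Real.exp (-L)) (Real.exp L) ∧ x 0 ∈ Icc a b} := by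
    ext x
    constructor
    · rintro ⟨h1, h2, h3⟩
      have h := abs_le.1 h2
      rw [ell] at h
      exact ⟨⟨(Real.le_log_iff_exp_le h1).1 h.1, (Real.log_le_iff_le_exp h1).1 h.2⟩, h3⟩
    · rintro ⟨h1, h2⟩
      have h0 : 0 < rad x := (Real.exp_pos _).trans_le h1.1
      exact ⟨h0, abs_le.2 ⟨(Real.le_log_iff_exp_le h0).2 h1.1, (Real.log_le_iff_le_exp h0).2 h1.2⟩,
        h2⟩
  have hc : IsClosed (slab L a b) := by
    rw [e]
    exact (isClosed_Icc.preimage continuous_rad).inter (isClosed_Icc.preimage (continuous_apply 0))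
  refine Metric.isCompact_of_isClosed_isBounded hc (isBounded_iff_forall_norm_le.2
    ⟨max (Real.exp L) (max |a| |b|), fun x hx => ?_⟩)
  have h0 : 0 ≤ max (Real.exp L) (max |a| |b|) := (Real.exp_pos L).le.trans (le_max_left _ _)
  rw [e] at hx
  have hr : ∀ i, x i ^ 2 ≤ rad x ^ 2 → ‖x i‖ ≤ max (Real.exp L) (max |a| |b|) := fun i hi =>
    (abs_le_of_sq_le_sq hi (Real.sqrt_nonneg _)).trans (hx.1.2.trans (le_max_left _ _))
  refine (pi_norm_le_iff_of_nonneg h0).2 fun i => ?_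
  fin_cases i
  · exact (abs_le_max_abs_abs hx.2.1 hx.2.2).trans (le_max_right _ _)
  all_goals
    refine hr _ ?_
    simp only [Fin.mk_one, Fin.reduceFinMk]
    rw [rad_sq]
    nlinarith [sq_nonneg (x 1), sq_nonneg (x 2), sq_nonneg (x 3)]

theorem monotoneOn_unitInterval {f f' : ℝ → ℝ}
    (hf : ∀ s ∈ Icc (0 : ℝ) 1, HasDerivWithinAt f (f' s) (Icc 0 1) s)
    (h : ∀ s ∈ Icc (0 : ℝ) 1, 0 ≤ f' s) : MonotoneOn f (Icc 0 1) :=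
  monotoneOn_of_hasDerivWithinAt_nonneg (convex_Icc 0 1)
    (fun s hs => (hf s hs).continuousWithinAt)
    (fun s hs => (hf s (interior_subset hs)).mono interior_subset)
    (fun s hs => h s (interior_subset hs))

/-- A trajectory of `f' = y m`, `y' = β m` in a region where turning points of the bounded function
`f` are strict minima can only last for a bounded time. -/
theorem duration_le {f y m T β : ℝ → ℝ} {k δ L Y : ℝ} (hk : 0 ≤ k) (hδ : 0 < δ)
    (hf : ∀ s ∈ Icc (0 : ℝ) 1, HasDerivWithinAt f (y s * m s) (Icc 0 1) s)
    (hy : ∀ s ∈ Icc (0 : ℝ) 1, HasDerivWithinAt y (β s * m s) (Icc 0 1) s)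
    (hT : ∀ s ∈ Icc (0 : ℝ) 1, HasDerivWithinAt T (m s) (Icc 0 1) s)
    (hm : ∀ s ∈ Icc (0 : ℝ) 1, 0 ≤ m s) (hβ : ∀ s ∈ Icc (0 : ℝ) 1, δ ≤ k * y s ^ 2 + β s)
    (hL : ∀ s ∈ Icc (0 : ℝ) 1, |f s| ≤ L) (hY : ∀ s ∈ Icc (0 : ℝ) 1, |y s| ≤ Y) :
    T 1 - T 0 ≤ 2 * Real.exp (k * L) * Y / (δ * Real.exp (-(k * L))) := by
  set c := δ * Real.exp (-(k * L)) with hc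
  have hc0 : 0 < c := by positivity
  -- Relative to `T`, the quantity `exp(k f) y` has derivative `exp(k f) (k y² + β) ≥ c`, while its
  -- modulus is at most `exp(k L) Y`. Its total growth bounds the elapsed `T`.
  have hG : ∀ s ∈ Icc (0 : ℝ) 1, HasDerivWithinAt (fun s => Real.exp (k * f s) * y s - c * T s)
      (Real.exp (k * f s) * (k * (y s * m s)) * y s + Real.exp (k * f s) * (β s * m s) - c * m s)
      (Icc 0 1) s := fun s hs =>
    ((((hf s hs).const_mul k).exp).mul (hy s hs)).sub ((hT s hs).const_mul c)
  have hmono := monotoneOn_unitInterval hG fun s hs => by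
    have h1 : Real.exp (-(k * L)) ≤ Real.exp (k * f s) :=
      Real.exp_le_exp.2 (by nlinarith [(abs_le.1 (hL s hs)).1])
    have h2 : c ≤ Real.exp (k * f s) * (k * y s ^ 2 + β s) := by
      rw [hc, mul_comm]
      exact mul_le_mul h1 (hβ s hs) hδ.le (Real.exp_pos _).le
    nlinarith [mul_le_mul_of_nonneg_right h2 (hm s hs)]
  have h01 := hmono (show (0 : ℝ) ∈ Icc (0 : ℝ) 1 by simp) (show (1 : ℝ) ∈ Icc (0 : ℝ) 1 by simp)
    zero_le_one
  have hb : ∀ s ∈ Icc (0 : ℝ) 1, |Real.exp (k * f s) * y s| ≤ Real.exp (k * L) * Y := fun s hs => by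
    rw [abs_mul, Real.abs_exp]
    exact mul_le_mul (Real.exp_le_exp.2 (by nlinarith [(abs_le.1 (hL s hs)).2])) (hY s hs)
      (abs_nonneg _) (Real.exp_pos _).le
  have h0 := abs_le.1 (hb 0 (by simp))
  have h1 := abs_le.1 (hb 1 (by simp))
  rw [le_div_iff₀ hc0]
  simp only at h01
  linarith

/-- Where `β ≤ 0`, a compact set, `a²` has a positive lower bound, so a large multiple of it
outweighs `β`. This turns a condition at turning points alone into the uniform inequality needed in
`duration_le`. -/
theorem exists_pos_le_mul_sq_add {E : Type*} [TopologicalSpace E] {X : Set E}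
    (hX : IsCompact X) {a β : E → ℝ} (ha : ContinuousOn a X) (hβ : ContinuousOn β X)
    (h : ∀ z ∈ X, a z = 0 → 0 < β z) :
    ∃ k δ : ℝ, 0 ≤ k ∧ 0 < δ ∧ ∀ z ∈ X, δ ≤ k * a z ^ 2 + β z := by
  obtain ⟨M, hM⟩ := hX.exists_bound_of_continuousOn hβ
  have hXc : IsCompact {z ∈ X | β z ≤ 0} := by
    obtain ⟨U, hU, hUe⟩ := (continuousOn_iff_isClosed.1 hβ) (Iic 0) isClosed_Iic
    have e : {z ∈ X | β z ≤ 0} = X ∩ U := by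
      ext z
      have := Set.ext_iff.1 hUe z
      simp only [mem_inter_iff, mem_preimage, mem_Iic] at this
      simp only [mem_ofPred_eq, mem_inter_iff]
      tauto
    rw [e]
    exact hX.inter_right hU
  obtain ⟨ε, hε, hε'⟩ := hXc.exists_forall_le' (f := fun z => a z ^ 2)
    ((ha.mono fun z hz => hz.1).pow 2) (a := 0) fun z hz => by
      have : a z ≠ 0 := fun h0 => absurd (h z hz.1 h0) (not_lt.2 hz.2)
      positivity
  have hk : 0 ≤ (|M| + 1) / ε := by positivity
  have hpos : ∀ z ∈ X, 0 < (|M| + 1) / ε * a z ^ 2 + β z := fun z hz => by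
    rcases le_or_gt (β z) 0 with h0 | h0
    · have h1 := hε' z ⟨hz, h0⟩
      have h2 : |M| + 1 ≤ (|M| + 1) / ε * a z ^ 2 := by
        rw [div_mul_eq_mul_div, le_div_iff₀ hε]
        gcongr
      have h3 := (abs_le.1 ((hM z hz).trans (le_abs_self M))).1
      linarith
    · positivity
  obtain ⟨δ, hδ, hδ'⟩ := hX.exists_forall_le' ((continuousOn_const.mul (ha.pow 2)).add hβ) hpos
  exact ⟨_, δ, hk, hδ, hδ'⟩

theorem dEll_smul (x : Vec) (a : ℝ) (v : Vec) : dEll x (a • v) = a * dEll x v := by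
  simp only [dEll, Pi.smul_apply, smul_eq_mul]
  ring

theorem continuousOn_dEll :
    ContinuousOn (fun z : Vec × Vec => dEll z.1 z.2) (spacetime ×ˢ univ) := by
  unfold dEll
  refine ContinuousOn.div (by fun_prop) ?_ fun z hz => (rad_sq_pos hz.1).ne'
  exact ((continuous_rad.comp continuous_fst).pow 2).continuousOn

/-- The translate of an event to time zero. -/
def atTimeZero (x : Vec) : Vec := x + Pi.single 0 (-x 0)

namespace Wormhole

variable (S : Wormhole)

theorem continuousOn_radialForce :
    ContinuousOn (fun z : Vec × Vec => S.radialForce z.1 z.2) (spacetime ×ˢ univ) := by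
  have hfst : MapsTo (Prod.fst : Vec × Vec → Vec) (spacetime ×ˢ univ) spacetime := fun z hz => hz.1
  have h1 := S.contDiffOn_lapse.continuousOn.comp continuousOn_fst hfst
  have h2 := S.contDiffOn_areal.continuousOn.comp continuousOn_fst hfst
  have h3 := S.contDiffOn_rot.continuousOn.comp continuousOn_fst hfst
  have h4 := S.continuousOn_dLapse.comp continuousOn_fst hfst
  have h5 := S.continuousOn_dAreal.comp continuousOn_fst hfst
  have h6 := S.continuousOn_dRot.comp continuousOn_fst hfst
  have h7 : ContinuousOn (fun z : Vec × Vec => (rad z.1 ^ 2)⁻¹) (spacetime ×ˢ univ) :=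
    ((continuous_rad.comp continuous_fst).pow 2).continuousOn.inv₀ fun z hz =>
      (rad_sq_pos hz.1).ne'
  have h8 := continuousOn_dEll
  simp only [Function.comp_def] at h1 h2 h3 h4 h5 h6
  simp only [radialForce, roundMetric_shifted, shifted_one, shifted_two, div_eq_mul_inv]
  fun_prop

theorem radialForce_smul (x : Vec) (a : ℝ) (u : Vec) :
    S.radialForce x (a • u) = a ^ 2 * S.radialForce x u := by
  simp only [radialForce, roundMetric_shifted, shifted_one, shifted_two, dEll_smul, Pi.smul_apply,
    smul_eq_mul]
  ring

theorem atTimeZero_mem {x : Vec} (hx : x ∈ spacetime) : atTimeZero x ∈ spacetime := by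
  change 0 < rad _
  rwa [atTimeZero, rad_add_single]

theorem isCompact_nonpos {C : Set Vec} (hC : IsCompact C) (hCs : C ⊆ spacetime) {V : Set Vec}
    (hV : IsCompact V) {A : Set ℝ} (hA : IsClosed A) :
    IsCompact {z : Vec × Vec | z.1 ∈ C ∧ z.2 ∈ V ∧ S.metric z.1 z.2 z.2 ∈ A} := by
  have h1 : ContinuousOn (fun z : Vec × Vec => S.metric z.1 z.2 z.2) (C ×ˢ V) :=
    S.contDiffOn_energy.continuousOn.mono (prod_mono hCs (subset_univ _))
  convert (hC.prod hV).of_isClosed_subset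
    (h1.preimage_isClosed_of_isClosed (hC.prod hV).isClosed hA) inter_subset_left using 1
  ext z
  simp [and_assoc]

theorem fderiv_add_single {H : Vec → ℝ} {a : ℝ} (h : ∀ y, H (y + Pi.single 0 a) = H y) (x : Vec) :
    fderiv ℝ H (x + Pi.single 0 a) = fderiv ℝ H x := by
  rw [← fderiv_comp_add_right]
  congr 1
  exact funext h

theorem radialForce_add_single (x u : Vec) (a : ℝ) :
    S.radialForce (x + Pi.single 0 a) u = S.radialForce x u := by
  have h1 : ∀ y, S.lapse (y + Pi.single 0 a) = S.lapse y := fun y => by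
    rw [lapse, ell_add_single, theta_add_single, lapse]
  have h2 : ∀ y, S.areal (y + Pi.single 0 a) = S.areal y := fun y => by
    rw [areal, ell_add_single, theta_add_single, areal]
  have h3 : ∀ y, S.rot (y + Pi.single 0 a) = S.rot y := fun y => by
    rw [rot, ell_add_single, theta_add_single, rot]
  have h4 : radial (x + Pi.single 0 a) = radial x := by
    funext i
    fin_cases i <;> simp [radial]
  simp only [radialForce, dLapse, dAreal, dRot, fderiv_add_single h1, fderiv_add_single h2,
    fderiv_add_single h3, h1, h2, h3, h4, roundMetric_shifted, shifted_one,
    shifted_two, rad_add_single, dEll_add_single]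
  simp

/-- On compact sets, causal vectors are bounded by their time components. -/
theorem exists_causal_bound {C : Set Vec} (hC : IsCompact C) (hCs : C ⊆ spacetime) :
    ∃ B : ℝ, 0 < B ∧ ∀ x ∈ C, ∀ v, S.metric x v v ≤ 0 → ‖v‖ ≤ B * |v 0| := by
  -- By homogeneity unit vectors suffice; on the compact set of causal unit vectors the time
  -- component is bounded away from zero.
  have hK := S.isCompact_nonpos hC hCs (isCompact_sphere (0 : Vec) 1) (isClosed_Iic (a := (0 : ℝ)))
  obtain ⟨ε, hε, hε'⟩ := hK.exists_forall_le' (f := fun z => |z.2 0|) (a := 0)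
    (by fun_prop) fun z hz => by
      refine abs_pos.2 fun h0 => ?_
      have := eq_zero_of_metric_self_nonpos (hCs hz.1) h0 hz.2.2
      have h1 := hz.2.1
      rw [this] at h1
      simp at h1
  refine ⟨ε⁻¹, inv_pos.2 hε, fun x hx v hv => ?_⟩
  by_cases h0 : v = 0
  · simp [h0]
  have hn : 0 < ‖v‖ := norm_pos_iff.2 h0
  have h1 : S.metric x (‖v‖⁻¹ • v) (‖v‖⁻¹ • v) ≤ 0 := by
    rw [metric_smul_left, metric_comm, metric_smul_left]
    exact mul_nonpos_of_nonneg_of_nonpos (by positivity)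
      (mul_nonpos_of_nonneg_of_nonpos (by positivity) hv)
  have h2 := hε' (x, ‖v‖⁻¹ • v) ⟨hx, by
    rw [mem_sphere_zero_iff_norm, norm_smul, norm_inv, norm_norm, inv_mul_cancel₀ hn.ne'], h1⟩
  simp only [Pi.smul_apply, smul_eq_mul, abs_mul, abs_inv, abs_norm] at h2
  rw [inv_mul_eq_div, le_div_iff₀ hn] at h2
  rwa [inv_mul_eq_div, le_div_iff₀ hε, mul_comm]

/-- Past-pointing lightlike directions, normalised to `dt = -1`. -/
def pastNullDirections (C : Set Vec) : Set (Vec × Vec) :=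
  {z | z.1 ∈ C ∧ z.2 0 = -1 ∧ S.metric z.1 z.2 z.2 = 0}

theorem isCompact_pastNullDirections {C : Set Vec} (hC : IsCompact C) (hCs : C ⊆ spacetime) :
    IsCompact (S.pastNullDirections C) := by
  obtain ⟨B, hB, hB'⟩ := S.exists_causal_bound hC hCs
  have hV : IsCompact (Metric.closedBall (0 : Vec) B ∩ {v | v 0 = -1}) :=
    (isCompact_closedBall _ _).inter_right (isClosed_eq (continuous_apply 0) continuous_const)
  convert S.isCompact_nonpos hC hCs hV (isClosed_singleton (x := (0 : ℝ))) using 1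
  ext z
  simp only [pastNullDirections, mem_ofPred_eq, mem_inter_iff, mem_closedBall_zero_iff,
    mem_singleton_iff]
  constructor
  · rintro ⟨h1, h2, h3⟩
    refine ⟨h1, ⟨?_, h2⟩, h3⟩
    simpa [h2] using hB' z.1 h1 z.2 h3.le
  · rintro ⟨h1, ⟨-, h2⟩, h3⟩
    exact ⟨h1, h2, h3⟩

/-- Lightlike geodesics that stay over a compact subset of `M_out` or `M_in` have bounded duration
and velocity. -/
theorem exists_confinement_bound {σ : ℝ} (hσ : σ ^ 2 = 1) {C : Set Vec} (hC : IsCompact C)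
    (hCσ : C ⊆ S.region σ) :
    ∃ D V : ℝ, 0 ≤ D ∧ ∀ c u : ℝ → Vec, S.IsPastNullGeodesic c u →
      (∀ s ∈ Icc (0 : ℝ) 1, atTimeZero (c s) ∈ C) →
      ∀ s ∈ Icc (0 : ℝ) 1, c 0 0 - D ≤ c s 0 ∧ c s 0 ≤ c 0 0 ∧ ‖u s‖ ≤ V := by
  have hCs : C ⊆ spacetime := fun x hx => (hCσ hx).1
  have hX := S.isCompact_pastNullDirections hC hCs
  have hXs : S.pastNullDirections C ⊆ spacetime ×ˢ univ := fun z hz => ⟨hCs hz.1, mem_univ _⟩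
  have c1 : ContinuousOn (fun z : Vec × Vec => dEll z.1 z.2) (S.pastNullDirections C) :=
    continuousOn_dEll.mono hXs
  have c2 : ContinuousOn (fun z : Vec × Vec => S.Γ z.1 z.2 z.2 0) (S.pastNullDirections C) :=
    ((continuous_apply 0).comp_continuousOn S.contDiffOn_Γ.continuousOn).mono hXs
  have c3 : ContinuousOn (fun z : Vec × Vec => S.radialForce z.1 z.2) (S.pastNullDirections C) :=
    S.continuousOn_radialForce.mono hXs
  obtain ⟨Y, hY⟩ := hX.exists_bound_of_continuousOn c1
  obtain ⟨g, hg⟩ := hX.exists_bound_of_continuousOn c2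
  obtain ⟨B, hB, hB'⟩ := S.exists_causal_bound hC hCs
  obtain ⟨L, hL⟩ := hC.exists_bound_of_continuousOn (continuousOn_ell.mono hCs)
  -- With `T = -t` as parameter, `a` is the derivative of σℓ and `β` its second derivative. The `Γ`
  -- term comes from the reparametrisation and vanishes at turning points.
  obtain ⟨k, δ, hk, hδ, hkδ⟩ := exists_pos_le_mul_sq_add hX
    (a := fun z => σ * dEll z.1 z.2)
    (β := fun z => σ * S.radialForce z.1 z.2 - σ * dEll z.1 z.2 * S.Γ z.1 z.2 z.2 0)
    (continuousOn_const.mul c1) ((continuousOn_const.mul c3).sub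
      ((continuousOn_const.mul c1).mul c2)) fun z hz h0 => by
        have hd : dEll z.1 z.2 = 0 := by
          have : σ ≠ 0 := fun h => by simp [h] at hσ
          exact (mul_eq_zero.1 h0).resolve_left this
        rw [hd, mul_zero, zero_mul, sub_zero]
        exact radialForce_pos hσ (hCσ hz.1) hz.2.2 (by rw [hz.2.1]; norm_num) hd
  have hσ1 : |σ| = 1 := by
    rw [← sq_eq_sq₀ (abs_nonneg _) zero_le_one, sq_abs, hσ, one_pow]
  set D := |2 * Real.exp (k * L) * Y / (δ * Real.exp (-(k * L)))| with hD
  -- The velocity bound has three sources: `m = dT/ds` starts at no more than `D exp(|g| D)`,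
  -- because unit parameter length consumes at most time `D`; it grows at most by another factor
  -- `exp(|g| D)`; and the norm of a causal vector is at most `B` times the modulus of its time
  -- component.
  refine ⟨D, B * (D * Real.exp (|g| * D) * Real.exp (|g| * D)), abs_nonneg _,
    fun c u hcu hcC => ?_⟩
  obtain ⟨hgeo, hnull⟩ := hcu
  have hIcc0 : (0 : ℝ) ∈ Icc (0 : ℝ) 1 := by simp
  have hIcc1 : (1 : ℝ) ∈ Icc (0 : ℝ) 1 := by simp
  -- the normalised direction
  set m : ℝ → ℝ := fun s => -u s 0 with hm
  have hm0 : ∀ s ∈ Icc (0 : ℝ) 1, 0 < m s := fun s hs => neg_pos.2 (hnull s hs).2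
  set w : ℝ → Vec := fun s => (m s)⁻¹ • u s with hw
  have hu : ∀ s ∈ Icc (0 : ℝ) 1, u s = m s • w s := fun s hs => by
    rw [hw, smul_smul, mul_inv_cancel₀ (hm0 s hs).ne', one_smul]
  have hz : ∀ s ∈ Icc (0 : ℝ) 1, (atTimeZero (c s), w s) ∈ S.pastNullDirections C := fun s hs => by
    refine ⟨hcC s hs, ?_, ?_⟩
    · have h0 := (hm0 s hs).ne'
      simp only [hw, Pi.smul_apply, smul_eq_mul]
      rw [inv_mul_eq_div, div_eq_iff h0]
      simp [hm]
    · simp only [atTimeZero, metric_add_single, hw]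
      rw [metric_smul_left, metric_comm, metric_smul_left, (hnull s hs).1, mul_zero, mul_zero]
  have ez : ∀ s, dEll (atTimeZero (c s)) (w s) = dEll (c s) (w s) := fun s => dEll_add_single _ _ _
  have eΓ : ∀ s, S.Γ (atTimeZero (c s)) (w s) (w s) 0 = S.Γ (c s) (w s) (w s) 0 := fun s => by
    rw [atTimeZero, Γ_add_single]
  have er : ∀ s, S.radialForce (atTimeZero (c s)) (w s) = S.radialForce (c s) (w s) := fun s => by
    rw [atTimeZero, radialForce_add_single]
  have hΓu : ∀ s ∈ Icc (0 : ℝ) 1, S.Γ (c s) (u s) (u s) 0 = m s ^ 2 * S.Γ (c s) (w s) (w s) 0 :=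
    fun s hs => by
      rw [hu s hs, Γ_smul_left, Γ_smul_right]
      simp only [Pi.smul_apply, smul_eq_mul]
      ring
  have hm' : ∀ s ∈ Icc (0 : ℝ) 1,
      HasDerivWithinAt m (S.Γ (c s) (w s) (w s) 0 * m s ^ 2) (Icc 0 1) s := fun s hs => by
    have := (hasDerivWithinAt_pi.1 (hgeo s hs).2.2 0).neg
    refine this.congr_deriv ?_
    rw [Pi.neg_apply, neg_neg, hΓu s hs, mul_comm]
  have hT' : ∀ s ∈ Icc (0 : ℝ) 1, HasDerivWithinAt (fun s => -c s 0) (m s) (Icc 0 1) s :=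
    fun s hs => (hasDerivWithinAt_pi.1 (hgeo s hs).2.1 0).neg
  have hf' : ∀ s ∈ Icc (0 : ℝ) 1, HasDerivWithinAt (fun s => σ * ell (c s))
      (σ * dEll (c s) (w s) * m s) (Icc 0 1) s := fun s hs => by
    obtain ⟨Q, hQ, hQ'⟩ := hasFDerivAt_ell (hgeo s hs).1
    have := (hQ.comp_hasDerivWithinAt s (hgeo s hs).2.1).const_mul σ
    refine this.congr_deriv ?_
    rw [hQ', hu s hs, dEll_smul]
    ring
  have hy' : ∀ s ∈ Icc (0 : ℝ) 1, HasDerivWithinAt (fun s => σ * dEll (c s) (w s))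
      ((σ * S.radialForce (c s) (w s) - σ * dEll (c s) (w s) * S.Γ (c s) (w s) (w s) 0) * m s)
      (Icc 0 1) s := fun s hs => by
    have h1 := ((hasDerivWithinAt_dEll (fun s hs => (hgeo s hs).1) hs (hgeo s hs).2.1
      (hgeo s hs).2.2).div (hm' s hs) (hm0 s hs).ne').const_mul σ
    refine (h1.congr_deriv ?_).congr_of_mem (fun r hr => ?_) hs
    · rw [hu s hs, radialForce_smul, dEll_smul]
      have := (hm0 s hs).ne'
      field_simp
    · simp only [hw, dEll_smul, Pi.div_apply]
      ring
  have hDle : ∀ s ∈ Icc (0 : ℝ) 1, c 0 0 - D ≤ c s 0 ∧ c s 0 ≤ c 0 0 := by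
    have hdur := duration_le (β := fun s => σ * S.radialForce (c s) (w s) -
        σ * dEll (c s) (w s) * S.Γ (c s) (w s) (w s) 0) (L := L) (Y := Y) hk hδ hf' hy' hT'
      (fun s hs => (hm0 s hs).le) (fun s hs => by
        have := hkδ _ (hz s hs)
        simpa only [ez, eΓ, er] using this) (fun s hs => by
        rw [abs_mul, hσ1, one_mul]
        have := hL _ (hcC s hs)
        rwa [atTimeZero, ell_add_single] at this) (fun s hs => by
        rw [abs_mul, hσ1, one_mul]
        have := hY _ (hz s hs)
        rwa [Real.norm_eq_abs, ez] at this)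
    have hmono := monotoneOn_unitInterval hT' fun s hs => (hm0 s hs).le
    intro s hs
    have h1 := hmono hIcc0 hs hs.1
    have h2 := hmono hs hIcc1 hs.2
    have h3 := hdur.trans (le_abs_self _)
    rw [← hD] at h3
    simp only at h1 h2 h3
    constructor <;> linarith
  have hgw : ∀ s ∈ Icc (0 : ℝ) 1, |S.Γ (c s) (w s) (w s) 0| ≤ |g| := fun s hs => by
    have := (hg _ (hz s hs)).trans (le_abs_self g)
    rwa [Real.norm_eq_abs, eΓ] at this
  -- From `m' = Γ⁰ m²` and `T' = m` it follows that `d(log m)/dT = Γ⁰`, which is bounded by `|g|`.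
  -- So `log m` changes by at most `|g| D` in either direction.
  have hup : ∀ s ∈ Icc (0 : ℝ) 1, m 0 * Real.exp (-(|g| * D)) ≤ m s := fun s hs => by
    have h1 := monotoneOn_unitInterval (f := fun s => m s * Real.exp (|g| * (-c s 0)))
      (fun s hs => (hm' s hs).mul (((hT' s hs).const_mul |g|).exp)) (fun s hs => by
        have := (abs_le.1 (hgw s hs)).1
        have h2 := hm0 s hs
        have h3 := Real.exp_pos (|g| * (-c s 0))
        have h4 : 0 ≤ (S.Γ (c s) (w s) (w s) 0 + |g|) * (m s ^ 2 * Real.exp (|g| * (-c s 0))) :=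
          mul_nonneg (by linarith) (by positivity)
        linarith) hIcc0 hs hs.1
    simp only at h1
    calc m 0 * Real.exp (-(|g| * D)) ≤ m 0 * Real.exp (|g| * (c s 0 - c 0 0)) := by
          have := (hDle s hs).1
          have h2 := hm0 0 hIcc0
          gcongr
          nlinarith [abs_nonneg g]
      _ = m 0 * Real.exp (|g| * -c 0 0) * Real.exp (|g| * c s 0) := by
          rw [mul_assoc, ← Real.exp_add]
          congr 2
          ring
      _ ≤ m s * Real.exp (|g| * -c s 0) * Real.exp (|g| * c s 0) := by gcongr
      _ = m s := by
          rw [mul_assoc, ← Real.exp_add, mul_neg, neg_add_cancel, Real.exp_zero, mul_one]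
  have hdown : ∀ s ∈ Icc (0 : ℝ) 1, m s ≤ m 0 * Real.exp (|g| * D) := fun s hs => by
    have h1 := monotoneOn_unitInterval (f := fun s => -(m s * Real.exp (-|g| * (-c s 0))))
      (fun s hs => ((hm' s hs).mul (((hT' s hs).const_mul (-|g|)).exp)).neg) (fun s hs => by
        have := (abs_le.1 (hgw s hs)).2
        have h2 := hm0 s hs
        have h4 : 0 ≤ (|g| - S.Γ (c s) (w s) (w s) 0) * (m s ^ 2 * Real.exp (-|g| * (-c s 0))) :=
          mul_nonneg (by linarith) (by positivity)
        linarith) hIcc0 hs hs.1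
    simp only [neg_le_neg_iff] at h1
    calc m s = m s * Real.exp (-|g| * -c s 0) * Real.exp (-|g| * c s 0) := by
          rw [mul_assoc, ← Real.exp_add, mul_neg, neg_add_cancel, Real.exp_zero, mul_one]
      _ ≤ m 0 * Real.exp (-|g| * -c 0 0) * Real.exp (-|g| * c s 0) := by gcongr
      _ = m 0 * Real.exp (|g| * (c 0 0 - c s 0)) := by
          rw [mul_assoc, ← Real.exp_add]
          congr 2
          ring
      _ ≤ m 0 * Real.exp (|g| * D) := by
          have := (hDle s hs).1
          have h2 := hm0 0 hIcc0
          gcongr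
          linarith
  have hm0D : m 0 ≤ D * Real.exp (|g| * D) := by
    have h1 := monotoneOn_unitInterval (f := fun s => -c s 0 - m 0 * Real.exp (-(|g| * D)) * s)
      (fun s hs => (hT' s hs).sub ((hasDerivWithinAt_id s _).const_mul _)) (fun s hs => by
        rw [mul_one]
        linarith [hup s hs]) hIcc0 hIcc1 zero_le_one
    have h2 := (hDle 1 hIcc1).1
    simp only at h1
    have h3 : m 0 * Real.exp (-(|g| * D)) ≤ D := by linarith
    rwa [Real.exp_neg, ← div_eq_mul_inv, div_le_iff₀ (Real.exp_pos _)] at h3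
  intro s hs
  refine ⟨(hDle s hs).1, (hDle s hs).2, ?_⟩
  have h1 := hB' _ (hcC s hs) (u s) (by
    rw [atTimeZero, metric_add_single]
    exact (hnull s hs).1.le)
  have h2 : |u s 0| = m s := abs_of_neg (hnull s hs).2
  rw [h2] at h1
  refine h1.trans (mul_le_mul_of_nonneg_left ?_ hB.le)
  exact (hdown s hs).trans (mul_le_mul_of_nonneg_right hm0D (Real.exp_pos _).le)

end Wormhole

end RotatingWormhole

end

/-! ### Confinement of the avoiding arcs to a compact set. -/

noncomputable section

namespace RotatingWormhole

open Set Filter Topology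

/-- A function with positive second derivative at its turning points attains its maximum at the
boundary. -/
theorem le_max_of_turning_points {f f' f'' : ℝ → ℝ}
    (hf : ∀ s ∈ Icc (0 : ℝ) 1, HasDerivWithinAt f (f' s) (Icc 0 1) s)
    (hf' : ∀ s ∈ Icc (0 : ℝ) 1, HasDerivWithinAt f' (f'' s) (Icc 0 1) s)
    (h : ∀ s ∈ Icc (0 : ℝ) 1, f' s = 0 → 0 < f'' s) :
    ∀ s ∈ Icc (0 : ℝ) 1, f s ≤ max (f 0) (f 1) := by
  obtain ⟨a, ha, hmax⟩ := isCompact_Icc.exists_isMaxOn (nonempty_Icc.2 zero_le_one)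
    (fun s hs => (hf s hs).continuousWithinAt : ContinuousOn f (Icc 0 1))
  intro s hs
  refine (hmax hs).trans ?_
  rcases eq_or_lt_of_le ha.1 with h0 | h0
  · rw [← h0]; exact le_max_left _ _
  rcases eq_or_lt_of_le ha.2 with h1 | h1
  · rw [h1]; exact le_max_right _ _
  exfalso
  have hnhds : Icc (0 : ℝ) 1 ∈ 𝓝 a := Icc_mem_nhds h0 h1
  have hz : f' a = 0 :=
    (hmax.isLocalMax hnhds).hasDerivAt_eq_zero ((hf a ha).hasDerivAt hnhds)
  have hd := (hf' a ha).hasDerivAt hnhds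
  have hpos : 0 < deriv f' a := by rw [hd.deriv]; exact h a ha hz
  -- Near the interior maximum `a`, `f'` has the sign of `r - a`, so `f` would increase strictly to
  -- the right of its maximum.
  have hev := eventually_nhdsWithin_sign_eq_of_deriv_pos hpos hz
  obtain ⟨ε, hε, hb⟩ := Metric.eventually_nhds_iff.1 hev
  set b' := min (a + ε / 2) 1 with hb'
  have hab' : a < b' := lt_min (by linarith) h1
  have hsub : Icc a b' ⊆ Icc 0 1 := Icc_subset_Icc h0.le (min_le_right _ _)
  have hmono : StrictMonoOn f (Icc a b') := by
    refine strictMonoOn_of_hasDerivWithinAt_pos (f' := f') (convex_Icc _ _)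
      (fun r hr => ((hf r (hsub hr)).continuousWithinAt).mono hsub)
      (fun r hr => (hf r (hsub (interior_subset hr))).mono (interior_subset.trans hsub)) ?_
    intro r hr
    rw [interior_Icc] at hr
    have h2 : SignType.sign (f' r) = SignType.sign (r - a) :=
      hb (by
        rw [Real.dist_eq, abs_of_pos (sub_pos.2 hr.1)]
        linarith [hr.2.le.trans (min_le_left (a + ε / 2) 1)])
    rw [sign_pos (sub_pos.2 hr.1)] at h2
    exact sign_eq_one_iff.1 h2
  exact absurd (hmono (left_mem_Icc.2 hab'.le) (right_mem_Icc.2 hab'.le) hab')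
    (not_lt.2 (hmax (hsub (right_mem_Icc.2 hab'.le))))

namespace Wormhole

variable {S : Wormhole}

theorem lapse_add_single (x : Vec) (a : ℝ) : S.lapse (x + Pi.single 0 a) = S.lapse x := by
  rw [lapse, ell_add_single, theta_add_single, lapse]

theorem add_single_mem_region {σ : ℝ} {x : Vec} (hx : x ∈ S.region σ) (a : ℝ) :
    x + Pi.single 0 a ∈ S.region σ := by
  have h2 : ∀ y, S.areal (y + Pi.single 0 a) = S.areal y := fun y => by
    rw [areal, ell_add_single, theta_add_single, areal]
  have h3 : ∀ y, S.rot (y + Pi.single 0 a) = S.rot y := fun y => by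
    rw [rot, ell_add_single, theta_add_single, rot]
  have h4 : radial (x + Pi.single 0 a) = radial x := by
    funext i
    fin_cases i <;> simp [radial]
  have h5 : x + Pi.single 0 a ∈ spacetime := by
    change 0 < rad _
    rw [rad_add_single]
    exact hx.1
  refine ⟨h5, ?_⟩
  simpa only [theta_add_single, dRot, slope, dLapse, dAreal, h4, h2, lapse_add_single,
    fderiv_add_single (fun y => S.lapse_add_single y a), fderiv_add_single h2,
    fderiv_add_single h3] using hx.2

theorem mem_region_of_notMem_K {x : Vec} (hx : x ∈ spacetime) (hK : x ∉ S.K) :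
    x ∈ S.region 1 ∨ x ∈ S.region (-1) := by
  by_contra! h
  exact hK ⟨hx, fun h' => by
    rcases h' with h' | h'
    · exact h.2 (S.Min_eq_region ▸ h')
    · exact h.1 (S.Mout_eq_region ▸ h')⟩

/-- A connected arc avoiding `K` stays in one of the two regions. -/
theorem exists_region {c : ℝ → Vec} (hc : ContinuousOn c (Icc 0 1))
    (hs : ∀ s ∈ Icc (0 : ℝ) 1, c s ∈ spacetime ∧ c s ∉ S.K) :
    ∃ σ : ℝ, (σ = 1 ∨ σ = -1) ∧ ∀ s ∈ Icc (0 : ℝ) 1, c s ∈ S.region σ := by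
  have hcon : IsPreconnected (c '' Icc 0 1) := isPreconnected_Icc.image c hc
  have hcov : c '' Icc 0 1 ⊆ S.region 1 ∪ S.region (-1) := by
    rintro _ ⟨s, hs', rfl⟩
    exact mem_region_of_notMem_K (hs s hs').1 (hs s hs').2
  rcases hcon.subset_or_subset (S.isOpen_region 1) (S.isOpen_region (-1)) (S.disjoint_region 1)
    hcov with h | h
  · exact ⟨1, Or.inl rfl, fun s hs => h (mem_image_of_mem c hs)⟩
  · exact ⟨-1, Or.inr rfl, fun s hs => h (mem_image_of_mem c hs)⟩

theorem IsGeodesic.continuousOn {c u : ℝ → Vec} (h : S.IsGeodesic c u) :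
    ContinuousOn c (Icc 0 1) := fun s hs => (h s hs).2.1.continuousWithinAt

/-- Turning points of σℓ have positive second derivative by `radialForce_pos`, so there is no
interior maximum. -/
theorem ell_le_max {σ : ℝ} (hσ : σ ^ 2 = 1) {c u : ℝ → Vec} (h : S.IsPastNullGeodesic c u)
    (hreg : ∀ s ∈ Icc (0 : ℝ) 1, c s ∈ S.region σ) :
    ∀ s ∈ Icc (0 : ℝ) 1, σ * ell (c s) ≤ max (σ * ell (c 0)) (σ * ell (c 1)) := by
  refine le_max_of_turning_points (f := fun s => σ * ell (c s))
    (f' := fun s => σ * dEll (c s) (u s)) (f'' := fun s => σ * S.radialForce (c s) (u s))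
    (fun s hs => ?_) (fun s hs => ?_) (fun s hs h0 => ?_)
  · obtain ⟨Q, hQ, hQ'⟩ := hasFDerivAt_ell (h.1 s hs).1
    have := (hQ.comp_hasDerivWithinAt s (h.1 s hs).2.1).const_mul σ
    rwa [hQ'] at this
  · exact (hasDerivWithinAt_dEll (fun s hs => (h.1 s hs).1) hs (h.1 s hs).2.1
      (h.1 s hs).2.2).const_mul σ
  · have hσ0 : σ ≠ 0 := fun h => by simp [h] at hσ
    exact radialForce_pos hσ (hreg s hs) (h.2 s hs).1 (h.2 s hs).2.ne
      ((mul_eq_zero.1 h0).resolve_left hσ0)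

/-- By `abs_dEll_le` the lapse bounds the radial speed of causal curves per unit of coordinate time;
a global bound lets ℓ change only by a finite amount in finite time. -/
theorem exists_lapse_bound (S : Wormhole) : ∃ B : ℝ, 0 < B ∧ ∀ x ∈ spacetime, S.lapse x ≤ B := by
  obtain ⟨C, L, hL, h⟩ := S.asymptotics
  obtain ⟨M, hM⟩ := (isCompact_slab L 0 0).exists_bound_of_continuousOn
    (S.contDiffOn_lapse.continuousOn.mono (slab_subset _ _ _))
  refine ⟨max |M| (1 + |C| / L), lt_max_of_lt_right (by positivity), fun x hx => ?_⟩
  rcases le_or_gt L |ell x| with h0 | h0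
  · refine le_max_of_le_right ?_
    have h1 := (h (ell x) h0 (theta x) (theta_mem x)).1
    have h2 : C / |ell x| ≤ |C| / L := by
      have := le_abs_self C
      gcongr
    have h3 := (abs_le.1 h1).2
    change S.lapse x - 1 ≤ _ at h3
    linarith
  · refine le_max_of_le_left ?_
    have h1 := hM (atTimeZero x) ⟨atTimeZero_mem hx, by rw [atTimeZero, ell_add_single]; exact h0.le,
      by simp [atTimeZero]⟩
    rw [atTimeZero, lapse_add_single] at h1
    exact (le_abs_self _).trans (h1.trans (le_abs_self M))

variable {τa : EReal} {γ : ℝ → Vec}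

theorem isOpen_timeDomain (τa : EReal) : IsOpen {τ : ℝ | (τ : EReal) < τa} :=
  isOpen_Iio.preimage continuous_coe_real_ereal

theorem IsTimelikeCurve.hasDerivAt (hγ : S.IsTimelikeCurve τa γ) {τ : ℝ} (hτ : (τ : EReal) < τa) :
    HasDerivAt γ (deriv γ τ) τ :=
  ((hγ.1.contDiffAt ((isOpen_timeDomain τa).mem_nhds hτ)).differentiableAt (by simp)).hasDerivAt

theorem IsTimelikeCurve.deriv_zero (hγ : S.IsTimelikeCurve τa γ) {τ : ℝ}
    (hτ : (τ : EReal) < τa) : deriv γ τ 0 = 1 := by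
  have h1 := hasDerivAt_pi.1 (hγ.hasDerivAt hτ) 0
  have h2 : HasDerivAt (fun τ => γ τ 0) 1 τ :=
    (hasDerivAt_id τ).congr_of_eventuallyEq (by
      filter_upwards [(isOpen_timeDomain τa).mem_nhds hτ] with r hr
      exact (hγ.2 r hr).2.1)
  exact h1.unique h2

theorem lt_of_le_of_mem {a τ : ℝ} (h : a ≤ τ) (hτ : (τ : EReal) < τa) : (a : EReal) < τa :=
  lt_of_le_of_lt (EReal.coe_le_coe_iff.2 h) hτ

theorem abs_dEll_le {x v : Vec} (hx : x ∈ spacetime) (hv : S.metric x v v ≤ 0) :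
    |dEll x v| ≤ S.lapse x * |v 0| := by
  have hN := S.lapse_pos x
  refine abs_le_of_sq_le_sq ?_ (by positivity)
  have h1 := roundMetric_self_nonneg hx (S.shifted x v)
  have h2 : 0 ≤ S.areal x ^ 2 * roundMetric x (S.shifted x v) (S.shifted x v) := by positivity
  rw [metric_def] at hv
  rw [mul_pow, sq_abs]
  linarith

/-- A timelike curve whose radius is bounded in the far past has bounded radius before any given
time. -/
theorem IsTimelikeCurve.exists_ell_bound (hγ : S.IsTimelikeCurve τa γ)
    (hb : ∃ B T : ℝ, ∀ τ : ℝ, (τ : EReal) < τa → τ ≤ T → |ell (γ τ)| ≤ B) (t : ℝ) :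
    ∃ B : ℝ, ∀ τ : ℝ, (τ : EReal) < τa → τ ≤ t → |ell (γ τ)| ≤ B := by
  obtain ⟨B, T, hB⟩ := hb
  obtain ⟨N, hN, hN'⟩ := S.exists_lapse_bound
  refine ⟨B + N * |t - T|, fun τ hτ hτt => ?_⟩
  have hNt : 0 ≤ N * |t - T| := by positivity
  rcases le_or_gt τ T with h | h
  · have := hB τ hτ h
    linarith
  have h1 := Convex.norm_image_sub_le_of_norm_hasDerivWithin_le (f := fun τ => ell (γ τ))
    (f' := fun τ => dEll (γ τ) (deriv γ τ)) (C := N) (s := Icc T τ) (fun r hr => by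
      have hr' := lt_of_le_of_mem hr.2 hτ
      obtain ⟨Q, hQ, hQ'⟩ := hasFDerivAt_ell (hγ.2 r hr').1
      have := hQ.comp_hasDerivAt r (hγ.hasDerivAt hr')
      rw [hQ'] at this
      exact this.hasDerivWithinAt) (fun r hr => by
      have hr' := lt_of_le_of_mem hr.2 hτ
      have := abs_dEll_le (hγ.2 r hr').1 (hγ.2 r hr').2.2.le
      rw [hγ.deriv_zero hr', abs_one, mul_one] at this
      exact this.trans (hN' _ (hγ.2 r hr').1)) (convex_Icc T τ) (left_mem_Icc.2 h.le)
      (right_mem_Icc.2 h.le)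
  have h2 := hB T (lt_of_le_of_mem h.le hτ) le_rfl
  rw [Real.norm_eq_abs, Real.norm_eq_abs] at h1
  have h3 : |τ - T| ≤ |t - T| := by
    rw [abs_of_pos (by linarith), abs_of_pos (by linarith)]
    linarith
  have h4 : N * |τ - T| ≤ N * |t - T| := by gcongr
  calc |ell (γ τ)| = |ell (γ T) + (ell (γ τ) - ell (γ T))| := by ring_nf
    _ ≤ |ell (γ T)| + |ell (γ τ) - ell (γ T)| := abs_add_le _ _
    _ ≤ _ := by linarith

/-- A timelike curve is Lipschitz while it stays in a slab. -/
theorem IsTimelikeCurve.exists_lipschitz (hγ : S.IsTimelikeCurve τa γ) {L a b : ℝ}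
    (hL : ∀ τ : ℝ, (τ : EReal) < τa → τ ≤ b → |ell (γ τ)| ≤ L) :
    ∃ B : ℝ, 0 < B ∧ ∀ τ τ' : ℝ, a ≤ τ → τ ≤ τ' → τ' ≤ b → (τ' : EReal) < τa →
      ‖γ τ' - γ τ‖ ≤ B * (τ' - τ) := by
  obtain ⟨B, hB, hB'⟩ := S.exists_causal_bound (isCompact_slab L a b) (slab_subset _ _ _)
  refine ⟨B, hB, fun τ τ' h1 h2 h3 h4 => ?_⟩
  have := Convex.norm_image_sub_le_of_norm_hasDerivWithin_le (f := γ)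
    (f' := deriv γ) (C := B) (s := Icc τ τ')
    (fun r hr => (hγ.hasDerivAt (lt_of_le_of_mem hr.2 h4)).hasDerivWithinAt) (fun r hr => by
      have hr' := lt_of_le_of_mem hr.2 h4
      obtain ⟨g1, g2, g3⟩ := hγ.2 r hr'
      have := hB' (γ r) ⟨g1, hL r hr' (hr.2.trans h3), by rw [g2]; exact ⟨h1.trans hr.1,
        hr.2.trans h3⟩⟩ (deriv γ r) g3.le
      rwa [hγ.deriv_zero hr', abs_one, mul_one] at this) (convex_Icc _ _) (left_mem_Icc.2 h2)
    (right_mem_Icc.2 h2)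
  rwa [Real.norm_of_nonneg (sub_nonneg.2 h2)] at this

theorem IsPastNullGeodesic.time_lt {c u : ℝ → Vec} (h : S.IsPastNullGeodesic c u) :
    c 1 0 < c 0 0 := by
  have hanti : StrictAntiOn (fun s => c s 0) (Icc 0 1) :=
    strictAntiOn_of_hasDerivWithinAt_neg (f' := fun s => u s 0) (convex_Icc _ _)
      (fun s hs => (hasDerivWithinAt_pi.1 (h.1 s hs).2.1 0).continuousWithinAt)
      (fun s hs => (hasDerivWithinAt_pi.1 (h.1 s (interior_subset hs)).2.1 0).mono interior_subset)
      (fun s hs => (h.2 s (interior_subset hs)).2)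
  exact hanti (by simp) (by simp) zero_lt_one

/-- All lightlike geodesic arcs from `p` to `γ` that avoid `W` stay in a compact subset of the
tangent bundle. -/
theorem exists_compact_confinement {p : Vec} (hγ : S.IsTimelikeCurve τa γ)
    (hb : ∃ B T : ℝ, ∀ τ : ℝ, (τ : EReal) < τa → τ ≤ T → |ell (γ τ)| ≤ B)
    {W : Set Vec} (hW : IsOpen W) (hKW : S.K ⊆ W) (hstat : ∀ x ∈ W, ∀ a : ℝ, x + Pi.single 0 a ∈ W) :
    ∃ L t V : ℝ, (∀ τ : ℝ, (τ : EReal) < τa → τ ≤ p 0 → |ell (γ τ)| ≤ L) ∧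
      ∀ c u : ℝ → Vec, S.IsPastNullGeodesic c u → c 0 = p →
      c 1 ∈ γ '' {τ : ℝ | (τ : EReal) < τa} → (∀ s ∈ Icc (0 : ℝ) 1, c s ∉ W) →
      ∀ s ∈ Icc (0 : ℝ) 1, c s ∈ slab L t (p 0) ∧ ‖u s‖ ≤ V := by
  obtain ⟨B, hB⟩ := hγ.exists_ell_bound hb (p 0)
  obtain ⟨L₀, hL₀, hfar⟩ := S.exists_far_bound
  set L := max L₀ (max |ell p| B) with hL
  have hregion : ∀ σ : ℝ, σ = 1 ∨ σ = -1 → ∃ D V : ℝ, 0 ≤ D ∧ ∀ c u : ℝ → Vec,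
      S.IsPastNullGeodesic c u → c 0 = p → c 1 ∈ γ '' {τ : ℝ | (τ : EReal) < τa} →
      (∀ s ∈ Icc (0 : ℝ) 1, c s ∉ W) → (∀ s ∈ Icc (0 : ℝ) 1, c s ∈ S.region σ) →
      ∀ s ∈ Icc (0 : ℝ) 1, c s ∈ slab L (p 0 - D) (p 0) ∧ ‖u s‖ ≤ V := by
    intro σ hσ
    have hσ2 : σ ^ 2 = 1 := by rcases hσ with rfl | rfl <;> norm_num
    have hσ1 : |σ| = 1 := by rcases hσ with rfl | rfl <;> norm_num
    -- Removing the open sets `W` and the opposite region leaves a compact set, and since `K ⊆ W` it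
    -- lies in the region σ.
    set C := slab L 0 0 \ (W ∪ S.region (-σ)) with hC
    have hCc : IsCompact C := (isCompact_slab L 0 0).diff (hW.union (S.isOpen_region _))
    have hCσ : C ⊆ S.region σ := fun x hx => by
      have h1 := mem_region_of_notMem_K (S := S) hx.1.1 fun h => hx.2 (Or.inl (hKW h))
      have h2 : x ∉ S.region (-σ) := fun h => hx.2 (Or.inr h)
      rcases hσ with rfl | rfl
      · exact h1.resolve_right h2
      · rw [neg_neg] at h2
        exact h1.resolve_left h2
    obtain ⟨D, V, hD, h⟩ := S.exists_confinement_bound hσ2 hCc hCσ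
    refine ⟨D, V, hD, fun c u hcu h0 h1 hcW hreg s hs => ?_⟩
    -- The upper bound on σℓ comes from the two endpoints, the lower one from the asymptotics
    -- through `exists_far_bound`.
    have hell : ∀ s ∈ Icc (0 : ℝ) 1, |ell (c s)| ≤ L := fun s hs => by
      have e1 := ell_le_max hσ2 hcu hreg s hs
      have e2 := hfar σ hσ _ (hreg s hs)
      have e3 : |ell (c 1)| ≤ B := by
        have hlt := hcu.time_lt
        obtain ⟨τ, hτ, hτ'⟩ := h1
        rw [h0, ← hτ', (hγ.2 τ hτ).2.1] at hlt
        rw [← hτ']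
        exact hB τ hτ hlt.le
      have e4 : ∀ x, σ * ell x ≤ |ell x| := fun x => by
        refine (le_abs_self _).trans ?_
        rw [abs_mul, hσ1, one_mul]
      have e5 : σ * ell (c s) ≤ L := by
        refine e1.trans (max_le ?_ ?_)
        · rw [h0]
          exact (e4 p).trans (le_max_of_le_right (le_max_left _ _))
        · exact (e4 _).trans (e3.trans (le_max_of_le_right (le_max_right _ _)))
      have e6 : |σ * ell (c s)| ≤ L :=
        abs_le.2 ⟨by linarith [le_max_left L₀ (max |ell p| B)], e5⟩
      rwa [abs_mul, hσ1, one_mul] at e6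
    have := h c u hcu (fun s hs => by
      refine ⟨⟨atTimeZero_mem (hcu.1 s hs).1, ?_, by simp [atTimeZero]⟩, ?_⟩
      · rw [atTimeZero, ell_add_single]
        exact hell s hs
      · rintro (hw | hw)
        · have := hstat _ hw (c s 0)
          rw [atTimeZero, add_assoc, ← Pi.single_add, neg_add_cancel, Pi.single_zero,
            add_zero] at this
          exact hcW s hs this
        · exact disjoint_left.1 (S.disjoint_region σ) (add_single_mem_region (hreg s hs) _) hw)
      s hs
    rw [h0] at this
    exact ⟨⟨(hcu.1 s hs).1, hell s hs, this.1, this.2.1⟩, this.2.2⟩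
  obtain ⟨D₁, V₁, hD₁, h₁⟩ := hregion 1 (Or.inl rfl)
  obtain ⟨D₂, V₂, hD₂, h₂⟩ := hregion (-1) (Or.inr rfl)
  refine ⟨L, p 0 - (D₁ + D₂), max V₁ V₂, fun τ hτ hτp => (hB τ hτ hτp).trans
    (le_max_of_le_right (le_max_right _ _)), fun c u hcu h0 h1 hcW s hs => ?_⟩
  obtain ⟨σ, hσ, hreg⟩ := exists_region (S := S) hcu.1.continuousOn fun s hs =>
    ⟨(hcu.1 s hs).1, fun h => hcW s hs (hKW h)⟩
  rcases hσ with rfl | rfl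
  · obtain ⟨⟨g1, g2, g3⟩, g4⟩ := h₁ c u hcu h0 h1 hcW hreg s hs
    exact ⟨⟨g1, g2, by linarith [g3.1], g3.2⟩, g4.trans (le_max_left _ _)⟩
  · obtain ⟨⟨g1, g2, g3⟩, g4⟩ := h₂ c u hcu h0 h1 hcW hreg s hs
    exact ⟨⟨g1, g2, by linarith [g3.1], g3.2⟩, g4.trans (le_max_right _ _)⟩

end Wormhole

end RotatingWormhole

end

/-! ### Local inversion, upward crossings, and a globally defined flow following geodesics. -/

noncomputable section

namespace RotatingWormhole

open Set Filter Topology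

/-- A field that is smooth on an open set agrees near a given compact subset with a smooth field
of compact support. -/
theorem exists_compactly_supported_extension {E : Type*} [NormedAddCommGroup E] [NormedSpace ℝ E]
    [FiniteDimensional ℝ E] {f : E → E} {Q U : Set E} (hQ : IsCompact Q) (hU : IsOpen U)
    (hQU : Q ⊆ U) (hf : ContDiffOn ℝ ∞ f U) :
    ∃ g : E → E, ContDiff ℝ 1 g ∧ HasCompactSupport g ∧
      ∃ O, IsOpen O ∧ Q ⊆ O ∧ O ⊆ U ∧ EqOn g f O := by
  have : ProperSpace E := FiniteDimensional.proper ℝ E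
  obtain ⟨K, hK, hQK, hKU⟩ := exists_compact_between hQ hU hQU
  obtain ⟨χ, h1, h0, -⟩ := exists_contMDiffMap_one_nhds_of_subset_interior (n := (1 : ℕ∞))
    (modelWithCornersSelf ℝ E) hQ.isClosed hQK
  have hχ : ContDiff ℝ 1 χ := χ.contMDiff.contDiff
  obtain ⟨O, hO, hQO, hOχ⟩ := mem_nhdsSet_iff_exists.1 h1
  refine ⟨fun x => χ x • f x, contDiff_iff_contDiffAt.2 fun x => ?_,
    HasCompactSupport.intro hK fun x hx => by rw [h0 x hx, zero_smul], O ∩ U, hO.inter hU,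
    subset_inter hQO hQU, inter_subset_right, fun x hx => ?_⟩
  · by_cases hx : x ∈ U
    · exact hχ.contDiffAt.smul ((hf.contDiffAt (hU.mem_nhds hx)).of_le (by norm_cast))
    · have : Kᶜ ∈ 𝓝 x := hK.isClosed.isOpen_compl.mem_nhds fun h => hx (hKU h)
      refine (contDiffAt_const (c := (0 : E))).congr_of_eventuallyEq ?_
      filter_upwards [this] with y hy
      rw [h0 y hy, zero_smul]
  · have : χ x = 1 := hOχ hx.1
    simp only [this, one_smul]

/-- If `D w = 0`, then `f` moves by `o(ε)` along `v + ε w`; the reverse Lipschitz estimate makes `ε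
w` itself `o(ε)`. This gives injectivity at nearby points without using continuity of the
derivative. -/
theorem injective_fderiv_of_antilipschitz {E : Type*} [NormedAddCommGroup E] [NormedSpace ℝ E]
    {f : E → E} {s : Set E} (hs : IsOpen s) {K : ℝ}
    (hK : ∀ x ∈ s, ∀ y ∈ s, ‖x - y‖ ≤ K * ‖f x - f y‖) {D : E →L[ℝ] E} {v : E} (hv : v ∈ s)
    (hD : HasFDerivAt f D v) : Function.Injective D := by
  refine (injective_iff_map_eq_zero D).2 fun w hw => ?_
  have hl : HasDerivAt (fun ε : ℝ => v + ε • w) w 0 := by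
    simpa using ((hasDerivAt_id (0 : ℝ)).smul_const w).const_add v
  have hD' : HasFDerivAt f D (v + (0 : ℝ) • w) := by simpa using hD
  have h1 : HasDerivAt (fun ε : ℝ => f (v + ε • w)) (D w) 0 := hD'.comp_hasDerivAt (0 : ℝ) hl
  rw [hw] at h1
  have h2 : HasDerivAt (fun ε : ℝ => v + ε • w) 0 0 := by
    rw [hasDerivAt_iff_isLittleO] at h1 ⊢
    refine Asymptotics.IsBigO.trans_isLittleO ?_ h1
    refine Asymptotics.IsBigO.of_bound K ?_
    have hmem : ∀ᶠ ε : ℝ in 𝓝 0, v + ε • w ∈ s :=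
      hl.continuousAt.eventually_mem (by simpa using hs.mem_nhds hv)
    filter_upwards [hmem] with ε hε
    simpa using hK _ hε _ (show v + (0 : ℝ) • w ∈ s by simpa using hv)
  exact hl.unique h2

/-- The inverse function theorem for strictly differentiable maps, with control of the derivative
near the base point. -/
theorem exists_local_inverse {E : Type*} [NormedAddCommGroup E] [NormedSpace ℝ E]
    [FiniteDimensional ℝ E] {f : E → E} {D : E →L[ℝ] E} {a : E} (hf : HasStrictFDerivAt f D a)
    (hD : Function.Injective D) :
    ∃ e : OpenPartialHomeomorph E E, a ∈ e.source ∧ (∀ x, e x = f x) ∧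
      ∀ v ∈ e.source, ∀ D' : E →L[ℝ] E, HasFDerivAt f D' v → Function.Injective D' := by
  have : CompleteSpace E := FiniteDimensional.complete ℝ E
  let D' : E ≃L[ℝ] E := (LinearEquiv.ofInjectiveEndo (D : E →ₗ[ℝ] E) hD).toContinuousLinearEquiv
  have hD' : (D' : E →L[ℝ] E) = D := by ext x; rfl
  rw [← hD'] at hf
  obtain ⟨s, ha, hs, happ⟩ := hf.approximates_deriv_on_open_nhds
  have hc : Subsingleton E ∨ ‖(D'.symm : E →L[ℝ] E)‖₊⁻¹ / 2 < ‖(D'.symm : E →L[ℝ] E)‖₊⁻¹ :=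
    D'.subsingleton_or_nnnorm_symm_pos.imp id fun h => NNReal.half_lt_self (inv_pos.2 h).ne'
  refine ⟨happ.toOpenPartialHomeomorph f s hc hs, ha, fun x => rfl, fun v hv D'' hD'' => ?_⟩
  obtain ⟨K, hanti⟩ : ∃ K, AntilipschitzWith K (s.domRestrict f) := ⟨_, happ.antilipschitz hc⟩
  refine injective_fderiv_of_antilipschitz hs (K := K) (fun x hx y hy => ?_) (show v ∈ s from hv) hD''
  have := hanti.le_mul_dist ⟨x, hx⟩ ⟨y, hy⟩
  rwa [Subtype.dist_eq, dist_eq_norm, dist_eq_norm] at this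

/-- A function whose zeros are all crossed upwards has at most one zero. -/
theorem false_of_upward_crossings {q q' : ℝ → ℝ} {a b : ℝ} (hab : a < b)
    (hq : ∀ τ ∈ Icc a b, HasDerivAt q (q' τ) τ) (hup : ∀ τ ∈ Icc a b, q τ = 0 → 0 < q' τ)
    (ha : q a = 0) (hb : q b = 0) : False := by
  have hsign : ∀ τ ∈ Icc a b, q τ = 0 → ∃ ε > 0, ∀ r, |r - τ| < ε →
      SignType.sign (q r) = SignType.sign (r - τ) := fun τ hτ h0 => by
    have hpos : 0 < deriv q τ := by rw [(hq τ hτ).deriv]; exact hup τ hτ h0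
    exact Metric.eventually_nhds_iff.1 (eventually_nhdsWithin_sign_eq_of_deriv_pos hpos h0)
  obtain ⟨ε, hε, hε'⟩ := hsign a (left_mem_Icc.2 hab.le) ha
  set a' := min (a + ε / 2) ((a + b) / 2) with ha'
  have haa' : a < a' := lt_min (by linarith) (by linarith)
  have ha'b : a' < b := (min_le_right _ _).trans_lt (by linarith)
  have hpos : ∀ r, a < r → r ≤ a' → 0 < q r := fun r h1 h2 => by
    have := hε' r (by
      rw [abs_of_pos (sub_pos.2 h1)]
      linarith [h2.trans (min_le_left (a + ε / 2) ((a + b) / 2))])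
    rw [sign_pos (sub_pos.2 h1)] at this
    exact sign_eq_one_iff.1 this
  -- The first point after `a'` where `q ≤ 0` is a zero with `q > 0` just before it, so it is not
  -- crossed upwards.
  set Z := Icc a' b ∩ q ⁻¹' Iic 0 with hZ
  have hsub : Icc a' b ⊆ Icc a b := Icc_subset_Icc_left haa'.le
  have hcont : ContinuousOn q (Icc a' b) := fun r hr =>
    (hq r (hsub hr)).continuousAt.continuousWithinAt
  have hZc : IsCompact Z := isCompact_Icc.of_isClosed_subset
    (hcont.preimage_isClosed_of_isClosed isClosed_Icc isClosed_Iic) inter_subset_left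
  obtain ⟨z, hz, hzmin⟩ := hZc.exists_isLeast ⟨b, right_mem_Icc.2 ha'b.le, hb.le⟩
  have haz : a' < z := by
    refine lt_of_le_of_ne hz.1.1 fun h => ?_
    have := hpos z (by rw [← h]; exact haa') h.ge
    exact absurd hz.2 (not_le.2 this)
  have hbefore : ∀ r, a' ≤ r → r < z → 0 < q r := fun r h1 h2 => by
    by_contra! h
    exact absurd (hzmin ⟨⟨h1, h2.le.trans hz.1.2⟩, h⟩) (not_le.2 h2)
  have hz0 : q z = 0 := by
    refine le_antisymm hz.2 ?_
    have hcz : Tendsto q (𝓝[<] z) (𝓝 (q z)) :=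
      (hq z (hsub hz.1)).continuousAt.continuousWithinAt
    refine ge_of_tendsto hcz ?_
    filter_upwards [Ioo_mem_nhdsLT haz] with r hr
    exact (hbefore r hr.1.le hr.2).le
  obtain ⟨η, hη, hη'⟩ := hsign z (hsub hz.1) hz0
  set r := max a' (z - η / 2) with hr
  have hrz : r < z := max_lt haz (by linarith)
  have h1 := hη' r (by
    rw [abs_sub_comm, abs_of_pos (sub_pos.2 hrz)]
    linarith [le_max_right a' (z - η / 2)])
  rw [sign_neg (sub_neg.2 hrz), sign_eq_neg_one_iff] at h1
  exact absurd (hbefore r (le_max_left _ _) hrz) (not_lt.2 h1.le)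

namespace Wormhole

variable {S : Wormhole}

/-- A past-pointing lightlike and a future-pointing timelike vector have positive product. -/
theorem metric_pos_of_past_null_of_future_timelike {x u w : Vec} (hx : x ∈ spacetime)
    (hu : S.metric x u u = 0) (hu0 : u 0 < 0) (hw : S.metric x w w < 0) (hw0 : 0 < w 0) :
    0 < S.metric x u w := by
  -- The factor is chosen so that `w + a u` is tangent to the spacelike slice, whence `0 ≤ g(w,w) +
  -- 2 a g(u,w)` with `a > 0` and `g(w,w) < 0`.
  set a := -(w 0 / u 0) with ha
  have ha0 : 0 < a := neg_pos.2 (div_neg_of_pos_of_neg hw0 hu0)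
  set z := w + a • u with hz
  have hz0 : z 0 = 0 := by
    simp only [hz, Pi.add_apply, Pi.smul_apply, smul_eq_mul, ha]
    rw [neg_mul, div_mul_cancel₀ _ hu0.ne, add_neg_cancel]
  have e : S.metric x z z = S.metric x w w + 2 * a * S.metric x u w := by
    rw [hz, metric_add_left, metric_smul_left, S.metric_comm x w, metric_add_left,
      metric_smul_left, S.metric_comm x u (w + a • u), metric_add_left, metric_smul_left, hu,
      S.metric_comm x w u]
    ring
  have h0 : 0 ≤ S.metric x z z := by
    by_contra! h
    have := eq_zero_of_metric_self_nonpos hx hz0 h.le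
    rw [this, metric_zero_left] at h
    exact lt_irrefl _ h
  rw [e] at h0
  by_contra! h
  nlinarith

/-- The geodesic flow from `p` near a compact subset `Q` of the tangent bundle, extended to all
initial velocities by a field that agrees with the geodesic field only on a neighbourhood `O`
of `Q`. -/
structure GeodesicFlow (S : Wormhole) (p : Vec) (Q : Set (Vec × Vec)) where
  /-- The region where the flow follows geodesics. -/
  O : Set (Vec × Vec)
  /-- The flow. -/
  φ : Vec → ℝ → Vec × Vec
  isOpen : IsOpen O
  subset : Q ⊆ O
  subset_spacetime : O ⊆ spacetime ×ˢ univ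
  initial : ∀ v, φ v 0 = (p, v)
  eq_of_isGeodesic : ∀ c u, S.IsGeodesic c u → c 0 = p → (∀ s ∈ Icc (0 : ℝ) 1, (c s, u s) ∈ Q) →
    ∀ s ∈ Icc (0 : ℝ) 1, φ (u 0) s = (c s, u s)
  lipschitz : ∃ C : ℝ, 0 ≤ C ∧ ∀ v v', ∀ s ∈ Icc (0 : ℝ) 1, ‖φ v s - φ v' s‖ ≤ C * ‖v - v'‖
  continuousOn : ∀ v, ContinuousOn (φ v) (Icc 0 1)
  isGeodesic : ∀ v, (∀ s ∈ Icc (0 : ℝ) 1, φ v s ∈ O) →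
    S.IsGeodesic (fun s => (φ v s).1) (fun s => (φ v s).2)
  eq_zero : ∀ v, ∀ s ∈ Icc (0 : ℝ) 1, φ v s ∈ O → (φ v s).2 = 0 → v = 0
  zero : (p, 0) ∈ O → ∀ s ∈ Icc (0 : ℝ) 1, φ 0 s = (p, 0)
  exists_derivative : ∀ v, (∀ s ∈ Icc (0 : ℝ) 1, φ v s ∈ O) → ∃ D : ℝ → Vec →L[ℝ] Vec × Vec,
    (∀ w, D 0 w = (0, w)) ∧
    (∀ s ∈ Icc (0 : ℝ) 1, ∀ w, HasDerivWithinAt (fun s => D s w)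
      (fderiv ℝ S.spray (φ v s) (D s w)) (Icc 0 1) s) ∧
    ∀ s ∈ Icc (0 : ℝ) 1, HasStrictFDerivAt (fun v => φ v s) (D s) v

theorem nonempty_geodesicFlow (S : Wormhole) (p : Vec) {Q : Set (Vec × Vec)} (hQ : IsCompact Q)
    (hQs : Q ⊆ spacetime ×ˢ univ) : Nonempty (S.GeodesicFlow p Q) := by
  have hU : IsOpen (spacetime ×ˢ (univ : Set Vec)) := isOpen_spacetime.prod isOpen_univ
  obtain ⟨f, hf, hfc, O, hO, hQO, hOU, hfO⟩ :=
    exists_compactly_supported_extension hQ hU hQs S.contDiffOn_spray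
  obtain ⟨Φ, hΦ0, hΦ, ⟨C, hC, hlip⟩, hD⟩ := UnitIntervalFlow.exists_flow hf hfc
  obtain ⟨K, hK⟩ := ContDiff.lipschitzWith_of_hasCompactSupport hfc hf one_ne_zero
  have hstat : ∀ x, (x, (0 : Vec)) ∈ O → f (x, 0) = 0 := fun x hx => by
    rw [hfO hx]
    simp [spray, Γ_zero_left]
  refine ⟨⟨O, fun v => Φ (p, v), hO, hQO, hOU, fun v => hΦ0 _, ?_, ⟨C, hC, fun v v' s hs => ?_⟩,
    fun v s hs => (hΦ _ s hs).continuousWithinAt, ?_, ?_, ?_, ?_⟩⟩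
  · intro c u hcu hc0 hcQ s hs
    refine UnitIntervalFlow.unique hK (hΦ (p, u 0)) (Z := fun s => (c s, u s)) (fun s hs => ?_)
      (by rw [hΦ0, hc0]) hs
    rw [hfO (hQO (hcQ s hs))]
    exact (hcu s hs).2.1.prodMk (hcu s hs).2.2
  · refine (hlip _ _ s hs).trans (le_of_eq ?_)
    rw [Prod.mk_sub_mk, sub_self, Prod.norm_mk, norm_zero, max_eq_right (norm_nonneg _)]
  · intro v hv s hs
    have h := hΦ (p, v) s hs
    rw [hfO (hv s hs)] at h
    exact ⟨(hOU (hv s hs)).1, h.fst, h.snd⟩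
  · intro v s₀ hs₀ hO₀ h0
    have e : Φ (p, v) s₀ = ((Φ (p, v) s₀).1, 0) := Prod.ext rfl h0
    have h1 : f (Φ (p, v) s₀) = 0 := by
      rw [e]
      exact hstat _ (e ▸ hO₀)
    have hsub : Icc 0 s₀ ⊆ Icc (0 : ℝ) 1 := Icc_subset_Icc_right hs₀.2
    -- Zero velocity is an equilibrium of the field, so backward uniqueness makes the trajectory
    -- constant on `[0, s₀]`, and its initial velocity is zero too.
    have := ODE_solution_unique_of_mem_Icc_left (v := fun _ => f) (s := fun _ => univ) (K := K)
      (a := 0) (b := s₀) (f := Φ (p, v)) (g := fun _ => Φ (p, v) s₀)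
      (fun _ _ => hK.lipschitzOnWith)
      (fun s hs => ((hΦ (p, v) s (hsub hs)).continuousWithinAt).mono hsub)
      (fun s hs => (hΦ (p, v) s (hsub (Ioc_subset_Icc_self hs))).mono_of_mem_nhdsWithin
        (mem_of_superset (Icc_mem_nhdsLE hs.1) (Icc_subset_Icc_right (hs.2.trans hs₀.2))))
      (fun _ _ => mem_univ _) continuousOn_const
      (fun s _ => by simpa only [h1] using hasDerivWithinAt_const s (Iic s) (Φ (p, v) s₀))
      (fun _ _ => mem_univ _) rfl (left_mem_Icc.2 hs₀.1)
    rw [hΦ0, e] at this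
    exact congrArg Prod.snd this
  · intro hp s hs
    exact UnitIntervalFlow.unique hK (hΦ (p, 0)) (Z := fun _ => (p, 0)) (fun s _ => by
      simpa only [hstat p hp] using hasDerivWithinAt_const s (Icc 0 1) ((p, 0) : Vec × Vec))
      (hΦ0 _) hs
  · intro v hv
    obtain ⟨D, hD0, hD', hDs⟩ := hD (p, v)
    have hin : HasStrictFDerivAt (fun v : Vec => (p, v)) (ContinuousLinearMap.inr ℝ Vec Vec) v :=
      (hasStrictFDerivAt_const p v).prodMk (hasStrictFDerivAt_id v)
    refine ⟨fun s => (D s).comp (ContinuousLinearMap.inr ℝ Vec Vec), fun w => ?_, fun s hs w => ?_,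
      fun s hs => ?_⟩
    · rw [ContinuousLinearMap.comp_apply, hD0]
      rfl
    · have h1 : fderiv ℝ S.spray (Φ (p, v) s) = fderiv ℝ f (Φ (p, v) s) := by
        refine Filter.EventuallyEq.fderiv_eq ?_
        filter_upwards [hO.mem_nhds (hv s hs)] with z hz
        exact (hfO hz).symm
      rw [h1]
      exact hD' s hs _
    · exact HasStrictFDerivAt.comp (g := fun z => Φ z s) v (hDs s hs) hin

end Wormhole

end RotatingWormhole

end

/-! ### The exponential map, the Gauss lemma, and conjugate points. -/

noncomputable section

namespace RotatingWormhole

open Set Filter Topology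

theorem constant_unitInterval {f : ℝ → ℝ} {A : ℝ}
    (hf : ∀ s ∈ Icc (0 : ℝ) 1, HasDerivWithinAt f A (Icc 0 1) s) :
    ∀ s ∈ Icc (0 : ℝ) 1, f s = f 0 + A * s := by
  have hl : ∀ s ∈ Icc (0 : ℝ) 1, HasDerivWithinAt (fun s => f s - A * s) 0 (Icc 0 1) s :=
    fun s hs => by
      have h := (hf s hs).sub ((hasDerivWithinAt_id s (Icc 0 1)).const_mul A)
      rw [mul_one, sub_self] at h
      exact h
  intro s hs
  have h0 : (0 : ℝ) ∈ Icc (0 : ℝ) 1 := by simp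
  have h1 := monotoneOn_unitInterval hl (fun _ _ => le_rfl) h0 hs hs.1
  have h2 := monotoneOn_unitInterval (fun s hs => (hl s hs).neg) (fun _ _ => by simp) h0 hs hs.1
  simp only [Pi.neg_apply] at h1 h2
  linarith

namespace Wormhole

variable {S : Wormhole}

theorem IsGeodesic.energy_eq {c u : ℝ → Vec} (h : S.IsGeodesic c u) :
    ∀ s ∈ Icc (0 : ℝ) 1, S.metric (c s) (u s) (u s) = S.metric (c 0) (u 0) (u 0) := fun s hs => by
  have := constant_unitInterval (fun s hs => hasDerivWithinAt_energy (h s hs).1 (h s hs).2.1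
    (h s hs).2.2) s hs
  simpa using this

/-- A lightlike geodesic with nowhere vanishing tangent that does not end in the future is
past-pointing. -/
theorem IsGeodesic.isPastNullGeodesic {c u : ℝ → Vec} (h : S.IsGeodesic c u)
    (h0 : S.metric (c 0) (u 0) (u 0) = 0) (hu : ∀ s ∈ Icc (0 : ℝ) 1, u s ≠ 0)
    (hend : u 0 0 ≤ 0 ∨ c 1 0 < c 0 0) : S.IsPastNullGeodesic c u := by
  have hnull : ∀ s ∈ Icc (0 : ℝ) 1, S.metric (c s) (u s) (u s) = 0 := fun s hs => by
    rw [h.energy_eq s hs, h0]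
  have hne : ∀ s ∈ Icc (0 : ℝ) 1, u s 0 ≠ 0 := fun s hs h1 =>
    hu s hs (eq_zero_of_metric_self_nonpos (h s hs).1 h1 (hnull s hs).le)
  have hcont : ContinuousOn (fun s => u s 0) (Icc 0 1) := fun s hs =>
    (hasDerivWithinAt_pi.1 (h s hs).2.2 0).continuousWithinAt
  have hI0 : (0 : ℝ) ∈ Icc (0 : ℝ) 1 := by simp
  have hI1 : (1 : ℝ) ∈ Icc (0 : ℝ) 1 := by simp
  refine ⟨h, fun s hs => ⟨hnull s hs, ?_⟩⟩
  rcases (isPreconnected_Icc.image _ hcont).subset_or_subset isOpen_Iio isOpen_Ioi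
    (u := Iio 0) (v := Ioi 0) (disjoint_left.2 fun x hx hx' => lt_asymm hx hx')
    (by
      rintro _ ⟨s, hs, rfl⟩
      exact lt_or_gt_of_ne (hne s hs)) with h2 | h2
  · exact h2 (mem_image_of_mem _ hs)
  · exfalso
    have hpos : ∀ s ∈ Icc (0 : ℝ) 1, 0 < u s 0 := fun s hs => h2 (mem_image_of_mem _ hs)
    rcases hend with h3 | h3
    · exact absurd (hpos 0 hI0) (not_lt.2 h3)
    · have := monotoneOn_unitInterval (fun s hs => hasDerivWithinAt_pi.1 (h s hs).2.1 0)
        (fun s hs => (hpos s hs).le) hI0 hI1 zero_le_one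
      exact absurd h3 (not_lt.2 this)

namespace GeodesicFlow

variable {p : Vec} {Q : Set (Vec × Vec)} (F : S.GeodesicFlow p Q)

/-- The exponential map at `p`. -/
def exp (v : Vec) : Vec := (F.φ v 1).1

theorem continuous_φ {s : ℝ} (hs : s ∈ Icc (0 : ℝ) 1) : Continuous fun v => F.φ v s := by
  obtain ⟨C, hC, h⟩ := F.lipschitz
  exact (LipschitzWith.of_dist_le_mul (K := C.toNNReal) fun v v' => by
    rw [dist_eq_norm, dist_eq_norm, Real.coe_toNNReal _ hC]
    exact h v v' s hs).continuous

theorem eventually_mem {v : Vec} (hv : ∀ s ∈ Icc (0 : ℝ) 1, F.φ v s ∈ F.O) :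
    ∀ᶠ v' in 𝓝 v, ∀ s ∈ Icc (0 : ℝ) 1, F.φ v' s ∈ F.O := by
  obtain ⟨C, hC, h⟩ := F.lipschitz
  obtain ⟨δ, hδ, hδO⟩ := (isCompact_Icc.image_of_continuousOn (F.continuousOn v)).exists_thickening_subset_open
    F.isOpen (by rintro _ ⟨s, hs, rfl⟩; exact hv s hs)
  have hb : Metric.ball v (δ / (C + 1)) ∈ 𝓝 v := Metric.ball_mem_nhds v (by positivity)
  filter_upwards [hb] with v' hv' s hs
  refine hδO (Metric.mem_thickening_iff.2 ⟨_, mem_image_of_mem _ hs, ?_⟩)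
  rw [dist_eq_norm]
  refine (h v' v s hs).trans_lt ?_
  rw [mem_ball_iff_norm, lt_div_iff₀ (by positivity)] at hv'
  nlinarith [norm_nonneg (v' - v)]

theorem mem_spacetime {v : Vec} {s : ℝ} (h : F.φ v s ∈ F.O) : (F.φ v s).1 ∈ spacetime :=
  (F.subset_spacetime h).1

/-- Obtained by differentiating conservation of energy in the initial velocity. The left side is the
derivative supplied by `hasDerivWithinAt_momentum`, which is therefore constant in the curve
parameter. -/
theorem derivative_energy {v : Vec} (hv : ∀ s ∈ Icc (0 : ℝ) 1, F.φ v s ∈ F.O) {s : ℝ}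
    (hs : s ∈ Icc (0 : ℝ) 1) {D : Vec →L[ℝ] Vec × Vec}
    (hD : HasFDerivAt (fun v => F.φ v s) D v) (w : Vec) :
    (1 / 2) * S.dg (F.φ v s).1 (D w).1 (F.φ v s).2 (F.φ v s).2 +
      S.metric (F.φ v s).1 (F.φ v s).2 (D w).2 = S.metric p v w := by
  have hp : p ∈ spacetime := by
    have := F.mem_spacetime (hv 0 (by simp))
    rwa [F.initial] at this
  obtain ⟨A, hA, hA'⟩ := hasFDerivAt_energy (S := S) (F.mem_spacetime (hv s hs)) (F.φ v s).2
  obtain ⟨B, hB, hB'⟩ := hasFDerivAt_energy (S := S) hp v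
  have hl : HasDerivAt (fun ε : ℝ => v + ε • w) w 0 := by
    simpa using ((hasDerivAt_id (0 : ℝ)).smul_const w).const_add v
  have hv0 : v + (0 : ℝ) • w = v := by simp
  have hB0 : HasDerivAt (fun ε : ℝ => S.metric p (v + ε • w) (v + ε • w)) (B (0, w)) 0 := by
    rw [← hv0] at hB
    exact hB.comp_hasDerivAt (0 : ℝ) ((hasDerivAt_const (0 : ℝ) p).prodMk hl)
  have hφ : HasDerivAt (fun ε : ℝ => F.φ (v + ε • w) s) (D w) 0 := by
    rw [← hv0] at hD
    exact hD.comp_hasDerivAt (0 : ℝ) hl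
  have hA0 : HasDerivAt (fun ε : ℝ => S.metric (F.φ (v + ε • w) s).1 (F.φ (v + ε • w) s).2
      (F.φ (v + ε • w) s).2) (A (D w)) 0 := by
    have hA1 : HasFDerivAt (fun z : Vec × Vec => S.metric z.1 z.2 z.2) A
        (F.φ (v + (0 : ℝ) • w) s) := by
      rw [hv0]
      exact hA
    exact hA1.comp_hasDerivAt (0 : ℝ) hφ
  have heq : (fun ε : ℝ => S.metric (F.φ (v + ε • w) s).1 (F.φ (v + ε • w) s).2
      (F.φ (v + ε • w) s).2) =ᶠ[𝓝 0] fun ε => S.metric p (v + ε • w) (v + ε • w) := by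
    have ht : Tendsto (fun ε : ℝ => v + ε • w) (𝓝 0) (𝓝 v) := by
      simpa only [ContinuousAt, hv0] using hl.continuousAt
    filter_upwards [ht.eventually (F.eventually_mem hv)] with ε hε
    have := (F.isGeodesic _ hε).energy_eq s hs
    simpa only [F.initial] using this
  have huniq := (hB0.congr_of_eventuallyEq heq).unique hA0
  have e : A (D w) = A ((D w).1, (D w).2) := rfl
  rw [hB', e, hA'] at huniq
  have h0 : S.dg p 0 v v = 0 := by rw [dg, map_zero]
  linarith

theorem hasDerivWithinAt_jacobi {v : Vec} {s : ℝ} (hs : F.φ v s ∈ F.O) {D : ℝ → Vec × Vec}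
    (hD : HasDerivWithinAt D (fderiv ℝ S.spray (F.φ v s) (D s)) (Icc 0 1) s) :
    HasDerivWithinAt (fun s => (D s).1) (D s).2 (Icc 0 1) s ∧
      HasDerivWithinAt (fun s => (D s).2)
        (-fderiv ℝ (fun y => S.Γ y (F.φ v s).2 (F.φ v s).2) (F.φ v s).1 (D s).1 -
          (2 : ℝ) • S.Γ (F.φ v s).1 (F.φ v s).2 (D s).2) (Icc 0 1) s := by
  have h := fderiv_spray (S := S) (F.mem_spacetime hs) (F.φ v s).2 (D s).1 (D s).2
  have h' : fderiv ℝ S.spray (F.φ v s) (D s) = _ := h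
  rw [h'] at hD
  exact ⟨hD.fst, hD.snd⟩

/-- The Gauss lemma. -/
theorem gauss {v : Vec} (hv : ∀ s ∈ Icc (0 : ℝ) 1, F.φ v s ∈ F.O) {D : ℝ → Vec →L[ℝ] Vec × Vec}
    (hD0 : ∀ w, D 0 w = (0, w))
    (hD : ∀ s ∈ Icc (0 : ℝ) 1, ∀ w, HasDerivWithinAt (fun s => D s w)
      (fderiv ℝ S.spray (F.φ v s) (D s w)) (Icc 0 1) s)
    (hDs : ∀ s ∈ Icc (0 : ℝ) 1, HasStrictFDerivAt (fun v => F.φ v s) (D s) v) (w : Vec) :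
    S.metric (F.φ v 1).1 (F.φ v 1).2 (D 1 w).1 = S.metric p v w := by
  have hder : ∀ s ∈ Icc (0 : ℝ) 1, HasDerivWithinAt
      (fun s => S.metric (F.φ v s).1 (F.φ v s).2 (D s w).1) (S.metric p v w) (Icc 0 1) s :=
    fun s hs => by
      have hgeo := F.isGeodesic v hv s hs
      have hJ := (F.hasDerivWithinAt_jacobi (D := fun s => D s w) (hv s hs) (hD s hs w)).1
      have := hasDerivWithinAt_momentum (S := S) (c := fun s => (F.φ v s).1)
        (u := fun s => (F.φ v s).2) (J := fun s => (D s w).1) (P := (D s w).2)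
        hgeo.1 hgeo.2.1 hgeo.2.2 hJ
      exact this.congr_deriv (F.derivative_energy hv hs (hDs s hs).hasFDerivAt w)
  have h1 := constant_unitInterval hder 1 (by simp)
  have h2 : (D 0 w).1 = 0 := by rw [hD0]
  simp only [h2] at h1
  rw [h1, S.metric_comm _ _ (0 : Vec), metric_zero_left, zero_add, mul_one]

/-- At a velocity whose geodesic has no conjugate endpoint, the exponential map is an immersion. -/
theorem injective_derivative {v : Vec} (hv : ∀ s ∈ Icc (0 : ℝ) 1, F.φ v s ∈ F.O)
    {D : ℝ → Vec →L[ℝ] Vec × Vec} (hD0 : ∀ w, D 0 w = (0, w))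
    (hD : ∀ s ∈ Icc (0 : ℝ) 1, ∀ w, HasDerivWithinAt (fun s => D s w)
      (fderiv ℝ S.spray (F.φ v s) (D s w)) (Icc 0 1) s)
    (hconj : ∀ J : ℝ → Vec, S.IsJacobiField (fun s => (F.φ v s).1) (fun s => (F.φ v s).2) J →
      J 0 = 0 → J 1 = 0 → ∀ s ∈ Icc (0 : ℝ) 1, J s = 0) :
    Function.Injective ((ContinuousLinearMap.fst ℝ Vec Vec).comp (D 1)) := by
  refine (injective_iff_map_eq_zero _).2 fun w hw => ?_
  have hI0 : (0 : ℝ) ∈ Icc (0 : ℝ) 1 := by simp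
  have hJ := fun s hs => F.hasDerivWithinAt_jacobi (D := fun s => D s w) (hv s hs) (hD s hs w)
  -- A kernel vector `w` yields a Jacobi field vanishing at both ends, hence identically, and its
  -- initial derivative is `w`.
  have hz := hconj (fun s => (D s w).1)
    ⟨fun s => (D s w).2, hJ⟩ (by simp [hD0]) hw
  have h1 := (hJ 0 hI0).1
  have h2 : HasDerivWithinAt (fun s => (D s w).1) 0 (Icc 0 1) 0 :=
    (hasDerivWithinAt_const (0 : ℝ) (Icc (0 : ℝ) 1) (0 : Vec)).congr_of_mem hz hI0
  have := (uniqueDiffOn_Icc zero_lt_one 0 hI0).eq_deriv _ h1 h2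
  simpa [hD0] using this

/-- Covers a limit velocity equal to zero, where the geodesic is constant and the caustic says
nothing: the Jacobi equation becomes `J'' = 0`. -/
theorem jacobi_eq_zero_of_constant {J : ℝ → Vec} {c u : ℝ → Vec}
    (hu : ∀ s ∈ Icc (0 : ℝ) 1, u s = 0) (hJ : S.IsJacobiField c u J) (h0 : J 0 = 0) (h1 : J 1 = 0) :
    ∀ s ∈ Icc (0 : ℝ) 1, J s = 0 := by
  obtain ⟨P, hP⟩ := hJ
  have hP' : ∀ s ∈ Icc (0 : ℝ) 1, HasDerivWithinAt P 0 (Icc 0 1) s := fun s hs => by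
    have := (hP s hs).2
    rw [hu s hs] at this
    simpa [Γ_zero_left] using this
  have hconst : ∀ i, ∀ s ∈ Icc (0 : ℝ) 1, P s i = P 0 i := fun i s hs => by
    have := constant_unitInterval (fun s hs => hasDerivWithinAt_pi.1 (hP' s hs) i) s hs
    simpa using this
  have hlin : ∀ i, ∀ s ∈ Icc (0 : ℝ) 1, J s i = P 0 i * s := fun i s hs => by
    have := constant_unitInterval (f := fun s => J s i) (A := P 0 i) (fun s hs => by
      rw [← hconst i s hs]
      exact hasDerivWithinAt_pi.1 (hP s hs).1 i) s hs
    simpa [h0] using this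
  intro s hs
  funext i
  have := hlin i 1 (by simp)
  rw [h1, mul_one] at this
  rw [hlin i s hs, ← this]
  simp

end GeodesicFlow

end Wormhole

end RotatingWormhole

end

/-! ### Local uniqueness of the intersections with γ, and finiteness. -/

noncomputable section

namespace RotatingWormhole

open Set Filter Topology

namespace Wormhole

variable {S : Wormhole}

namespace GeodesicFlow

variable {p : Vec} {Q : Set (Vec × Vec)} (F : S.GeodesicFlow p Q)

theorem isPastNull {v : Vec} (hv : ∀ s ∈ Icc (0 : ℝ) 1, F.φ v s ∈ F.O)
    (hnull : S.metric p v v = 0) (hv0 : v ≠ 0) (hend : v 0 ≤ 0 ∨ F.exp v 0 < p 0) :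
    S.IsPastNullGeodesic (fun s => (F.φ v s).1) (fun s => (F.φ v s).2) := by
  refine (F.isGeodesic v hv).isPastNullGeodesic ?_ (fun s hs h => hv0 (F.eq_zero v s hs (hv s hs) h))
    ?_
  · simpa only [F.initial] using hnull
  · simpa only [F.initial, exp] using hend

/-- Near a velocity where the exponential map is an immersion, a timelike curve meets the past
light-cone at most once. -/
theorem exists_nhds_unique {τa : EReal} {γ : ℝ → Vec} (hγ : S.IsTimelikeCurve τa γ) {L : ℝ}
    (hL : ∀ τ : ℝ, (τ : EReal) < τa → τ ≤ p 0 → |ell (γ τ)| ≤ L) {a : Vec}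
    (ha : ∀ s ∈ Icc (0 : ℝ) 1, F.φ a s ∈ F.O)
    (hconj : ∀ J : ℝ → Vec, S.IsJacobiField (fun s => (F.φ a s).1) (fun s => (F.φ a s).2) J →
      J 0 = 0 → J 1 = 0 → ∀ s ∈ Icc (0 : ℝ) 1, J s = 0) :
    ∃ M ∈ 𝓝 a, ∀ v₁ ∈ M, ∀ v₂ ∈ M, ∀ τ₁ τ₂ : ℝ, S.metric p v₁ v₁ = 0 → S.metric p v₂ v₂ = 0 →
      (τ₂ : EReal) < τa → τ₁ ≤ τ₂ → τ₂ < p 0 → F.exp v₁ = γ τ₁ → F.exp v₂ = γ τ₂ → v₁ = v₂ := by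
  have hI1 : (1 : ℝ) ∈ Icc (0 : ℝ) 1 := by simp
  have hexp : ∀ {v : Vec} {D : Vec →L[ℝ] Vec × Vec}, HasStrictFDerivAt (fun v => F.φ v 1) D v →
      HasStrictFDerivAt F.exp ((ContinuousLinearMap.fst ℝ Vec Vec).comp D) v := fun h => h.fst
  obtain ⟨D, hD0, hD, hDs⟩ := F.exists_derivative a ha
  obtain ⟨e, hae, he, hinj⟩ := exists_local_inverse (hexp (hDs 1 hI1))
    (F.injective_derivative ha hD0 hD hconj)
  obtain ⟨N, hNO, hN, haN⟩ := eventually_nhds_iff.1 (F.eventually_mem ha)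
  set T := e.target ∩ e.symm ⁻¹' N with hT
  have hTo : IsOpen T := e.isOpen_inter_preimage_symm hN
  have haT : F.exp a ∈ T := by
    rw [← he a]
    refine ⟨e.map_source hae, ?_⟩
    rw [mem_preimage, e.left_inv hae]
    exact haN
  obtain ⟨r, hr, hrT⟩ := Metric.isOpen_iff.1 hTo _ haT
  obtain ⟨B, hB, hlip⟩ := hγ.exists_lipschitz (a := F.exp a 0 - 1) hL
  -- Both hitting times lie within `r'` of the time of `exp a`, so the piece of γ between them stays
  -- within `2 B r' + r' ≤ r` of `exp a` and can be pulled back. The bound 1 keeps these times in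
  -- the range of the Lipschitz estimate.
  set r' := min 1 (r / (2 * B + 2)) with hr'
  have hr'0 : 0 < r' := lt_min one_pos (by positivity)
  have hexpc : Continuous F.exp := continuous_fst.comp (F.continuous_φ hI1)
  have hM : e.source ∩ F.exp ⁻¹' Metric.ball (F.exp a) r' ∈ 𝓝 a :=
    inter_mem (e.open_source.mem_nhds hae)
      (hexpc.continuousAt.preimage_mem_nhds (Metric.ball_mem_nhds _ hr'0))
  refine ⟨_, hM, ?_⟩
  rintro v₁ ⟨h1s, h1b⟩ v₂ ⟨h2s, h2b⟩ τ₁ τ₂ hn1 hn2 hτa hle hτp e1 e2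
  rcases eq_or_lt_of_le hle with heq | hlt
  · refine e.injOn h1s h2s ?_
    rw [he, he, e1, e2, heq]
  exfalso
  rw [mem_preimage, mem_ball_iff_norm, e1] at h1b
  rw [mem_preimage, mem_ball_iff_norm, e2] at h2b
  have hτ : ∀ τ, τ ≤ τ₂ → (τ : EReal) < τa := fun τ h => lt_of_le_of_mem h hτa
  have ht1 : |τ₁ - F.exp a 0| < r' := by
    have := (norm_le_pi_norm (γ τ₁ - F.exp a) 0).trans_lt h1b
    rwa [Pi.sub_apply, (hγ.2 τ₁ (hτ _ hle)).2.1] at this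
  have ht2 : |τ₂ - F.exp a 0| < r' := by
    have := (norm_le_pi_norm (γ τ₂ - F.exp a) 0).trans_lt h2b
    rwa [Pi.sub_apply, (hγ.2 τ₂ hτa).2.1] at this
  have hτT : ∀ τ ∈ Icc τ₁ τ₂, γ τ ∈ T := fun τ hτ' => by
    refine hrT (mem_ball_iff_norm.2 ?_)
    have hl := hlip τ₁ τ (by linarith [(abs_lt.1 ht1).1, min_le_left 1 (r / (2 * B + 2))]) hτ'.1
      (hτ'.2.trans hτp.le) (hτ τ hτ'.2)
    have h3 : τ - τ₁ ≤ 2 * r' := by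
      linarith [(abs_lt.1 ht1).1, (abs_lt.1 ht2).2, hτ'.2]
    have h4 : r' * (2 * B + 2) ≤ r := by
      rw [← le_div_iff₀ (by positivity)]
      exact min_le_right _ _
    calc ‖γ τ - F.exp a‖ = ‖(γ τ - γ τ₁) + (γ τ₁ - F.exp a)‖ := by rw [sub_add_sub_cancel]
      _ ≤ ‖γ τ - γ τ₁‖ + ‖γ τ₁ - F.exp a‖ := norm_add_le _ _
      _ < B * (τ - τ₁) + r' := add_lt_add_of_le_of_lt hl h1b
      _ ≤ B * (2 * r') + r' := by gcongr
      _ ≤ r := by nlinarith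
  -- the pull-back of the curve and the causal character of its position vector
  have hv : ∀ τ ∈ Icc τ₁ τ₂, ∃ v', HasDerivAt (fun τ => e.symm (γ τ)) v' τ ∧
      (S.metric p (e.symm (γ τ)) (e.symm (γ τ)) = 0 →
        0 < S.metric p (e.symm (γ τ)) v') := fun τ hτ' => by
    obtain ⟨hτt, hτN⟩ := hτT τ hτ'
    set v := e.symm (γ τ) with hvdef
    have hvO : ∀ s ∈ Icc (0 : ℝ) 1, F.φ v s ∈ F.O := hNO v hτN
    have hev : F.exp v = γ τ := by rw [← he, hvdef, e.right_inv hτt]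
    obtain ⟨D, hD0, hD, hDs⟩ := F.exists_derivative v hvO
    have hDv := (hexp (hDs 1 hI1)).hasFDerivAt
    have hi := hinj v (e.map_target hτt) _ hDv
    let D' : Vec ≃L[ℝ] Vec :=
      (LinearEquiv.ofInjectiveEndo (((ContinuousLinearMap.fst ℝ Vec Vec).comp (D 1) :
        Vec →L[ℝ] Vec) : Vec →ₗ[ℝ] Vec) hi).toContinuousLinearEquiv
    have hD' : (D' : Vec →L[ℝ] Vec) = (ContinuousLinearMap.fst ℝ Vec Vec).comp (D 1) := by
      ext x; rfl
    have hsymm : HasFDerivAt e.symm (D'.symm : Vec →L[ℝ] Vec) (γ τ) := by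
      refine e.hasFDerivAt_symm hτt ?_
      rw [hD']
      exact hDv.congr_of_eventuallyEq (Eventually.of_forall he)
    have hγτ := hγ.hasDerivAt (hτ τ hτ'.2)
    refine ⟨_, hsymm.comp_hasDerivAt τ hγτ, fun hnull => ?_⟩
    -- The vector inserted is the derivative of the pulled-back curve, and the exponential map sends
    -- it to `γ'`. The Gauss lemma thus moves its product with `v` from `p` to the end of the
    -- geodesic.
    have hg := F.gauss hvO hD0 hD hDs (D'.symm (deriv γ τ))
    have hD1 : (D 1 (D'.symm (deriv γ τ))).1 = deriv γ τ := by
      have := congrArg (fun A : Vec →L[ℝ] Vec => A (D'.symm (deriv γ τ))) hD'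
      exact this.symm.trans (D'.apply_symm_apply _)
    rw [hD1] at hg
    have htime : γ τ 0 < p 0 := by
      rw [(hγ.2 τ (hτ τ hτ'.2)).2.1]
      exact hτ'.2.trans_lt hτp
    -- Zero velocity would give `exp v = p`, but `γ τ` is strictly earlier than `p`.
    have hv0 : v ≠ 0 := fun h0 => by
      have h3 := F.zero (by
        have := hvO 0 (by simp)
        rwa [F.initial, h0] at this) 1 hI1
      rw [h0, exp, h3] at hev
      rw [← hev] at htime
      exact lt_irrefl _ htime
    have hpast := F.isPastNull hvO hnull hv0 (Or.inr (by rw [hev]; exact htime))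
    obtain ⟨hn, hu0⟩ := hpast.2 1 hI1
    obtain ⟨-, -, htl⟩ := hγ.2 τ (hτ τ hτ'.2)
    have hxs := F.mem_spacetime (hvO 1 hI1)
    have := metric_pos_of_past_null_of_future_timelike (S := S) (w := deriv γ τ) hxs hn hu0
      (by rw [← hev] at htl; exact htl) (by rw [hγ.deriv_zero (hτ τ hτ'.2)]; exact one_pos)
    rw [hg] at this
    exact this
  choose! v' hv' hpos using hv
  have hp : p ∈ spacetime := by
    have := F.mem_spacetime (ha 0 (by simp))
    rwa [F.initial] at this
  have hq : ∀ τ ∈ Icc τ₁ τ₂, HasDerivAt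
      (fun τ => S.metric p (e.symm (γ τ)) (e.symm (γ τ)))
      (2 * S.metric p (e.symm (γ τ)) (v' τ)) τ := fun τ hτ' => by
    have := (hasDerivWithinAt_metric (S := S) (I := univ) (s := τ) (c := fun _ => p) hp
      (hasDerivAt_const τ p).hasDerivWithinAt (hv' τ hτ').hasDerivWithinAt
      (hv' τ hτ').hasDerivWithinAt).hasDerivAt univ_mem
    refine this.congr_deriv ?_
    rw [dg, map_zero, S.metric_comm p (v' τ)]
    ring
  refine false_of_upward_crossings hlt hq (fun τ hτ' h0 => mul_pos two_pos (hpos τ hτ' h0)) ?_ ?_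
  · rw [← e1, ← he, e.left_inv h1s]
    exact hn1
  · rw [← e2, ← he, e.left_inv h2s]
    exact hn2

end GeodesicFlow

/-- Initial velocities of the lightlike geodesics from `p` to `γ` that avoid `W`. -/
def avoidingVelocities (S : Wormhole) (p : Vec) (A W : Set Vec) : Set Vec :=
  {v | ∃ c u : ℝ → Vec, S.IsPastNullGeodesic c u ∧ c 0 = p ∧ u 0 = v ∧ c 1 ∈ A ∧
    ∀ s ∈ Icc (0 : ℝ) 1, c s ∉ W}

/-- An infinite set of velocities in a compact set accumulates at some `a`. Closedness keeps the
trajectory of `a` in `Q` and puts its endpoint in the closure of γ, away from the caustic, so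
`exists_nhds_unique` applies at `a`. -/
theorem finite_avoidingVelocities {p : Vec} {Q : Set (Vec × Vec)} (hQ : IsCompact Q)
    (F : S.GeodesicFlow p Q) {τa : EReal} {γ : ℝ → Vec} (hγ : S.IsTimelikeCurve τa γ)
    (hcaustic : Disjoint (closure (γ '' {τ : ℝ | (τ : EReal) < τa})) (S.caustic p)) {L : ℝ}
    (hL : ∀ τ : ℝ, (τ : EReal) < τa → τ ≤ p 0 → |ell (γ τ)| ≤ L) {W : Set Vec}
    (hconf : ∀ c u : ℝ → Vec, S.IsPastNullGeodesic c u → c 0 = p →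
      c 1 ∈ γ '' {τ : ℝ | (τ : EReal) < τa} → (∀ s ∈ Icc (0 : ℝ) 1, c s ∉ W) →
      ∀ s ∈ Icc (0 : ℝ) 1, (c s, u s) ∈ Q) :
    (S.avoidingVelocities p (γ '' {τ : ℝ | (τ : EReal) < τa}) W).Finite := by
  set Z := S.avoidingVelocities p (γ '' {τ : ℝ | (τ : EReal) < τa}) W with hZ
  have hI0 : (0 : ℝ) ∈ Icc (0 : ℝ) 1 := by simp
  have hI1 : (1 : ℝ) ∈ Icc (0 : ℝ) 1 := by simp
  have hZφ : ∀ v ∈ Z, (∀ s ∈ Icc (0 : ℝ) 1, F.φ v s ∈ Q) ∧ S.metric p v v = 0 ∧ v 0 < 0 ∧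
      ∃ τ : ℝ, (τ : EReal) < τa ∧ τ < p 0 ∧ F.exp v = γ τ := by
    rintro v ⟨c, u, hcu, hc0, rfl, ⟨τ, hτ, hτ'⟩, hcW⟩
    have hcQ := hconf c u hcu hc0 ⟨τ, hτ, hτ'⟩ hcW
    have hφ := F.eq_of_isGeodesic c u hcu.1 hc0 hcQ
    have h0 := hcu.2 0 hI0
    rw [hc0] at h0
    refine ⟨fun s hs => by rw [hφ s hs]; exact hcQ s hs, h0.1, h0.2, τ, hτ, ?_, ?_⟩
    · have := hcu.time_lt
      rwa [hc0, ← hτ', (hγ.2 τ hτ).2.1] at this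
    · rw [GeodesicFlow.exp, hφ 1 hI1, hτ']
  by_contra hinf
  have hKc : IsCompact (Prod.snd '' Q) := hQ.image continuous_snd
  obtain ⟨a, -, hacc⟩ := Set.Infinite.exists_accPt_of_subset_isCompact hinf hKc fun v hv => by
    have := (hZφ v hv).1 0 hI0
    rw [F.initial] at this
    exact ⟨_, this, rfl⟩
  rw [accPt_iff_frequently] at hacc
  have hacl : a ∈ closure Z := mem_closure_iff_frequently.2 (hacc.mono fun v hv => hv.2)
  have haQ : ∀ s ∈ Icc (0 : ℝ) 1, F.φ a s ∈ Q := fun s hs =>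
    hQ.isClosed.closure_subset (map_mem_closure (f := fun v => F.φ v s) (F.continuous_φ hs) hacl
      fun v hv => (hZφ v hv).1 s hs)
  have haO : ∀ s ∈ Icc (0 : ℝ) 1, F.φ a s ∈ F.O := fun s hs => F.subset (haQ s hs)
  have hexpc : Continuous F.exp := continuous_fst.comp (F.continuous_φ hI1)
  have hacγ : F.exp a ∈ closure (γ '' {τ : ℝ | (τ : EReal) < τa}) :=
    map_mem_closure hexpc hacl fun v hv => by
      obtain ⟨-, -, -, τ, hτ, -, h⟩ := hZφ v hv
      exact ⟨τ, hτ, h.symm⟩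
  have hanull : S.metric p a a = 0 := by
    have hc : Continuous fun v => S.metric p v v := by
      simp only [metric_eq_sum]
      fun_prop
    exact (isClosed_eq hc continuous_const).closure_subset_iff.2
      (fun v hv => (hZφ v hv).2.1) hacl
  have ha0 : a 0 ≤ 0 :=
    (isClosed_le (continuous_apply 0) continuous_const).closure_subset_iff.2
      (fun v hv => (hZφ v hv).2.2.1.le) hacl
  have hconj : ∀ J : ℝ → Vec, S.IsJacobiField (fun s => (F.φ a s).1) (fun s => (F.φ a s).2) J →
      J 0 = 0 → J 1 = 0 → ∀ s ∈ Icc (0 : ℝ) 1, J s = 0 := by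
    intro J hJ hJ0 hJ1
    by_cases h0 : a = 0
    · refine GeodesicFlow.jacobi_eq_zero_of_constant (fun s hs => ?_) hJ hJ0 hJ1
      have hpO : (p, (0 : Vec)) ∈ F.O := by
        have := haO 0 hI0
        rwa [F.initial, h0] at this
      rw [h0, F.zero hpO s hs]
    · by_contra! hne
      refine disjoint_left.1 hcaustic hacγ ⟨_, _, J, F.isPastNull haO hanull h0 (Or.inl ha0), ?_,
        rfl, hJ, hJ0, hJ1, hne⟩
      simp only [F.initial]
  obtain ⟨M, hM, huniq⟩ := F.exists_nhds_unique hγ hL haO hconj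
  have hfreq : ∀ M ∈ 𝓝 a, ∃ v ∈ M, v ≠ a ∧ v ∈ Z := fun M hM => by
    obtain ⟨v, h1, h2⟩ := (hacc.and_eventually hM).exists
    exact ⟨v, h2, h1⟩
  obtain ⟨v₁, h1M, h1a, h1Z⟩ := hfreq M hM
  -- As `v₁ ≠ a`, deleting `v₁` from `M` leaves a neighbourhood of `a`, which supplies a second,
  -- different velocity.
  obtain ⟨v₂, ⟨h2M, h2v⟩, -, h2Z⟩ := hfreq (M ∩ {v₁}ᶜ)
    (inter_mem hM (isOpen_compl_singleton.mem_nhds fun h => h1a (mem_singleton_iff.1 h).symm))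
  obtain ⟨-, hn1, -, τ₁, hτ1, hp1, e1⟩ := hZφ v₁ h1Z
  obtain ⟨-, hn2, -, τ₂, hτ2, hp2, e2⟩ := hZφ v₂ h2Z
  rcases le_total τ₁ τ₂ with h | h
  · exact h2v (huniq v₁ h1M v₂ h2M τ₁ τ₂ hn1 hn2 hτ2 h hp2 e1 e2).symm
  · exact h2v (huniq v₂ h2M v₁ h1M τ₂ τ₁ hn2 hn1 hτ1 h hp1 e2 e1)

end Wormhole

end RotatingWormhole

end

theorem mainTheorem2 (S : RotatingWormhole.Wormhole)
    (p : RotatingWormhole.Vec) (hp : p ∈ RotatingWormhole.spacetime)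
    (τa : EReal) (hτa : ⊥ < τa) (γ : ℝ → RotatingWormhole.Vec)
    (hγ : S.IsTimelikeCurve τa γ)
    (hcaustic : Disjoint (closure (γ '' {τ : ℝ | (τ : EReal) < τa})) (S.caustic p))
    (hbounded : ∃ B T : ℝ, ∀ τ : ℝ, (τ : EReal) < τa → τ ≤ T → |RotatingWormhole.ell (γ τ)| ≤ B)
    (W : Set RotatingWormhole.Vec) (hW : IsOpen W) (hKW : S.K ⊆ W)
    (hstat : ∀ x ∈ W, ∀ a : ℝ, x + Pi.single 0 a ∈ W) :
    {G ∈ S.pastNullArcs p (γ '' {τ : ℝ | (τ : EReal) < τa}) | ¬ (G ∩ W).Nonempty}.Finite := by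
  obtain ⟨L, t, V, hL, hconf⟩ :=
    RotatingWormhole.Wormhole.exists_compact_confinement (p := p) hγ hbounded hW hKW hstat
  set Q := RotatingWormhole.slab L t (p 0) ×ˢ Metric.closedBall (0 : RotatingWormhole.Vec) V
  have hQ : IsCompact Q := (RotatingWormhole.isCompact_slab _ _ _).prod (isCompact_closedBall _ _)
  have hconfQ : ∀ c u : ℝ → RotatingWormhole.Vec, S.IsPastNullGeodesic c u → c 0 = p →
      c 1 ∈ γ '' {τ : ℝ | (τ : EReal) < τa} → (∀ s ∈ Set.Icc (0 : ℝ) 1, c s ∉ W) →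
      ∀ s ∈ Set.Icc (0 : ℝ) 1, (c s, u s) ∈ Q := fun c u h h0 h1 hcW s hs =>
    ⟨(hconf c u h h0 h1 hcW s hs).1, mem_closedBall_zero_iff.2 (hconf c u h h0 h1 hcW s hs).2⟩
  obtain ⟨F⟩ := S.nonempty_geodesicFlow p hQ
    (Set.prod_mono (RotatingWormhole.slab_subset _ _ _) (Set.subset_univ _))
  -- Each avoiding arc is the trace of the flow line of its initial velocity, so finitely many
  -- velocities give finitely many arcs.
  refine ((RotatingWormhole.Wormhole.finite_avoidingVelocities hQ F hγ hcaustic hL hconfQ).image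
    fun v => (fun s => (F.φ v s).1) '' Set.Icc 0 1).subset ?_
  rintro G ⟨⟨c, u, hcu, h0, h1, rfl⟩, hGW⟩
  have hcW : ∀ s ∈ Set.Icc (0 : ℝ) 1, c s ∉ W := fun s hs h =>
    hGW ⟨c s, Set.mem_image_of_mem c hs, h⟩
  refine ⟨u 0, ⟨c, u, hcu, h0, rfl, h1, hcW⟩, Set.image_congr fun s hs => ?_⟩
  rw [F.eq_of_isGeodesic c u hcu.1 h0 (hconfQ c u hcu h0 h1 hcW) s hs]
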